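/- Let $m>0$ and let $M=\mathbb{R}\times[m,\infty)\times\mathbb{S}^2\ni(t^*,r,\omega)$ be the extremal Reissner--Nordström exterior with metric $$g=-\Omega^2(dt^*)^2+2(1-\Omega^2)\,dt^*dr+(2-\Omega^2)\,dr^2+r^2d\omega^2,\qquad \Omega^2=\Big(1-\frac mr\Big)^2 .$$ Tangent vectors are written $p=(p^{t^*},p^r,\cancel p)$, with $|\cancel p|_{\cancel g}$ the length of the angular part with respect to $\cancel g=r^2d\omega^2$. Let $\mathcal P\subset TM$ be the bundle of nonzero future-directed null vectors, $E=\Omega^2p^{t^*}-(1-\Omega^2)p^r$, and equip each fibre $\mathcal P_x$ with the measure $d\mu_x=E^{-1}r^2\sin\theta\,dp^r\,dp^\theta\,dp^\phi$. For $r>m$ let $t=t^*-F(r)$ with $F(r)=2m\log(r-m)-\frac{m^2}{r-m}$, let $r^*$ satisfy $\frac{dr^*}{dr}=\Omega^{-2}$, $r^*(2m)=0$, and let $u=t-r^*$, $v=t+r^*$, $p^u=du(p)$, $p^v=dv(p)$. Fix $\rho>2$, set $R=\rho m$, and let $\tau=t^*$ for $r\le R$ and $\tau=u+c(R)$ for $r\ge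 R$, where the constant $c(R)$ makes $\tau$ continuous. Put $\Sigma_0=\{\tau=0\}$ and $\mathcal P_0=\mathcal P|_{\Sigma_0}$. Let $f_0:\mathcal P_0\to[0,\infty)$ be continuous and bounded, with $$\operatorname{supp}(f_0)\subset\{r\le C_r,\ p^{t^*}\le C_p,\ |p^r|\le C_p,\ |\cancel p|_{\cancel g}\le C_p\}$$ for some $C_r,C_p>0$, and let $\|f_0\|_{L^\infty}=\sup_{\mathcal P_0}f_0$. Let $f$ be the solution of the massless Vlasov equation on $\{\tau\ge0\}$ with data $f_0$, i.e. $f|_{\mathcal P_0}=f_0$ and, over $\{\tau>0\}$, $f$ is obtained by transporting $f_0$ along future-directed affinely parametrised null geodesics issuing from $\Sigma_0$. A continuous weight $w:\mathcal P\to[0,\infty)$ is called bounded in $x$ if it is bounded on each set $\{p^{t^*},|p^r|,|\cancel p|_{\cancel g}\le K\}\subset\mathcal P$, $K>0$; for such $w$ put $W=\sup\{w(x,p):(x,p)\in\operatorname{supp}(f),\ \tau(x)\ge0\}$. There are constants $C,C_0>0$ depending only on $\rho$ such that, with $\tau_\bullet=C_0\big(m+\frac{C_r^2}{m}\big)$,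 the following hold for all $m,C_r,C_p,f_0$ and $f$ as above. (i) For every continuous weight $w\ge0$ bounded in $x$ we have $W<\infty$, and for all $x\in M$ with $\tau(x)>\tau_\bullet$ $$\int_{\mathcal P_x}wf\,d\mu_x\le C\,W\,\|f_0\|_{L^\infty}\frac{C_p^2C_r^2}{r^2}\frac{m^2}{(\tau(x)-\tau_\bullet)^2}.$$ (ii) For all real $a,b,c\ge0$ there is a constant $C'>0$ depending only on $\rho,a,b,c$ such that for all $x\in M$ with $\tau(x)>\tau_\bullet$ and all $0<\delta<1$: if $r\ge(1+\delta)m$, then $$\int_{\mathcal P_x}|p^r|^a(p^{t^*})^b|\cancel p|_{\cancel g}^c f\,d\mu_x\le\frac{C'}{\delta^{2b}}\|f_0\|_{L^\infty}\frac{C_p^{2+a+b+c}C_r^{2+c}}{r^{2+c}}\Big(\frac m{\tau(x)-\tau_\bullet}\Big)^{2(1+a+b)+c};$$ if $m\le r\le(1+\delta)m$, then $$\int_{\mathcal P_x}|p^r|^a(p^{t^*})^b|\cancel p|_{\cancel g}^c f\,d\mu_x\le C'\|f_0\|_{L^\infty}\frac{C_p^{2+a+b+c}C_r^{2+c}}{r^{2+c}}\Big(\frac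 m{\tau(x)-\tau_\bullet}\Big)^{2(1+a)+c};$$ and if $r\ge R$, then $$\int_{\mathcal P_x}|p^v|^a|p^u|^b|\cancel p|_{\cancel g}^c f\,d\mu_x\le C'\|f_0\|_{L^\infty}\frac{C_p^{2+a+b+c}C_r^{2(1+b)+c}}{r^{2(1+b)+c}}\Big(\frac m{\tau(x)-\tau_\bullet}\Big)^{2(1+a+b)+c}.$$ (iii) For every $0<\delta<1$ there is $\mathfrak c>0$ depending only on $\rho$ and $\delta$ such that, if in addition $\operatorname{supp}(f_0)\subset\{r\ge(1+\delta)m\}$, then for every $w$ as in (i) and all $x\in M$ with $\tau(x)\ge\tau_\bullet$ $$\int_{\mathcal P_x}wf\,d\mu_x\le C\,W\,\|f_0\|_{L^\infty}\frac{C_r^2C_p^2}{r^2}e^{-\frac{\mathfrak c}{m}(\tau(x)-\tau_\bullet)},$$ and for every $0<\delta'<1$, if moreover $r\notin[(2-\delta')m,(2+\delta')m]$ and $\tau(x)\ge\tau_\bullet-m\log\delta'$, then the same bound holds with $e^{-\frac{2\mathfrak c}{m}(\tau(x)-\tau_\bullet)}$ in place of $e^{-\frac{\mathfrak c}{m}(\tau(x)-\tau_\bullet)}$.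 -/

import Mathlib

open MeasureTheory

open scoped ENNReal

noncomputable section

namespace ERN

/-- Euclidean three-space; the point `y = r ω` encodes the radius `r = ‖y‖` and the
direction `ω ∈ S²`. -/
abbrev Space := EuclideanSpace ℝ (Fin 3)

/-- Events `x = (t*, y)` in the global chart `(t*, r, ω) ↦ (t*, r ω)`; since the chart is
global, tangent vectors are also pairs `p = (p^{t*}, dy(p))`. -/
abbrev Event := ℝ × Space

/-- Points `(x, p)` of the tangent bundle. -/
abbrev Phase := Event × Event

/-- The area radius `r`. -/
def rad (x : Event) : ℝ := ‖x.2‖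

/-- `Ω² = (1 - m / r)²`. -/
def lapse (m r : ℝ) : ℝ := (1 - m / r) ^ 2

/-- The exterior `ℝ × [m, ∞) × S²`, including the event horizon `r = m`. -/
def exterior (m : ℝ) : Set Event := {x | m ≤ rad x}

/-- The component `p^{t*}`. -/
def pT (p : Event) : ℝ := p.1

/-- The component `p^r = dr(p)`. -/
def pR (x p : Event) : ℝ := inner ℝ x.2 p.2 / rad x

/-- The part of `p` tangent to the sphere of radius `r`. The spherical metric
`r² dω²` is the restriction of the Euclidean inner product to such vectors. -/
def slash (x p : Event) : Space := p.2 - (pR x p / rad x) • x.2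

/-- The length of the angular part of `p` with respect to `r² dω²`. -/
def pAng (x p : Event) : ℝ := ‖slash x p‖

/-- The extremal Reissner–Nordström metric
`-Ω² (dt*)² + 2 (1 - Ω²) dt* dr + (2 - Ω²) dr² + r² dω²`, as a bilinear form. -/
def metric (m : ℝ) (x p q : Event) : ℝ :=
  -lapse m (rad x) * (pT p * pT q)
    + (1 - lapse m (rad x)) * (pT p * pR x q + pR x p * pT q)
    + (2 - lapse m (rad x)) * (pR x p * pR x q)
    + inner ℝ (slash x p) (slash x q)

/-- The energy `E = -g(∂_{t*}, p) = Ω² p^{t*} - (1 - Ω²) p^r`. -/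
def energy (m : ℝ) (x p : Event) : ℝ := -metric m x (1, 0) p

/-- The mass-shell: future-directed (nonzero) null vectors over the exterior. As `t*` is a
time function up to and including the horizon, a null vector is future-directed if and only
if `p^{t*} = dt*(p) > 0`. -/
def massShell (m : ℝ) : Set Phase :=
  {z | z.1 ∈ exterior m ∧ metric m z.1 z.2 z.2 = 0 ∧ 0 < pT z.2}

/-- `γ : [a, b] → M` is an affinely parametrised future-directed null geodesic with velocity
`p`. The geodesic equation is written with its free index lowered and contracted with an
arbitrary constant vector `ξ`:
`d/ds (g_{μν} p^ν) ξ^μ = (1/2) (∂_μ g_{αβ}) p^α p^β ξ^μ`. -/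
def IsNullGeodesic (m a b : ℝ) (γ p : ℝ → Event) : Prop :=
  ∀ s ∈ Set.Icc a b,
    (γ s, p s) ∈ massShell m ∧
    HasDerivWithinAt γ (p s) (Set.Icc a b) s ∧
    ∀ ξ : Event,
      HasDerivWithinAt (fun σ => metric m (γ σ) (p σ) ξ)
        ((1 / 2) * fderiv ℝ (fun x => metric m x (p s) (p s)) (γ s) ξ) (Set.Icc a b) s

/-- The function `F` with `t* = t + F(r)`. -/
def bigF (m r : ℝ) : ℝ := 2 * m * Real.log (r - m) - m ^ 2 / (r - m)

/-- The Regge–Wheeler coordinate `r*`, normalised by `r*(2m) = 0`. -/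
def rStar (m r : ℝ) : ℝ :=
  r + 2 * m * Real.log (r - m) - m ^ 2 / (r - m) - 2 * m * Real.log m - m

/-- The double null coordinate `u = t - r*`. -/
def uCoord (m : ℝ) (x : Event) : ℝ := (x.1 - bigF m (rad x)) - rStar m (rad x)

/-- The double null coordinate `v = t + r*`. -/
def vCoord (m : ℝ) (x : Event) : ℝ := (x.1 - bigF m (rad x)) + rStar m (rad x)

/-- The component `p^u = du(p)`. -/
def pU (m : ℝ) (x p : Event) : ℝ := fderiv ℝ (uCoord m) x p

/-- The component `p^v = dv(p)`. -/
def pV (m : ℝ) (x p : Event) : ℝ := fderiv ℝ (vCoord m) x p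

/-- The constant making `tau` continuous at `r = R`. -/
def cConst (m R : ℝ) : ℝ :=
  R + 4 * m * Real.log (R - m) - 2 * m ^ 2 / (R - m) - 2 * m * Real.log m - m

/-- The time function: `t*` for `r ≤ R` and `u + c(R)` for `r ≥ R`. -/
def tau (m R : ℝ) (x : Event) : ℝ :=
  if rad x ≤ R then x.1 else uCoord m x + cConst m R

/-- The mass-shell over the initial hypersurface `Σ₀ = {τ = 0}`. -/
def initialShell (m R : ℝ) : Set Phase := {z | z ∈ massShell m ∧ tau m R z.1 = 0}

/-- The mass-shell over the future `{τ ≥ 0}` of the initial hypersurface. -/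
def futureShell (m R : ℝ) : Set Phase := {z | z ∈ massShell m ∧ 0 ≤ tau m R z.1}

/-- The (closed) support, relative to `A`, of a function on `A`. -/
def suppOn (A : Set Phase) (f : Phase → ℝ) : Set Phase :=
  A ∩ closure {z | z ∈ A ∧ f z ≠ 0}

/-- Continuous, bounded, nonnegative initial data whose support lies in
`{r ≤ Cr, p^{t*} ≤ Cp, |p^r| ≤ Cp, |p̸| ≤ Cp}`. -/
structure IsInitialData (m R Cr Cp : ℝ) (f₀ : Phase → ℝ) : Prop where
  continuousOn : ContinuousOn f₀ (initialShell m R)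
  nonneg : ∀ z ∈ initialShell m R, 0 ≤ f₀ z
  bounded : BddAbove (f₀ '' initialShell m R)
  support : ∀ z ∈ suppOn (initialShell m R) f₀,
    rad z.1 ≤ Cr ∧ pT z.2 ≤ Cp ∧ |pR z.1 z.2| ≤ Cp ∧ pAng z.1 z.2 ≤ Cp

/-- `f` is the solution of the massless Vlasov equation to the future of `Σ₀` with data `f₀`:
it restricts to `f₀` over `Σ₀` and is transported unchanged along every future-directed null
geodesic that starts on `Σ₀`. (The part `r ≥ R` of `Σ₀` is null; the radial outgoing
geodesics running inside it never leave `Σ₀` and impose no condition.) -/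
structure IsVlasovSolution (m R : ℝ) (f₀ f : Phase → ℝ) : Prop where
  initial : ∀ z ∈ initialShell m R, f z = f₀ z
  transport : ∀ (a b : ℝ) (γ p : ℝ → Event), a ≤ b → IsNullGeodesic m a b γ p →
    tau m R (γ a) = 0 → 0 < tau m R (γ b) → f (γ b, p b) = f₀ (γ a, p a)

/-- A nonnegative continuous weight on the mass-shell that is bounded in `x`: it is bounded on
every set `{p^{t*}, |p^r|, |p̸| ≤ K}`. -/
structure IsWeight (m : ℝ) (w : Phase → ℝ) : Prop where
  continuousOn : ContinuousOn w (massShell m)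
  nonneg : ∀ z ∈ massShell m, 0 ≤ w z
  boundedInX : ∀ K : ℝ, 0 < K →
    BddAbove (w '' {z | z ∈ massShell m ∧ pT z.2 ≤ K ∧ |pR z.1 z.2| ≤ K ∧ pAng z.1 z.2 ≤ K})

/-- `‖f₀‖_{L^∞}`. -/
def supNorm (m R : ℝ) (f₀ : Phase → ℝ) : ℝ := sSup (f₀ '' initialShell m R)

/-- `W`, the supremum of the weight on the support of `f` (over `{τ ≥ 0}`). -/
def weightSup (m R : ℝ) (w f : Phase → ℝ) : ℝ := sSup (w '' suppOn (futureShell m R) f)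

/-- The energy of a null vector as a function of its spatial part `q`:
`√((p^r)² + Ω² |p̸|²)`. -/
def shellEnergy (m : ℝ) (x : Event) (q : Space) : ℝ :=
  √(pR x (0, q) ^ 2 + lapse m (rad x) * pAng x (0, q) ^ 2)

/-- The null vector with spatial part `q`: `p^{t*}` is recovered from the mass-shell relation.
For `r > m` this parametrises the fibre over `x` by `q ≠ 0`; for `r = m` it parametrises, by
`{p^r < 0}`, the fibre without the null ray `p^r = 0`. -/
def lift (m : ℝ) (x : Event) (q : Space) : Event :=
  (if pR x (0, q) ≤ 0 then
      |pR x (0, q)| + pAng x (0, q) ^ 2 / (shellEnergy m x q + |pR x (0, q)|)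
    else
      (shellEnergy m x q + (1 - lapse m (rad x)) * pR x (0, q)) / lapse m (rad x),
   q)

/-- The measure `dμ_x` on the fibre `𝒫_x` of the mass-shell, in the parametrisation `lift`:
`r² sin θ / E dp^r dp^θ dp^φ`, which in Cartesian components is `(1 / E) d³q`. -/
def fibreMeasure (m : ℝ) (x : Event) : Measure Space :=
  (volume.restrict {q | (x, lift m x q) ∈ massShell m}).withDensity
    (fun q => ENNReal.ofReal (1 / energy m x (lift m x q)))

/-- The moment `∫_{𝒫_x} h dμ_x ∈ [0, ∞]` of a nonnegative function `h` on the mass-shell. -/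
def moment (m : ℝ) (x : Event) (h : Phase → ℝ) : ℝ≥0∞ :=
  ∫⁻ q, ENNReal.ofReal (h (x, lift m x q)) ∂(fibreMeasure m x)

/-- `τ_• = C₀ (m + Cr² / m)`. -/
def tauDot (C₀ m Cr : ℝ) : ℝ := C₀ * (m + Cr ^ 2 / m)

end ERN

end

/-! A null geodesic conserves the energy E and the angular momentum L = r|p̸|, and f is constant
along it. A moment at x is therefore at most ‖f₀‖ times a bound for the weight times the μ_x-measure
of the momenta whose geodesic, followed back, meets the support of f₀. For late τ(x) such momenta
are rare; there are only two ways to stay near the black hole for a long time.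

Trapping at r = 2m. Let k² = 1/(16m²) - Ω²/r², with k changing sign at the photon sphere, and ξ =
p^r. Then ξ - Lk and ξ + Lk solve scalar linear equations with rates -Lk' and +Lk', and their
product is the constant E² - (L/4m)². The second factor is at most E + L/(4m) in size while the
first is damped, so a long life forces L/E to be exponentially close to 4m.

Slowness at the horizon. The damping rate Lk' has to be compared with the passage of time, and it
degenerates at the horizon and at infinity. `escape_rate` shows that Y' ≤ 4000 m L k', where Y is t*
- r - 4m log r (comparable to τ) plus two nonnegative corrections. The one for ingoing motion from
far away is at most 12r at the start and is absorbed in τ_•. The one for outgoing motion near the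
horizon has no uniform bound. If it accounts for half of the elapsed time t, then E ≲ C_p m²/t² and
the orbit starts at r₀ - m ≲ m²/t. This dichotomy is `IsOrbit.slow_or_trapped`.

Measure. In Cartesian momenta dμ_x = d³q/E, and L² ≤ 4 C_r² C_p E on the support. Hence the momenta
with E ≤ e have measure of order C_r² C_p e / r², and e ~ C_p m²/t² gives the quadratic decay.
Polynomial weights gain further powers of E on this slow set. On the trapped set, with deviation ε
from criticality, a fixed angular part confines (p^r)² to a window of width of order ε, which costs
a factor √ε: always exponentially small. If the data stay away from the horizon, the slow case is
impossible once t > 48m/δ, and only the exponential part survives.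

Existence of the geodesics. The solution is known only through its values along geodesics, so each
(x, p) with E > 0 and τ(x) > 0 must be joined to Σ₀. In the Cartesian Kerr–Schild chart the spatial
motion is a central force problem, solved backwards in `exists_orbit`. -/

namespace ERN

/-! ### Algebra of the mass shell in Kerr–Schild form. -/

/-- The component `dt* + dr`, conjugate to the ingoing null coordinate. -/
noncomputable def pIn (x p : Event) : ℝ := pT p + pR x p

theorem inner_self_eq_rad_sq (x : Event) : inner ℝ x.2 x.2 = rad x ^ 2 := by
  rw [real_inner_self_eq_norm_sq, rad]

theorem inner_eq_rad_mul_pR {x : Event} (hx : 0 < rad x) (p : Event) :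
    inner ℝ x.2 p.2 = rad x * pR x p := by
  rw [pR]; field_simp

theorem inner_slash_slash (x p q : Event) :
    inner ℝ (slash x p) (slash x q) = inner ℝ p.2 q.2 - pR x p * pR x q := by
  rcases (norm_nonneg x.2).eq_or_lt with h0 | hx
  · have : rad x = 0 := h0.symm
    simp [slash, pR, this]
  · change 0 < rad x at hx
    have h1 := inner_eq_rad_mul_pR hx q
    have h2 := inner_eq_rad_mul_pR hx p
    have h3 := inner_self_eq_rad_sq x
    have h4 : inner ℝ p.2 x.2 = rad x * pR x p := by rw [real_inner_comm, h2]
    simp only [slash, inner_sub_left, inner_sub_right, real_inner_smul_left,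
      real_inner_smul_right]
    rw [h3, h1, h4]
    field_simp
    ring

theorem pAng_sq (x p : Event) : pAng x p ^ 2 = ‖p.2‖ ^ 2 - pR x p ^ 2 := by
  rw [pAng, ← real_inner_self_eq_norm_sq, inner_slash_slash, real_inner_self_eq_norm_sq]
  ring

/-- The Kerr–Schild form of the metric. -/
theorem metric_eq (m : ℝ) (x p q : Event) :
    metric m x p q = -(pT p * pT q) + inner ℝ p.2 q.2
      + (1 - lapse m (rad x)) * (pIn x p * pIn x q) := by
  rw [metric, inner_slash_slash, pIn, pIn]; ring

theorem energy_eq (m : ℝ) (x p : Event) :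
    energy m x p = lapse m (rad x) * pIn x p - pR x p := by
  rw [energy, metric_eq, pIn]
  simp [pT, pR, pIn]; ring

theorem lapse_nonneg (m r : ℝ) : 0 ≤ lapse m r := sq_nonneg _

theorem lapse_eq {m r : ℝ} (hr : 0 < r) : lapse m r = (r - m) ^ 2 / r ^ 2 := by
  rw [lapse]; field_simp

theorem lapse_lt_one {m r : ℝ} (hm : 0 < m) (hr : m ≤ r) : lapse m r < 1 := by
  have h0 : 0 < r := hm.trans_le hr
  rw [lapse_eq h0, div_lt_one (by positivity)]
  nlinarith

theorem rad_pos {m : ℝ} (hm : 0 < m) {x : Event} (hx : x ∈ exterior m) : 0 < rad x :=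
  hm.trans_le hx

section shell

variable {m : ℝ} {x p : Event}

/-- The null condition in factored form. It still determines `pIn` at the horizon, where
`energy_sq_eq` loses the angular part. -/
theorem pAng_sq_eq (h : (x, p) ∈ massShell m) :
    pAng x p ^ 2 = pIn x p * (energy m x p - pR x p) := by
  have h2 : metric m x p p = 0 := h.2.1
  rw [metric_eq, real_inner_self_eq_norm_sq] at h2
  rw [pAng_sq, energy_eq]
  simp only [pIn] at *
  linear_combination h2

/-- Nullity reads (p^{t*})² = (p^r)² + |p̸|² + (1 - Ω²)(pIn)², a sum of nonnegative terms. Hence a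
bound on p^{t*} alone places p in a set on which weights are bounded. -/
theorem pAng_le_pT_and_abs_pR_le (hm : 0 < m) (h : (x, p) ∈ massShell m) :
    pAng x p ≤ pT p ∧ |pR x p| ≤ pT p := by
  have h2 : metric m x p p = 0 := h.2.1
  have h3 : 0 < pT p := h.2.2
  rw [metric_eq, real_inner_self_eq_norm_sq] at h2
  have h4 := pAng_sq x p
  have h5 : 0 ≤ (1 - lapse m (rad x)) * (pIn x p * pIn x p) :=
    mul_nonneg (sub_nonneg.2 (lapse_lt_one hm h.1).le) (mul_self_nonneg _)
  constructor
  · apply abs_le_of_sq_le_sq' _ h3.le |>.2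
    nlinarith [sq_nonneg (pR x p)]
  · apply abs_le_of_sq_le_sq _ h3.le
    nlinarith [sq_nonneg (pAng x p)]

theorem pIn_nonneg (hm : 0 < m) (h : (x, p) ∈ massShell m) : 0 ≤ pIn x p := by
  have := abs_le.1 (pAng_le_pT_and_abs_pR_le hm h).2
  rw [pIn]; linarith

theorem energy_sq_eq (h : (x, p) ∈ massShell m) :
    energy m x p ^ 2 = pR x p ^ 2 + lapse m (rad x) * pAng x p ^ 2 := by
  rw [pAng_sq_eq h, energy_eq]; ring

/-- The energy of a future-directed null vector is nonnegative, and vanishes only on the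
generators of the horizon. -/
theorem energy_pos (hm : 0 < m) (h : (x, p) ∈ massShell m) (h0 : m < rad x ∨ p.2 ≠ 0) :
    0 < energy m x p := by
  have hx : 0 < rad x := rad_pos hm h.1
  have h1 := pIn_nonneg hm h
  have h2 := lapse_nonneg m (rad x)
  have h3 := pAng_sq_eq h
  have h4 := energy_sq_eq h
  have h5 := pAng_sq x p
  have hT : 0 < pT p := h.2.2
  have e1 := energy_eq m x p
  have hE0 : 0 ≤ energy m x p := by
    by_contra hneg
    push Not at hneg
    have : 0 < pR x p := by nlinarith [mul_nonneg h2 h1]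
    have : 0 < pIn x p := by rw [pIn]; linarith
    nlinarith [sq_nonneg (pAng x p)]
  rcases hE0.eq_or_lt with hE | hE
  swap
  · exact hE
  exfalso
  rw [← hE] at h4 h3 e1
  have hR : pR x p = 0 := by
    have : 0 ≤ lapse m (rad x) * pAng x p ^ 2 := by positivity
    nlinarith [sq_nonneg (pR x p)]
  rw [hR] at h3 h5 e1
  rw [h3] at h5
  have hn : ‖p.2‖ = 0 := by nlinarith
  rcases h0 with h0 | h0
  · have h6 : 0 < lapse m (rad x) := by
      rw [lapse_eq hx]
      have : 0 < rad x - m := sub_pos.2 h0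
      positivity
    have h7 : 0 < pIn x p := by rw [pIn, hR]; linarith
    nlinarith [mul_pos h6 h7]
  · exact h0 (norm_eq_zero.1 hn)

theorem abs_pR_le_energy (hE : 0 ≤ energy m x p) (h : (x, p) ∈ massShell m) :
    |pR x p| ≤ energy m x p := by
  apply abs_le_of_sq_le_sq _ hE
  have := lapse_nonneg m (rad x)
  nlinarith [energy_sq_eq h, mul_nonneg this (sq_nonneg (pAng x p))]

end shell

end ERN

/-! ### The trapping function k and the pointwise escape inequality. -/

namespace ERN

/-- The function `k` with `k² = 1 / (16 m²) - Ω² / r²`, vanishing at the photon sphere. -/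
noncomputable def trapK (m r : ℝ) : ℝ :=
  (r - 2 * m) * √(r ^ 2 + 4 * m * r - 4 * m ^ 2) / (4 * m * r ^ 2)

/-- The derivative of `trapK`. -/
noncomputable def trapK' (m r : ℝ) : ℝ :=
  4 * m * (r - m) / (r ^ 3 * √(r ^ 2 + 4 * m * r - 4 * m ^ 2))

section trapK

variable {m r : ℝ}

theorem trapK_radicand_pos (hm : 0 < m) (hr : m ≤ r) : 0 < r ^ 2 + 4 * m * r - 4 * m ^ 2 := by
  nlinarith

theorem hasDerivAt_trapK (hm : 0 < m) (hr : m ≤ r) : HasDerivAt (trapK m) (trapK' m r) r := by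
  have hN := trapK_radicand_pos hm hr
  have hr0 : 0 < r := hm.trans_le hr
  have h0 : HasDerivAt (fun r : ℝ => r ^ 2) (2 * r) r := by simpa using hasDerivAt_pow 2 r
  have h1 : HasDerivAt (fun r : ℝ => r ^ 2 + 4 * m * r - 4 * m ^ 2) (2 * r + 4 * m * 1) r :=
    (h0.add ((hasDerivAt_id r).const_mul (4 * m))).sub_const (4 * m ^ 2)
  have h3 : HasDerivAt (trapK m) _ r :=
    (((hasDerivAt_id r).sub_const (2 * m)).mul (h1.sqrt hN.ne')).div (h0.const_mul (4 * m))
      (by positivity)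
  refine h3.congr_deriv ?_
  have hs := Real.sqrt_pos.2 hN
  have hs2 := Real.sq_sqrt hN.le
  simp only [trapK', id, Pi.mul_apply]
  set S := √(r ^ 2 + 4 * m * r - 4 * m ^ 2)
  field_simp
  rw [hs2]
  ring

theorem trapK_sq (hm : 0 < m) (hr : m ≤ r) :
    trapK m r ^ 2 = 1 / (16 * m ^ 2) - lapse m r / r ^ 2 := by
  have hr0 : 0 < r := hm.trans_le hr
  rw [trapK, lapse_eq hr0, div_pow, mul_pow, Real.sq_sqrt (trapK_radicand_pos hm hr).le]
  field_simp
  ring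

/-- This is half the derivative of k². Multiplied by L² it is the radial force, which is why ξ ± Lk
satisfy linear equations. -/
theorem trapK_mul_trapK' (hm : 0 < m) (hr : m ≤ r) :
    trapK m r * trapK' m r = (r - m) * (r - 2 * m) / r ^ 5 := by
  have hr0 : 0 < r := hm.trans_le hr
  have hs := Real.sqrt_pos.2 (trapK_radicand_pos hm hr)
  rw [trapK, trapK']
  set S := √(r ^ 2 + 4 * m * r - 4 * m ^ 2)
  field_simp

theorem trapK_abs_le (hm : 0 < m) (hr : m ≤ r) : |trapK m r| ≤ 1 / (4 * m) := by
  apply abs_le_of_sq_le_sq _ (by positivity)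
  have hr0 : 0 < r := hm.trans_le hr
  rw [trapK_sq hm hr]
  have : 0 ≤ lapse m r / r ^ 2 := div_nonneg (lapse_nonneg _ _) (by positivity)
  have e : (1 / (4 * m)) ^ 2 = 1 / (16 * m ^ 2) := by field_simp; norm_num
  linarith

theorem trapK_pos_iff (hm : 0 < m) (hr : m ≤ r) : 0 < trapK m r ↔ 2 * m < r := by
  have hr0 : 0 < r := hm.trans_le hr
  have hs := Real.sqrt_pos.2 (trapK_radicand_pos hm hr)
  rw [trapK, mul_div_assoc, mul_pos_iff_of_pos_right (by positivity), sub_pos]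

theorem trapK_nonneg_iff (hm : 0 < m) (hr : m ≤ r) : 0 ≤ trapK m r ↔ 2 * m ≤ r := by
  have hr0 : 0 < r := hm.trans_le hr
  have hs := Real.sqrt_pos.2 (trapK_radicand_pos hm hr)
  rw [trapK, mul_div_assoc, mul_nonneg_iff_of_pos_right (by positivity), sub_nonneg]

end trapK

/-- The pointwise inequality behind the escape estimate, in units `m = E = 1`. -/
theorem escape_rate_normalized {q x z : ℝ} (hq : 1 < q) (hz : 0 ≤ z) (hx : z ^ 2 = 1 - x ^ 2) :
    (1 + x) * q ^ 2 / (q - 1) ^ 2 - 2 * x - 4 * x / q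
      + (-12 * (1 + x) / (q - 1) ^ 2 - 6 * (1 - x) + 6 * (1 - x ^ 2) * (q + 4) / (q * (q - 1)))
      ≤ 16000 * z / (q * √(q ^ 2 + 4 * q - 4)) := by
  have hq1 : 0 < q - 1 := sub_pos.2 hq
  have hq0 : 0 < q := by linarith
  have hx1 : 0 ≤ 1 + x := by nlinarith [sq_nonneg z]
  have hx2 : 0 ≤ 1 - x := by nlinarith [sq_nonneg z]
  have hN : 0 < q ^ 2 + 4 * q - 4 := by nlinarith
  have hS := Real.sqrt_pos.2 hN
  have hrhs : 0 ≤ 16000 * z / (q * √(q ^ 2 + 4 * q - 4)) := by positivity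
  have h1 : (1 + x) * q ^ 2 / (q - 1) ^ 2 - 2 * x - 4 * x / q
      ≤ 3 * (1 + x) / (q - 1) ^ 2 + 3 * (1 - x) := by
    have : 3 * (1 + x) / (q - 1) ^ 2 + 3 * (1 - x) -
        ((1 + x) * q ^ 2 / (q - 1) ^ 2 - 2 * x - 4 * x / q)
        = (2 * (1 + x) + 2 * (1 - x) * (q - 1) ^ 3) / (q * (q - 1) ^ 2) := by
      field_simp
      ring
    have h : 0 ≤ (2 * (1 + x) + 2 * (1 - x) * (q - 1) ^ 3) / (q * (q - 1) ^ 2) := by positivity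
    linarith
  have h2 : 3 * (1 + x) / (q - 1) ^ 2 + 3 * (1 - x) +
      (-12 * (1 + x) / (q - 1) ^ 2 - 6 * (1 - x) + 6 * (1 - x ^ 2) * (q + 4) / (q * (q - 1)))
      = 6 * z ^ 2 * (q + 4) / (q * (q - 1)) - 9 * (1 + x) / (q - 1) ^ 2 - 3 * (1 - x) := by
    rw [hx]; ring
  have hz1 : z ≤ 1 := by nlinarith [sq_nonneg x]
  have hz2 : z ^ 2 = (1 + x) * (1 - x) := by rw [hx]; ring
  suffices h : 6 * z ^ 2 * (q + 4) / (q * (q - 1)) - 9 * (1 + x) / (q - 1) ^ 2 - 3 * (1 - x)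
      ≤ 16000 * z / (q * √(q ^ 2 + 4 * q - 4)) by linarith
  -- Close to the horizon and far out, the terms -9(1+x)/(q-1)² and -3(1-x) make the left side
  -- nonpositive. Only in between, around the photon sphere q = 2, is the right side used; there
  -- 16000 = 200 · 80, where 80 bounds q times the root.
  by_cases ha : q ≤ 1 + 3 / 20
  · refine le_trans ?_ hrhs
    have : 6 * z ^ 2 * (q + 4) / (q * (q - 1)) ≤ 9 * (1 + x) / (q - 1) ^ 2 := by
      rw [hz2, div_le_div_iff₀ (by positivity) (by positivity)]
      have e1 : (1 - x) * (q + 4) * (q - 1) ≤ 2 * (5 * q) * (3 / 20) := by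
        have : (1 - x) ≤ 2 := by linarith
        have : q + 4 ≤ 5 * q := by linarith
        gcongr; linarith
      have e2 : 0 ≤ (1 + x) * (q - 1) := by positivity
      nlinarith [mul_le_mul_of_nonneg_left e1 e2]
    linarith
  push Not at ha
  by_cases hb : q ≤ 8
  · have e1 : 6 * z ^ 2 * (q + 4) / (q * (q - 1)) ≤ 200 * z := by
      rw [div_le_iff₀ (by positivity)]
      have : z ^ 2 ≤ z := by nlinarith
      have : q + 4 ≤ 5 * q := by linarith
      have h3 : 6 * z ^ 2 * (q + 4) ≤ 6 * z * (5 * q) := by gcongr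
      have h4 : 0 ≤ z * q := by positivity
      nlinarith
    have e2 : 200 * z ≤ 16000 * z / (q * √(q ^ 2 + 4 * q - 4)) := by
      have : √(q ^ 2 + 4 * q - 4) ≤ 10 := by
        rw [Real.sqrt_le_iff]
        constructor <;> nlinarith
      rw [le_div_iff₀ (by positivity)]
      have h5 : q * √(q ^ 2 + 4 * q - 4) ≤ 8 * 10 := by gcongr
      nlinarith
    have e3 : 0 ≤ 9 * (1 + x) / (q - 1) ^ 2 := by positivity
    linarith
  · push Not at hb
    refine le_trans ?_ hrhs
    have e1 : 6 * z ^ 2 * (q + 4) / (q * (q - 1)) ≤ 9 * z ^ 2 / (q - 1) := by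
      rw [div_le_div_iff₀ (by positivity) (by positivity)]
      have : 6 * (q + 4) ≤ 9 * q := by linarith
      have h4 : 0 ≤ z ^ 2 * (q - 1) := by positivity
      nlinarith [mul_le_mul_of_nonneg_left this h4]
    have e2 : 9 * z ^ 2 / (q - 1) ≤ 9 * (1 + x) / (q - 1) ^ 2 + 3 * (1 - x) := by
      have : 9 * (1 + x) / (q - 1) ^ 2 + 3 * (1 - x) - 9 * z ^ 2 / (q - 1)
        = (9 * (1 + x) + 3 * (1 - x) * (q - 1) ^ 2 - 9 * z ^ 2 * (q - 1)) / (q - 1) ^ 2 := by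
        field_simp
      have h : 0 ≤ (9 * (1 + x) + 3 * (1 - x) * (q - 1) ^ 2 - 9 * z ^ 2 * (q - 1)) := by
        have f1 : z ^ 2 ≤ 1 := by nlinarith
        -- Subtracting 9/4 of this square leaves (1-x)(q-1)²(3 - 9z²/4), which is nonnegative
        -- because z² ≤ 1.
        have f2 : 0 ≤ (1 + x) * (2 - (1 - x) * (q - 1)) ^ 2 := by positivity
        have f3 : 0 ≤ (1 - z ^ 2) * ((1 - x) * (q - 1) ^ 2) :=
          mul_nonneg (by linarith) (by positivity)
        have f4 : z ^ 2 * (1 - x) = (1 + x) * (1 - x) * (1 - x) := by rw [hz2]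
        rw [hz2] at f3 ⊢
        nlinarith [mul_nonneg hx2 (sq_nonneg (q - 1))]
      have := div_nonneg h (sq_nonneg (q - 1))
      linarith
    linarith

end ERN

/-! ### Dynamics of the reduced radial system. -/

namespace ERN

/-- The reduced system satisfied by the radius `r`, the radial momentum `ξ = p^r`, the component
`pv = p^{t*} + p^r` and the time `T = t*` along a null geodesic of energy `E > 0` and angular
momentum `L` that stays outside the horizon except possibly at its endpoints. -/
structure IsOrbit (m E L a b : ℝ) (r ξ pv T : ℝ → ℝ) : Prop where
  m_pos : 0 < m
  E_pos : 0 < E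
  L_nonneg : 0 ≤ L
  le : a ≤ b
  r_ge : ∀ s ∈ Set.Icc a b, m ≤ r s
  r_gt : ∀ s ∈ Set.Ioo a b, m < r s
  deriv_r : ∀ s ∈ Set.Icc a b, HasDerivWithinAt r (ξ s) (Set.Icc a b) s
  deriv_ξ : ∀ s ∈ Set.Icc a b,
    HasDerivWithinAt ξ (L ^ 2 * ((r s - m) * (r s - 2 * m) / r s ^ 5)) (Set.Icc a b) s
  deriv_pv : ∀ s ∈ Set.Icc a b,
    HasDerivWithinAt pv ((L ^ 2 - m * (r s - m) * pv s ^ 2) / r s ^ 3) (Set.Icc a b) s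
  deriv_T : ∀ s ∈ Set.Icc a b, HasDerivWithinAt T (pv s - ξ s) (Set.Icc a b) s
  in_eq : ∀ s ∈ Set.Icc a b, pv s * (r s - m) ^ 2 = (E + ξ s) * r s ^ 2
  out_eq : ∀ s ∈ Set.Icc a b, pv s * (E - ξ s) * r s ^ 2 = L ^ 2
  pv_nonneg : ∀ s ∈ Set.Icc a b, 0 ≤ pv s
  abs_ξ_le : ∀ s ∈ Set.Icc a b, |ξ s| ≤ E

/-- The pointwise inequality behind the escape estimate. -/
theorem escape_rate {m E L r ξ pv : ℝ} (hm : 0 < m) (hE : 0 < E) (hL : 0 ≤ L) (hr : m < r)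
    (h1 : pv * (r - m) ^ 2 = (E + ξ) * r ^ 2) (h2 : pv * (E - ξ) * r ^ 2 = L ^ 2) :
    pv - ξ - ξ - 4 * m * (ξ / r)
      + (12 * m ^ 2 / E * (((L ^ 2 - m * (r - m) * pv ^ 2) / r ^ 3 * (r - m) + pv * ξ) / r ^ 2
          - pv * (r - m) * (2 * ξ / r ^ 3))
        + 6 / E * (ξ * (E - ξ) - r * (L ^ 2 * ((r - m) * (r - 2 * m) / r ^ 5))))
      ≤ 4000 * m * (L * trapK' m r) := by
  -- Units m = E = 1: with q = r/m, x = ξ/E and L = m E z q²/(q-1), the two null relations reduce to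
  -- z² = 1 - x².
  obtain ⟨q, rfl⟩ : ∃ q, r = m * q := ⟨r / m, by field_simp⟩
  obtain ⟨x, rfl⟩ : ∃ x, ξ = E * x := ⟨ξ / E, by field_simp⟩
  have hq : 1 < q := by nlinarith
  have hq1 : 0 < q - 1 := sub_pos.2 hq
  have hq0 : 0 < q := by linarith
  have hpv : pv = E * (1 + x) * q ^ 2 / (q - 1) ^ 2 := by
    rw [eq_div_iff (by positivity)]
    have : m ^ 2 * (pv * (q - 1) ^ 2) = m ^ 2 * (E * (1 + x) * q ^ 2) := by
      linear_combination h1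
    exact mul_left_cancel₀ (by positivity) this
  obtain ⟨z, rfl⟩ : ∃ z, L = m * E * z * q ^ 2 / (q - 1) :=
    ⟨L * (q - 1) / (m * E * q ^ 2), by field_simp⟩
  have hz : 0 ≤ z := by
    by_contra hneg
    push Not at hneg
    have : m * E * z * q ^ 2 / (q - 1) < 0 := by
      apply div_neg_of_neg_of_pos _ hq1
      have : 0 < m * E * q ^ 2 := by positivity
      nlinarith
    linarith
  have hzx : z ^ 2 = 1 - x ^ 2 := by
    rw [hpv] at h2
    field_simp at h2
    linear_combination -h2
  have key := escape_rate_normalized hq hz hzx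
  have hN : 0 < q ^ 2 + 4 * q - 4 := by nlinarith
  have hS := Real.sqrt_pos.2 hN
  have e1 : √((m * q) ^ 2 + 4 * m * (m * q) - 4 * m ^ 2) = m * √(q ^ 2 + 4 * q - 4) := by
    rw [show (m * q) ^ 2 + 4 * m * (m * q) - 4 * m ^ 2 = m ^ 2 * (q ^ 2 + 4 * q - 4) by ring,
      Real.sqrt_mul (by positivity), Real.sqrt_sq hm.le]
  have e2 : 4000 * m * (m * E * z * q ^ 2 / (q - 1) * trapK' m (m * q))
      = E * (16000 * z / (q * √(q ^ 2 + 4 * q - 4))) := by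
    rw [trapK', e1]
    set S := √(q ^ 2 + 4 * q - 4)
    field_simp
    ring
  rw [e2]
  refine le_trans (le_of_eq ?_) (mul_le_mul_of_nonneg_left key hE.le)
  have hL2 : (m * E * z * q ^ 2 / (q - 1)) ^ 2 =
      m ^ 2 * E ^ 2 * (1 - x ^ 2) * q ^ 4 / (q - 1) ^ 2 := by
    rw [← hzx]; field_simp
  rw [hL2, hpv, show m * q - m = m * (q - 1) by ring]
  field_simp
  ring

/-- A solution of a scalar linear equation is a positive multiple of its initial value. -/
theorem linear_ode_sign {a b : ℝ} {φ g : ℝ → ℝ} (hab : a ≤ b) (hg : ContinuousOn g (Set.Icc a b))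
    (hφ : ∀ s ∈ Set.Icc a b, HasDerivWithinAt φ (g s * φ s) (Set.Icc a b) s) :
    ∀ s ∈ Set.Icc a b, ∃ κ : ℝ, 0 < κ ∧ φ a = κ * φ s := by
  set G := Set.IccExtend hab (Set.domRestrict (Set.Icc a b) g) with hG
  have hGc : Continuous G := hg.domRestrict.Icc_extend'
  have hGe : ∀ s ∈ Set.Icc a b, G s = g s := fun s hs => by
    rw [hG, Set.IccExtend_of_mem _ _ hs]; rfl
  have hJ : ∀ s, HasDerivAt (fun s => ∫ t in a..s, G t) (G s) s := fun s =>
    (hGc.integral_hasStrictDerivAt a s).hasDerivAt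
  have hc : ∀ s ∈ Set.Icc a b, HasDerivWithinAt (fun s => φ s * Real.exp (-∫ t in a..s, G t)) 0
      (Set.Icc a b) s := fun s hs => by
    refine ((hφ s hs).mul (hJ s).neg.exp.hasDerivWithinAt).congr_deriv ?_
    simp only [Pi.neg_apply, hGe s hs]; ring
  intro s hs
  refine ⟨Real.exp (-∫ t in a..s, G t), Real.exp_pos _, ?_⟩
  have := constant_of_derivWithin_zero (f := fun s => φ s * Real.exp (-∫ t in a..s, G t))
    (fun s hs => (hc s hs).differentiableWithinAt)
    (fun s hs => by
      have hs' : s ∈ Set.Icc a b := Set.Ico_subset_Icc_self hs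
      exact (hc s hs').derivWithin (uniqueDiffOn_Icc (hs.1.trans_lt hs.2) s hs')) s hs
  simp only [intervalIntegral.integral_same, neg_zero, Real.exp_zero, mul_one] at this
  rw [← this]; ring

namespace IsOrbit

variable {m E L a b : ℝ} {r ξ pv T : ℝ → ℝ}

theorem r_pos (h : IsOrbit m E L a b r ξ pv T) {s : ℝ} (hs : s ∈ Set.Icc a b) : 0 < r s :=
  h.m_pos.trans_le (h.r_ge s hs)

theorem deriv_k (h : IsOrbit m E L a b r ξ pv T) {s : ℝ} (hs : s ∈ Set.Icc a b) :
    HasDerivWithinAt (fun s => trapK m (r s)) (trapK' m (r s) * ξ s) (Set.Icc a b) s :=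
  (hasDerivAt_trapK h.m_pos (h.r_ge s hs)).comp_hasDerivWithinAt s (h.deriv_r s hs)

/-- The stable combination `ξ - L k` is damped along the orbit. -/
theorem deriv_stable (h : IsOrbit m E L a b r ξ pv T) {s : ℝ} (hs : s ∈ Set.Icc a b) :
    HasDerivWithinAt (fun s => ξ s - L * trapK m (r s))
      (-(L * trapK' m (r s)) * (ξ s - L * trapK m (r s))) (Set.Icc a b) s := by
  refine ((h.deriv_ξ s hs).sub ((h.deriv_k hs).const_mul L)).congr_deriv ?_
  rw [← trapK_mul_trapK' h.m_pos (h.r_ge s hs)]; ring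

/-- The unstable combination `ξ + L k` is amplified along the orbit. -/
theorem deriv_unstable (h : IsOrbit m E L a b r ξ pv T) {s : ℝ} (hs : s ∈ Set.Icc a b) :
    HasDerivWithinAt (fun s => ξ s + L * trapK m (r s))
      ((L * trapK' m (r s)) * (ξ s + L * trapK m (r s))) (Set.Icc a b) s := by
  refine ((h.deriv_ξ s hs).add ((h.deriv_k hs).const_mul L)).congr_deriv ?_
  rw [← trapK_mul_trapK' h.m_pos (h.r_ge s hs)]; ring

theorem continuousOn_rate (h : IsOrbit m E L a b r ξ pv T) :
    ContinuousOn (fun s => L * trapK' m (r s)) (Set.Icc a b) := by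
  have hr : ContinuousOn r (Set.Icc a b) := fun s hs => (h.deriv_r s hs).continuousWithinAt
  unfold trapK'
  refine continuousOn_const.mul (ContinuousOn.div (by fun_prop) (by fun_prop) fun s hs => ?_)
  have h1 := h.r_pos hs
  have h2 := Real.sqrt_pos.2 (trapK_radicand_pos h.m_pos (h.r_ge s hs))
  positivity

theorem stable_sign (h : IsOrbit m E L a b r ξ pv T) {s : ℝ} (hs : s ∈ Set.Icc a b) :
    ∃ κ : ℝ, 0 < κ ∧ ξ a - L * trapK m (r a) = κ * (ξ s - L * trapK m (r s)) :=
  linear_ode_sign h.le h.continuousOn_rate.neg (fun _ hs => h.deriv_stable hs) s hs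

theorem unstable_sign (h : IsOrbit m E L a b r ξ pv T) {s : ℝ} (hs : s ∈ Set.Icc a b) :
    ∃ κ : ℝ, 0 < κ ∧ ξ a + L * trapK m (r a) = κ * (ξ s + L * trapK m (r s)) :=
  linear_ode_sign h.le h.continuousOn_rate (fun _ hs => h.deriv_unstable hs) s hs

theorem energy_eq (h : IsOrbit m E L a b r ξ pv T) {s : ℝ} (hs : s ∈ Set.Icc a b) :
    E ^ 2 = ξ s ^ 2 + L ^ 2 * (lapse m (r s) / r s ^ 2) := by
  have h1 := h.in_eq s hs
  have h2 := h.out_eq s hs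
  have h3 := h.r_pos hs
  rw [lapse_eq h3, ← h2]
  field_simp
  linear_combination (-E + ξ s) * h1

/-- Energy conservation ξ² + L²Ω²/r² = E² with k² substituted. The sign of the product tells on
which side of the critical value L = 4mE the orbit lies. -/
theorem stable_mul_unstable (h : IsOrbit m E L a b r ξ pv T) {s : ℝ} (hs : s ∈ Set.Icc a b) :
    (ξ s - L * trapK m (r s)) * (ξ s + L * trapK m (r s)) = E ^ 2 - (L / (4 * m)) ^ 2 := by
  have h1 := trapK_sq h.m_pos (h.r_ge s hs)
  have h2 := h.energy_eq hs
  have e : (L / (4 * m)) ^ 2 = L ^ 2 * (1 / (16 * m ^ 2)) := by ring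
  rw [e, h2]
  linear_combination (-L ^ 2) * h1

theorem abs_L_trapK_le (h : IsOrbit m E L a b r ξ pv T) {s : ℝ} (hs : s ∈ Set.Icc a b) :
    |L * trapK m (r s)| ≤ L / (4 * m) := by
  rw [abs_mul, abs_of_nonneg h.L_nonneg, div_eq_mul_one_div]
  exact mul_le_mul_of_nonneg_left (trapK_abs_le h.m_pos (h.r_ge s hs)) h.L_nonneg

/-- The potential barrier at r = 2m. If L > 4mE, the stable and unstable combinations have opposite
signs, and each keeps its sign along the orbit; then so does their difference 2Lk, which rules out a
crossing. -/
theorem le_energy_of_crossing (h : IsOrbit m E L a b r ξ pv T)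
    (hc : (r a ≤ 2 * m ∧ 2 * m ≤ r b) ∨ (2 * m ≤ r a ∧ r b ≤ 2 * m)) : L ≤ 4 * m * E := by
  by_contra hlt
  push Not at hlt
  have hm := h.m_pos
  have ha := Set.left_mem_Icc.2 h.le
  have hb := Set.right_mem_Icc.2 h.le
  have hLp : 0 < L := lt_trans (by have := h.E_pos; positivity) hlt
  have hD : E ^ 2 - (L / (4 * m)) ^ 2 < 0 := by
    have : E < L / (4 * m) := by rw [lt_div_iff₀ (by positivity)]; linarith
    have := h.E_pos
    nlinarith
  obtain ⟨κ, hκ, e1⟩ := h.stable_sign hb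
  obtain ⟨κ', hκ', e2⟩ := h.unstable_sign hb
  have p1 := h.stable_mul_unstable ha
  have p2 := h.stable_mul_unstable hb
  have ka := trapK_nonneg_iff hm (h.r_ge a ha)
  have kb := trapK_nonneg_iff hm (h.r_ge b hb)
  have ka' := trapK_pos_iff hm (h.r_ge a ha)
  have kb' := trapK_pos_iff hm (h.r_ge b hb)
  set A1 := ξ a - L * trapK m (r a)
  set A2 := ξ a + L * trapK m (r a)
  set B1 := ξ b - L * trapK m (r b)
  set B2 := ξ b + L * trapK m (r b)
  have da : A2 - A1 = 2 * L * trapK m (r a) := by simp only [A1, A2]; ring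
  have db : B2 - B1 = 2 * L * trapK m (r b) := by simp only [B1, B2]; ring
  have hneg : B1 * B2 < 0 := by linarith
  have key : ∀ {k1 k2 : ℝ}, A2 - A1 = 2 * L * k1 → B2 - B1 = 2 * L * k2 →
      k1 ≤ 0 → 0 ≤ k2 → False := by
    intro k1 k2 f1 f2 g1 g2
    have f3 : A2 ≤ A1 := by nlinarith
    have f4 : B1 ≤ B2 := by nlinarith
    rcases mul_neg_iff.1 hneg with ⟨u, v⟩ | ⟨u, v⟩
    · linarith
    · have : A1 < 0 := by rw [e1]; exact mul_neg_of_pos_of_neg hκ u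
      have : 0 < A2 := by rw [e2]; positivity
      linarith
  have key' : ∀ {k1 k2 : ℝ}, A2 - A1 = 2 * L * k1 → B2 - B1 = 2 * L * k2 →
      0 ≤ k1 → k2 ≤ 0 → False := by
    intro k1 k2 f1 f2 g1 g2
    have f3 : A1 ≤ A2 := by nlinarith
    have f4 : B2 ≤ B1 := by nlinarith
    rcases mul_neg_iff.1 hneg with ⟨u, v⟩ | ⟨u, v⟩
    · have : 0 < A1 := by rw [e1]; positivity
      have : A2 < 0 := by rw [e2]; exact mul_neg_of_pos_of_neg hκ' v
      linarith
    · linarith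
  rcases hc with ⟨c1, c2⟩ | ⟨c1, c2⟩
  · exact key da db (not_lt.1 fun hh => absurd (ka'.1 hh) (not_lt.2 c1)) (kb.2 c2)
  · exact key' da db (ka.2 c1) (not_lt.1 fun hh => absurd (kb'.1 hh) (not_lt.2 c2))

theorem antitoneOn_of_deriv {φ φ' : ℝ → ℝ}
    (hφ : ∀ s ∈ Set.Icc a b, HasDerivWithinAt φ (φ' s) (Set.Icc a b) s)
    (h0 : ∀ s ∈ Set.Ioo a b, φ' s ≤ 0) : AntitoneOn φ (Set.Icc a b) := by
  refine antitoneOn_of_deriv_nonpos (convex_Icc a b)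
    (fun s hs => (hφ s hs).continuousWithinAt) (fun s hs => ?_) (fun s hs => ?_)
  all_goals
    rw [interior_Icc] at hs
    have := (hφ s (Set.Ioo_subset_Icc_self hs)).hasDerivAt (Icc_mem_nhds hs.1 hs.2)
  · exact this.differentiableAt.differentiableWithinAt
  · rw [this.deriv]; exact h0 s hs

/-- Such an orbit has been ingoing all along. The stable combination is negative throughout. If the
unstable one is nonpositive, so is their mean ξ. If it is positive, then k > 0 throughout, the orbit
stays outside the photon sphere, and there ξ is nondecreasing. -/
theorem r_le_of_ingoing (h : IsOrbit m E L a b r ξ pv T) (h1 : 2 * m < r b) (h2 : ξ b < 0) :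
    r b ≤ r a := by
  have hm := h.m_pos
  have ha := Set.left_mem_Icc.2 h.le
  have hb := Set.right_mem_Icc.2 h.le
  suffices hξ : ∀ s ∈ Set.Icc a b, ξ s ≤ 0 from
    antitoneOn_of_deriv h.deriv_r (fun s hs => hξ s (Set.Ioo_subset_Icc_self hs)) ha hb h.le
  have kb : 0 ≤ L * trapK m (r b) :=
    mul_nonneg h.L_nonneg ((trapK_nonneg_iff hm (h.r_ge b hb)).2 h1.le)
  have hB : ∀ s ∈ Set.Icc a b, ξ s - L * trapK m (r s) < 0 := fun s hs => by
    obtain ⟨κ, hκ, e1⟩ := h.stable_sign hb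
    obtain ⟨κ', hκ', e2⟩ := h.stable_sign hs
    by_contra hcon
    push Not at hcon
    nlinarith [mul_nonneg hκ'.le hcon]
  by_cases hA : ξ b + L * trapK m (r b) ≤ 0
  · intro s hs
    have : ξ s + L * trapK m (r s) ≤ 0 := by
      obtain ⟨κ, hκ, e1⟩ := h.unstable_sign hb
      obtain ⟨κ', hκ', e2⟩ := h.unstable_sign hs
      by_contra hcon
      push Not at hcon
      nlinarith [mul_pos hκ' hcon]
    linarith [hB s hs]
  · push Not at hA
    have hk : ∀ s ∈ Set.Icc a b, 0 ≤ r s - 2 * m := fun s hs => by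
      have : 0 < ξ s + L * trapK m (r s) := by
        obtain ⟨κ, hκ, e1⟩ := h.unstable_sign hb
        obtain ⟨κ', hκ', e2⟩ := h.unstable_sign hs
        by_contra hcon
        push Not at hcon
        nlinarith [mul_pos hκ hA]
      have h3 := hB s hs
      have : 0 < trapK m (r s) := pos_of_mul_pos_right (by linarith : 0 < L * _) h.L_nonneg
      linarith [(trapK_pos_iff hm (h.r_ge s hs)).1 this]
    have hmono : AntitoneOn (fun s => -ξ s) (Set.Icc a b) :=
      antitoneOn_of_deriv (fun s hs => (h.deriv_ξ s hs).neg) fun s hs => by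
        have hs' := Set.Ioo_subset_Icc_self hs
        have := hk s hs'
        have := sub_nonneg.2 (h.r_ge s hs')
        have := h.r_pos hs'
        rw [neg_nonpos]; positivity
    intro s hs
    have := hmono hs hb hs.2
    simp only at this
    linarith

/-- Inside the photon sphere, an outgoing orbit has always been outgoing. -/
theorem outgoing_before (h : IsOrbit m E L a b r ξ pv T) (h1 : r b < 2 * m) (h2 : 0 < ξ b) :
    ∀ s ∈ Set.Icc a b, 0 ≤ ξ s ∧ r s ≤ 2 * m := by
  have hm := h.m_pos
  have hb := Set.right_mem_Icc.2 h.le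
  have kb : L * trapK m (r b) ≤ 0 := by
    refine mul_nonpos_of_nonneg_of_nonpos h.L_nonneg (not_lt.1 fun hh => ?_)
    linarith [(trapK_pos_iff hm (h.r_ge b hb)).1 hh]
  have hB : ∀ s ∈ Set.Icc a b, 0 < ξ s - L * trapK m (r s) := fun s hs => by
    obtain ⟨κ, hκ, e1⟩ := h.stable_sign hb
    obtain ⟨κ', hκ', e2⟩ := h.stable_sign hs
    by_contra hcon
    push Not at hcon
    nlinarith [mul_nonneg hκ'.le (neg_nonneg.2 hcon)]
  -- Mirror image of `r_le_of_ingoing`: either both combinations are nonnegative throughout, or k ≤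
  -- 0 throughout and ξ is nonincreasing.
  by_cases hA : 0 ≤ ξ b + L * trapK m (r b)
  · have hξ : ∀ s ∈ Set.Icc a b, 0 ≤ ξ s := fun s hs => by
      have : 0 ≤ ξ s + L * trapK m (r s) := by
        obtain ⟨κ, hκ, e1⟩ := h.unstable_sign hb
        obtain ⟨κ', hκ', e2⟩ := h.unstable_sign hs
        by_contra hcon
        push Not at hcon
        nlinarith [mul_pos hκ' (neg_pos.2 hcon), mul_nonneg hκ.le hA]
      linarith [hB s hs]
    have hmono : AntitoneOn (fun s => -r s) (Set.Icc a b) :=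
      antitoneOn_of_deriv (fun s hs => (h.deriv_r s hs).neg) fun s hs => by
        rw [neg_nonpos]; exact hξ s (Set.Ioo_subset_Icc_self hs)
    intro s hs
    have := hmono hs hb hs.2
    simp only at this
    exact ⟨hξ s hs, by linarith⟩
  · push Not at hA
    have hk : ∀ s ∈ Set.Icc a b, r s - 2 * m ≤ 0 := fun s hs => by
      have : ξ s + L * trapK m (r s) < 0 := by
        obtain ⟨κ, hκ, e1⟩ := h.unstable_sign hb
        obtain ⟨κ', hκ', e2⟩ := h.unstable_sign hs
        by_contra hcon
        push Not at hcon
        nlinarith [mul_pos hκ (neg_pos.2 hA), mul_nonneg hκ'.le hcon]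
      have h3 := hB s hs
      by_contra hcon
      push Not at hcon
      have := mul_nonneg h.L_nonneg
        ((trapK_nonneg_iff hm (h.r_ge s hs)).2 (by linarith : 2 * m ≤ r s))
      linarith
    have hmono : AntitoneOn ξ (Set.Icc a b) :=
      antitoneOn_of_deriv h.deriv_ξ fun s hs => by
        have hs' := Set.Ioo_subset_Icc_self hs
        have h3 := hk s hs'
        have h4 := sub_nonneg.2 (h.r_ge s hs')
        have := h.r_pos hs'
        have : (r s - m) * (r s - 2 * m) / r s ^ 5 ≤ 0 :=
          div_nonpos_of_nonpos_of_nonneg (mul_nonpos_of_nonneg_of_nonpos h4 h3) (by positivity)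
        nlinarith [sq_nonneg L]
    intro s hs
    have := hmono hs hb hs.2
    exact ⟨by linarith, by linarith [hk s hs]⟩

/-- The escape estimate: unless the orbit starts outgoing close to the horizon, it can only stay
in a bounded region for a long time if `L / E` is exponentially close to its critical value. -/
theorem escape (h : IsOrbit m E L a b r ξ pv T) :
    |E - L / (4 * m)| ≤ (E + L / (4 * m)) *
      Real.exp (-((T b - r b - 4 * m * Real.log (r b)) - (T a - r a - 4 * m * Real.log (r a))
        - 12 * m ^ 2 / E * (pv a * (r a - m) / r a ^ 2) - 12 * r a) / (4000 * m)) := by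
  have hm := h.m_pos
  have hE := h.E_pos
  have hL := h.L_nonneg
  have ha := Set.left_mem_Icc.2 h.le
  have hb := Set.right_mem_Icc.2 h.le
  -- Both corrections are nonnegative, so they may be dropped at b. At a the second is at most 12 r
  -- a, and the first is kept in the exponent.
  set Y : ℝ → ℝ := fun s => T s - r s - 4 * m * Real.log (r s)
    + (12 * m ^ 2 / E * (pv s * (r s - m) / r s ^ 2) + 6 / E * (r s * (E - ξ s))) with hY
  have hYd : ∀ s ∈ Set.Icc a b, HasDerivWithinAt Y
      (pv s - ξ s - ξ s - 4 * m * (ξ s / r s)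
      + (12 * m ^ 2 / E * (((L ^ 2 - m * (r s - m) * pv s ^ 2) / r s ^ 3 * (r s - m)
          + pv s * ξ s) / r s ^ 2 - pv s * (r s - m) * (2 * ξ s / r s ^ 3))
        + 6 / E * (ξ s * (E - ξ s) - r s * (L ^ 2 * ((r s - m) * (r s - 2 * m) / r s ^ 5)))))
      (Set.Icc a b) s := fun s hs => by
    have h0 := h.r_pos hs
    have d1 := (((h.deriv_T s hs).sub (h.deriv_r s hs)).sub
      (((h.deriv_r s hs).log h0.ne').const_mul (4 * m)))
    have d2 := ((((h.deriv_pv s hs).mul ((h.deriv_r s hs).sub_const m)).div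
      ((h.deriv_r s hs).pow 2) (by simp only [Pi.pow_apply]; positivity)).const_mul
        (12 * m ^ 2 / E))
    have d3 := (((h.deriv_r s hs).mul ((h.deriv_ξ s hs).const_sub E)).const_mul (6 / E))
    refine (d1.add (d2.add d3)).congr_deriv ?_
    simp only [Pi.pow_apply, Pi.mul_apply, Nat.cast_ofNat, Nat.add_one_sub_one, pow_one]
    field_simp
    ring
  -- Chosen so that c · 4000 m L k' = 2Lk', the damping rate of (ξ - Lk)².
  set c := 1 / (2000 * m) with hc
  have hc0 : 0 < c := by positivity
  have hanti : AntitoneOn (fun s => (ξ s - L * trapK m (r s)) ^ 2 * Real.exp (c * Y s))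
      (Set.Icc a b) := by
    refine antitoneOn_of_deriv (fun s hs => ((h.deriv_stable hs).pow 2).mul
      ((hYd s hs).const_mul c).exp) fun s hs => ?_
    have hs' := Set.Ioo_subset_Icc_self hs
    have hrate := escape_rate hm hE hL (h.r_gt s hs) (h.in_eq s hs') (h.out_eq s hs')
    have hcm : c * (4000 * m * (L * trapK' m (r s))) = 2 * (L * trapK' m (r s)) := by
      rw [hc]; field_simp; ring
    have hrate' := mul_le_mul_of_nonneg_left hrate hc0.le
    rw [hcm] at hrate'
    simp only [Pi.pow_apply, Nat.cast_ofNat, Nat.add_one_sub_one, pow_one]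
    set B := ξ s - L * trapK m (r s)
    have hpos : 0 ≤ B ^ 2 * Real.exp (c * Y s) := by positivity
    nlinarith [mul_le_mul_of_nonneg_left hrate' hpos]
  have hab := hanti ha hb h.le
  simp only at hab
  have hLm : 0 ≤ L / (4 * m) := by positivity
  have ba : (ξ a - L * trapK m (r a)) ^ 2 ≤ (E + L / (4 * m)) ^ 2 := by
    apply sq_le_sq'
    all_goals
      have := abs_le.1 (h.abs_ξ_le a ha)
      have := abs_le.1 (h.abs_L_trapK_le ha)
      linarith
  have bb : (ξ b + L * trapK m (r b)) ^ 2 ≤ (E + L / (4 * m)) ^ 2 := by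
    apply sq_le_sq'
    all_goals
      have := abs_le.1 (h.abs_ξ_le b hb)
      have := abs_le.1 (h.abs_L_trapK_le hb)
      linarith
  have hD := h.stable_mul_unstable hb
  set W := E + L / (4 * m) with hW
  have hWp : 0 < W := by positivity
  have hY1 : T b - r b - 4 * m * Real.log (r b) ≤ Y b := by
    have h1 : 0 ≤ 12 * m ^ 2 / E * (pv b * (r b - m) / r b ^ 2) := by
      have := h.pv_nonneg b hb
      have := sub_nonneg.2 (h.r_ge b hb)
      positivity
    have h2 : 0 ≤ 6 / E * (r b * (E - ξ b)) := by
      have := h.r_pos hb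
      have := sub_nonneg.2 (abs_le.1 (h.abs_ξ_le b hb)).2
      positivity
    simp only [hY]; linarith
  have hY2 : Y a ≤ T a - r a - 4 * m * Real.log (r a)
      + 12 * m ^ 2 / E * (pv a * (r a - m) / r a ^ 2) + 12 * r a := by
    have h2 : 6 / E * (r a * (E - ξ a)) ≤ 12 * r a := by
      have h3 := h.r_pos ha
      have h4 := (abs_le.1 (h.abs_ξ_le a ha)).1
      rw [div_mul_eq_mul_div, div_le_iff₀ hE]
      nlinarith
    simp only [hY]; linarith
  have hsq : (E - L / (4 * m)) ^ 2 * Real.exp (c * Y b) ≤ W ^ 2 * Real.exp (c * Y a) := by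
    -- The conserved product turns smallness of the stable factor at b into smallness of (E - L/4m)
    -- W; a factor W² is then cancelled.
    have e1 : ((E - L / (4 * m)) * W) ^ 2 * Real.exp (c * Y b)
        ≤ W ^ 2 * (W ^ 2 * Real.exp (c * Y a)) := by
      have : (E - L / (4 * m)) * W = E ^ 2 - (L / (4 * m)) ^ 2 := by rw [hW]; ring
      rw [this, ← hD, mul_pow]
      calc _ = (ξ b + L * trapK m (r b)) ^ 2 *
            ((ξ b - L * trapK m (r b)) ^ 2 * Real.exp (c * Y b)) := by ring
        _ ≤ W ^ 2 * ((ξ a - L * trapK m (r a)) ^ 2 * Real.exp (c * Y a)) := by gcongr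
        _ ≤ _ := by gcongr
    have e2 : W ^ 2 * ((E - L / (4 * m)) ^ 2 * Real.exp (c * Y b))
        ≤ W ^ 2 * (W ^ 2 * Real.exp (c * Y a)) := by
      refine le_trans (le_of_eq ?_) e1; ring
    exact le_of_mul_le_mul_left e2 (by positivity)
  apply abs_le_of_sq_le_sq _ (by positivity)
  rw [mul_pow, ← Real.exp_nat_mul]
  have e3 : (E - L / (4 * m)) ^ 2 ≤ W ^ 2 * Real.exp (c * Y a - c * Y b) := by
    rw [Real.exp_sub, ← mul_div_assoc, le_div_iff₀ (Real.exp_pos _)]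
    exact hsq
  refine e3.trans ?_
  gcongr
  have : c * Y a - c * Y b = -(Y b - Y a) / (2000 * m) := by rw [hc]; ring
  rw [this, Nat.cast_ofNat, ← mul_div_assoc, div_le_div_iff₀ (by positivity) (by positivity)]
  nlinarith

/-- By `outgoing_before`, ξ ≥ 0 and r ≤ 2m hold throughout, and the derivative of pv is a
nonnegative multiple of E(r - 2m) - ξ r. -/
theorem pv_le_of_outgoing (h : IsOrbit m E L a b r ξ pv T) (h1 : r b < 2 * m) (h2 : 0 < ξ b) :
    pv b ≤ pv a := by
  have hm := h.m_pos
  refine antitoneOn_of_deriv h.deriv_pv (fun s hs => ?_) (Set.left_mem_Icc.2 h.le)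
    (Set.right_mem_Icc.2 h.le) h.le
  have hs' := Set.Ioo_subset_Icc_self hs
  obtain ⟨h3, h4⟩ := h.outgoing_before h1 h2 s hs'
  have h5 := h.r_gt s hs
  have h6 := h.in_eq s hs'
  have h7 := h.out_eq s hs'
  have h8 := h.pv_nonneg s hs'
  have h9 := h.r_pos hs'
  apply div_nonpos_of_nonpos_of_nonneg _ (by positivity)
  have hd : 0 < r s - m := sub_pos.2 h5
  have e : (r s - m) * (L ^ 2 - m * (r s - m) * pv s ^ 2)
      = pv s * r s ^ 2 * ((E - ξ s) * (r s - m) - m * (E + ξ s)) := by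
    rw [← h7]; linear_combination (-m * pv s) * h6
  have h10 := sub_nonneg.2 (abs_le.1 (h.abs_ξ_le s hs')).2
  have e2 : (E - ξ s) * (r s - m) - m * (E + ξ s) ≤ 0 := by nlinarith [mul_nonneg hm.le h3]
  have e3 : (r s - m) * (L ^ 2 - m * (r s - m) * pv s ^ 2) ≤ 0 := by
    rw [e]; exact mul_nonpos_of_nonneg_of_nonpos (by positivity) e2
  exact nonpos_of_mul_nonpos_right e3 hd

/-- The expression (E + ξ)r²/(r - m)² for pv degenerates at the horizon, so it is used only for r ≥
2m. Outgoing orbits inside the photon sphere have nonincreasing pv. Otherwise pv = L²/((E - ξ)r²) ≤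
L²/(E m²), and L² is controlled by the starting point if r a ≤ 2m, and by `le_energy_of_crossing` if
not. -/
theorem pv_le (h : IsOrbit m E L a b r ξ pv T) {P : ℝ} (hP : pv a ≤ P) (hEP : E ≤ P) :
    pv b ≤ 16 * P := by
  have hm := h.m_pos
  have hE := h.E_pos
  have ha := Set.left_mem_Icc.2 h.le
  have hb := Set.right_mem_Icc.2 h.le
  have hξ := abs_le.1 (h.abs_ξ_le b hb)
  have hr := h.r_ge b hb
  have hpv := h.pv_nonneg b hb
  have hin := h.in_eq b hb
  have hout := h.out_eq b hb
  by_cases h1 : 2 * m ≤ r b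
  · have e1 : pv b * (r b - m) ^ 2 ≤ (16 * P) * (r b - m) ^ 2 := by
      rw [hin]
      have : r b ^ 2 ≤ 4 * (r b - m) ^ 2 := by nlinarith
      have : (E + ξ b) * r b ^ 2 ≤ (2 * E) * (4 * (r b - m) ^ 2) := by gcongr; linarith
      nlinarith [sq_nonneg (r b - m)]
    exact le_of_mul_le_mul_right e1 (by have : 0 < r b - m := by linarith
                                        positivity)
  push Not at h1
  by_cases h2 : 0 < ξ b
  · have := h.pv_le_of_outgoing h1 h2
    linarith
  push Not at h2
  have e1 : pv b * (E * m ^ 2) ≤ L ^ 2 := by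
    rw [← hout, mul_assoc]
    gcongr <;> linarith
  have e2 : L ^ 2 ≤ 16 * P * (E * m ^ 2) := by
    by_cases h3 : r a ≤ 2 * m
    · rw [← h.out_eq a ha]
      have h4 := h.pv_nonneg a ha
      have h5 := abs_le.1 (h.abs_ξ_le a ha)
      have h6 := h.r_pos ha
      have : pv a * (E - ξ a) * r a ^ 2 ≤ P * (2 * E) * (2 * m) ^ 2 := by
        have : 0 ≤ E - ξ a := by linarith
        have : 0 ≤ P := by linarith
        gcongr
        linarith
      nlinarith [mul_pos hE (sq_pos_of_pos hm)]
    · push Not at h3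
      have := h.le_energy_of_crossing (Or.inr ⟨h3.le, h1.le⟩)
      have : L ^ 2 ≤ (4 * m * E) ^ 2 := by have := h.L_nonneg; gcongr
      nlinarith [mul_pos hE (sq_pos_of_pos hm)]
  exact le_of_mul_le_mul_right (e1.trans e2) (by positivity)

/-- Outside the photon sphere, the outgoing part of the momentum dominates. -/
theorem energy_sub_le (h : IsOrbit m E L a b r ξ pv T) (h1 : 2 * m < r b) :
    (E - ξ b) * r b ^ 2 ≤ 16 * E * r a ^ 2 := by
  have hm := h.m_pos
  have hE := h.E_pos
  have ha := Set.left_mem_Icc.2 h.le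
  have hb := Set.right_mem_Icc.2 h.le
  have hξ := abs_le.1 (h.abs_ξ_le b hb)
  have hra := h.r_ge a ha
  have hrb := h.r_pos hb
  by_cases h2 : ξ b < 0
  · have := h.r_le_of_ingoing h1 h2
    have : (E - ξ b) * r b ^ 2 ≤ (2 * E) * r a ^ 2 := by gcongr; linarith
    nlinarith [mul_pos hE (sq_pos_of_pos (h.r_pos ha))]
  push Not at h2
  -- For outgoing motion E(E - ξ) ≤ E² - ξ² = L²Ω²/r² ≤ L²/r².
  have e1 : E * ((E - ξ b) * r b ^ 2) ≤ L ^ 2 := by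
    have e := h.energy_eq hb
    have e4 : lapse m (r b) ≤ 1 := (lapse_lt_one hm (h.r_ge b hb)).le
    have e5 : L ^ 2 * lapse m (r b) = (E ^ 2 - ξ b ^ 2) * r b ^ 2 := by
      rw [e]; field_simp; ring
    have : 0 ≤ ξ b * (E - ξ b) * r b ^ 2 :=
      mul_nonneg (mul_nonneg h2 (by linarith)) (by positivity)
    nlinarith [mul_le_mul_of_nonneg_left e4 (sq_nonneg L)]
  have e2 : L ^ 2 ≤ 16 * E ^ 2 * r a ^ 2 := by
    by_cases h3 : r a ≤ 2 * m
    · have := h.le_energy_of_crossing (Or.inl ⟨h3, h1.le⟩)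
      have := h.L_nonneg
      calc L ^ 2 ≤ (4 * m * E) ^ 2 := by gcongr
        _ = 16 * E ^ 2 * m ^ 2 := by ring
        _ ≤ _ := by gcongr
    · push Not at h3
      have e := h.energy_eq ha
      have hra0 := h.r_pos ha
      have e4 : 1 / 4 ≤ lapse m (r a) := by
        rw [lapse_eq hra0, div_le_div_iff₀ (by norm_num) (by positivity)]
        nlinarith
      have e5 : L ^ 2 * lapse m (r a) = (E ^ 2 - ξ a ^ 2) * r a ^ 2 := by
        rw [e]; field_simp; ring
      nlinarith [mul_le_mul_of_nonneg_left e4 (sq_nonneg L),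
        mul_nonneg (sq_nonneg (ξ a)) (sq_nonneg (r a)),
        mul_nonneg (sq_nonneg E) (sq_nonneg (r a))]
  have e3 : E * ((E - ξ b) * r b ^ 2) ≤ E * (16 * E * r a ^ 2) := by nlinarith
  exact le_of_mul_le_mul_left e3 hE

end IsOrbit

end ERN

/-! ### Null geodesics from a central force problem. -/

namespace ERN

section curves

variable {s : ℝ} {I : Set ℝ} {y : ℝ → Space} {y' : Space}

theorem hasDerivWithinAt_norm (hy : HasDerivWithinAt y y' I s) (h0 : 0 < ‖y s‖) :
    HasDerivWithinAt (fun t => ‖y t‖) (inner ℝ (y s) y' / ‖y s‖) I s := by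
  have h1 := hy.norm_sq.sqrt (by positivity)
  have h2 : (fun t => √((fun t => ‖y t‖) t ^ 2)) = fun t => ‖y t‖ :=
    funext fun t => Real.sqrt_sq (norm_nonneg _)
  refine (HasDerivWithinAt.congr_deriv (f := fun t => ‖y t‖) (h2 ▸ h1) ?_)
  rw [show (√(‖y s‖ ^ 2)) = ‖y s‖ from Real.sqrt_sq (norm_nonneg _)]
  field_simp

theorem hasDerivAt_norm_line {y w : Space} (h0 : 0 < ‖y‖) :
    HasDerivAt (fun t : ℝ => ‖y + t • w‖) (inner ℝ y w / ‖y‖) 0 := by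
  have h1 : HasDerivAt (fun t : ℝ => y + t • w) w 0 := by
    simpa using ((hasDerivAt_id (0 : ℝ)).smul_const w).const_add y
  have h2 := hasDerivWithinAt_norm (h1.hasDerivWithinAt (s := Set.univ)) (by simpa using h0)
  simpa [hasDerivWithinAt_univ] using h2

end curves

theorem hasDerivAt_lapse {m r : ℝ} (hr : 0 < r) :
    HasDerivAt (lapse m) (2 * m * (r - m) / r ^ 3) r := by
  have h1 : HasDerivAt (fun r : ℝ => 1 - m / r) (-(-m / r ^ 2)) r := by
    have := ((hasDerivAt_inv hr.ne').const_mul m).const_sub 1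
    simp only [← div_eq_mul_inv] at this
    exact this.congr_deriv (by ring)
  refine (h1.pow 2).congr_deriv ?_
  simp only [Nat.cast_ofNat, Nat.add_one_sub_one, pow_one]
  field_simp

theorem differentiableAt_rad {x : Event} (hx : 0 < rad x) : DifferentiableAt ℝ rad x :=
  DifferentiableAt.norm ℝ (differentiableAt_snd) (norm_pos_iff.1 hx)

/-- In Kerr–Schild form the flat part is constant, so only Ω² and the radial direction inside `pIn`
are differentiated. -/
theorem fderiv_metric_self {m : ℝ} {x : Event} (hx : 0 < rad x) (p ζ : Event) :
    fderiv ℝ (fun x => metric m x p p) x ζ =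
      -(2 * m * (rad x - m) / rad x ^ 3 * pR x ζ) * pIn x p ^ 2
        + (1 - lapse m (rad x)) * (2 * pIn x p *
          (inner ℝ ζ.2 p.2 / rad x - pR x p * pR x ζ / rad x)) := by
  have hf : (fun x => metric m x p p) = fun x : Event => -(pT p * pT p) + inner ℝ p.2 p.2
      + (1 - lapse m (rad x)) * (pT p + inner ℝ x.2 p.2 / rad x) ^ 2 := by
    funext x; rw [metric_eq, pIn, pR]; ring
  have hrad := differentiableAt_rad hx
  have hin : DifferentiableAt ℝ (fun x : Event => inner ℝ x.2 p.2) x :=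
    differentiableAt_snd.inner ℝ (differentiableAt_const _)
  have hlap : DifferentiableAt ℝ (fun x : Event => lapse m (rad x)) x :=
    (hasDerivAt_lapse hx).differentiableAt.comp x hrad
  have hdiv : DifferentiableAt ℝ (fun x : Event => inner ℝ x.2 p.2 / rad x) x := by
    simp only [div_eq_mul_inv]
    exact hin.mul (hrad.inv hx.ne')
  have hd : DifferentiableAt ℝ (fun x => metric m x p p) x := by
    rw [hf]
    exact (((hlap.const_sub 1).mul
      ((hdiv.const_add _).pow 2)).const_add _)
  rw [← hd.lineDeriv_eq_fderiv]
  refine HasLineDerivAt.lineDeriv ?_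
  unfold HasLineDerivAt
  rw [hf]
  have h1 : HasDerivAt (fun t : ℝ => rad (x + t • ζ)) (pR x ζ) 0 := hasDerivAt_norm_line hx
  have h0 : rad (x + (0 : ℝ) • ζ) = rad x := by simp
  have h2 : HasDerivAt (fun t : ℝ => lapse m (rad (x + t • ζ)))
      (2 * m * (rad x - m) / rad x ^ 3 * pR x ζ) 0 :=
    HasDerivAt.comp (0 : ℝ) (h₂ := lapse m) (by rw [h0]; exact hasDerivAt_lapse hx) h1
  have h3 : HasDerivAt (fun t : ℝ => inner ℝ (x + t • ζ).2 p.2) (inner ℝ ζ.2 p.2) 0 := by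
    have : (fun t : ℝ => inner ℝ (x + t • ζ).2 p.2)
        = fun t : ℝ => inner ℝ x.2 p.2 + t * inner ℝ ζ.2 p.2 := by
      funext t; simp [inner_add_left, real_inner_smul_left]
    rw [this]
    simpa using ((hasDerivAt_id (0 : ℝ)).mul_const (inner ℝ ζ.2 p.2)).const_add (inner ℝ x.2 p.2)
  have h4 := (((h2.const_sub 1).mul
    (((h3.div h1 (by rw [h0]; exact hx.ne')).const_add (pT p)).pow 2)).const_add
      (-(pT p * pT p) + inner ℝ p.2 p.2))
  refine h4.congr_deriv ?_
  simp only [Pi.pow_apply, Nat.cast_ofNat, Nat.add_one_sub_one, pow_one, zero_smul, add_zero,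
    Pi.div_apply]
  rw [pIn, pR, pR]
  field_simp

/-- Null geodesics from solutions of the central force problem
`y'' = -L² m (3 r - 2 m) / r⁶ y`. -/
theorem isNullGeodesic_of_central {m a b E L : ℝ} (hm : 0 < m) {y v : ℝ → Space} {pv T : ℝ → ℝ}
    (hr : ∀ s ∈ Set.Icc a b, m ≤ ‖y s‖)
    (hy : ∀ s ∈ Set.Icc a b, HasDerivWithinAt y (v s) (Set.Icc a b) s)
    (hv : ∀ s ∈ Set.Icc a b, HasDerivWithinAt v
      (-(L ^ 2 * m * (3 * ‖y s‖ - 2 * m) / ‖y s‖ ^ 6) • y s) (Set.Icc a b) s)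
    (hpv : ∀ s ∈ Set.Icc a b, HasDerivWithinAt pv
      ((L ^ 2 - m * (‖y s‖ - m) * pv s ^ 2) / ‖y s‖ ^ 3) (Set.Icc a b) s)
    (hT : ∀ s ∈ Set.Icc a b,
      HasDerivWithinAt T (pv s - inner ℝ (y s) (v s) / ‖y s‖) (Set.Icc a b) s)
    (hin : ∀ s ∈ Set.Icc a b,
      pv s * (‖y s‖ - m) ^ 2 = (E + inner ℝ (y s) (v s) / ‖y s‖) * ‖y s‖ ^ 2)
    (hout : ∀ s ∈ Set.Icc a b,
      pv s * (E - inner ℝ (y s) (v s) / ‖y s‖) * ‖y s‖ ^ 2 = L ^ 2)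
    (hang : ∀ s ∈ Set.Icc a b, L ^ 2 = ‖y s‖ ^ 2 * ‖v s‖ ^ 2 - inner ℝ (y s) (v s) ^ 2)
    (hpos : ∀ s ∈ Set.Icc a b, 0 < pv s - inner ℝ (y s) (v s) / ‖y s‖) :
    IsNullGeodesic m a b (fun s => (T s, y s))
      (fun s => (pv s - inner ℝ (y s) (v s) / ‖y s‖, v s)) := by
  have hlap : ∀ s ∈ Set.Icc a b,
      lapse m ‖y s‖ * pv s = E + inner ℝ (y s) (v s) / ‖y s‖ := fun s hs => by
    have h0 : 0 < ‖y s‖ := hm.trans_le (hr s hs)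
    rw [lapse_eq h0, div_mul_eq_mul_div, div_eq_iff (by positivity), ← hin s hs]; ring
  intro s hs
  have h0 : 0 < ‖y s‖ := hm.trans_le (hr s hs)
  have hrad : rad (T s, y s) = ‖y s‖ := rfl
  have hpR : ∀ q : Event, pR (T s, y s) q = inner ℝ (y s) q.2 / ‖y s‖ := fun q => rfl
  have hpIn : pIn (T s, y s) (pv s - inner ℝ (y s) (v s) / ‖y s‖, v s) = pv s := by
    rw [pIn, hpR, pT]; ring
  refine ⟨⟨hr s hs, ?_, hpos s hs⟩, (hT s hs).prodMk (hy s hs), fun ζ => ?_⟩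
  · rw [metric_eq, hpIn, real_inner_self_eq_norm_sq, hrad]
    have h1 := hlap s hs
    have h2 := hout s hs
    have h3 := hang s hs
    simp only [pT]
    set ξ := inner ℝ (y s) (v s) / ‖y s‖ with hξ
    have h4 : inner ℝ (y s) (v s) = ξ * ‖y s‖ := by rw [hξ]; field_simp
    have h5 : ‖v s‖ ^ 2 = ξ ^ 2 + pv s * (E - ξ) := by
      have : ‖y s‖ ^ 2 * ‖v s‖ ^ 2 = ‖y s‖ ^ 2 * (ξ ^ 2 + pv s * (E - ξ)) := by
        rw [h4] at h3
        linear_combination -h3 - h2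
      exact mul_left_cancel₀ (by positivity) this
    rw [h5]
    linear_combination (-pv s) * h1
  -- The relation Ω² pv = E + ξ removes Ω² from the lowered momentum, so that only y, v and pv have
  -- to be differentiated.
  · have hcongr : ∀ σ ∈ Set.Icc a b,
        metric m (T σ, y σ) (pv σ - inner ℝ (y σ) (v σ) / ‖y σ‖, v σ) ζ =
        -E * ζ.1 + inner ℝ (v σ) ζ.2 +
          (pv σ - E - inner ℝ (y σ) (v σ) / ‖y σ‖) * (inner ℝ (y σ) ζ.2 / ‖y σ‖) := by
      intro σ hσ
      have h1 := hlap σ hσ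
      rw [metric_eq]
      simp only [pIn, pT, pR, rad]
      linear_combination (-ζ.1 - inner ℝ (y σ) ζ.2 / ‖y σ‖) * h1
    have dr := hasDerivWithinAt_norm (hy s hs) h0
    have d1 : HasDerivWithinAt (fun σ => inner ℝ (v σ) ζ.2)
        (-(L ^ 2 * m * (3 * ‖y s‖ - 2 * m) / ‖y s‖ ^ 6) * inner ℝ (y s) ζ.2)
        (Set.Icc a b) s := by
      refine ((hv s hs).inner ℝ (hasDerivWithinAt_const s _ ζ.2)).congr_deriv ?_
      rw [inner_zero_right, real_inner_smul_left]; ring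
    have d2 : HasDerivWithinAt (fun σ => inner ℝ (y σ) ζ.2) (inner ℝ (v s) ζ.2)
        (Set.Icc a b) s := by
      refine ((hy s hs).inner ℝ (hasDerivWithinAt_const s _ ζ.2)).congr_deriv ?_
      simp
    have d3 : HasDerivWithinAt (fun σ => inner ℝ (y σ) (v σ))
        (‖v s‖ ^ 2 - (L ^ 2 * m * (3 * ‖y s‖ - 2 * m) / ‖y s‖ ^ 6) * ‖y s‖ ^ 2)
        (Set.Icc a b) s := by
      refine ((hy s hs).inner ℝ (hv s hs)).congr_deriv ?_
      rw [real_inner_smul_right, real_inner_self_eq_norm_sq, real_inner_self_eq_norm_sq]; ring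
    have d4 := (d1.const_add (-E * ζ.1)).add
      ((((hpv s hs).sub_const E).sub (d3.div dr h0.ne')).mul (d2.div dr h0.ne'))
    refine (HasDerivWithinAt.congr d4 hcongr (hcongr s hs)).congr_deriv ?_
    rw [fderiv_metric_self (by exact h0), hpIn]
    simp only [hpR, hrad, Pi.sub_apply, Pi.div_apply]
    have h1 := hlap s hs
    have h3 := hang s hs
    set N := ‖y s‖
    set ip := inner ℝ (y s) (v s)
    set iz := inner ℝ (y s) ζ.2
    rw [real_inner_comm (v s) ζ.2]
    set vz := inner ℝ (v s) ζ.2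
    have h6 : (1 - lapse m N) * pv s = pv s - E - ip / N := by linear_combination -h1
    have h7 : ‖v s‖ ^ 2 = (L ^ 2 + ip ^ 2) / N ^ 2 := by
      rw [eq_div_iff (by positivity)]; linear_combination -h3
    rw [h7]
    have h8 : (1 - lapse m N) * (2 * pv s * (vz / N - ip / N * (iz / N) / N)) =
      2 * (pv s - E - ip / N) * (vz / N - ip / N * (iz / N) / N) := by rw [← h6]; ring
    rw [h8]
    field_simp
    ring

end ERN

/-! ### Solving the central force problem and recovering `pv`. -/

namespace ERN

/-- Backward solvability, over any time interval, of a central force problem whose force law is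
extended below the radius `m`. -/
theorem exists_central_solution {m B : ℝ} (hm : 0 < m) {φ : ℝ → ℝ}
    (hφ : ContDiffOn ℝ 1 φ (Set.Ici m)) (hB : ∀ q : ℝ, m ≤ q → |φ q| * q ≤ B) (y₀ v₀ : Space)
    {S : ℝ} (hS : 0 < S) :
    ∃ y v : ℝ → Space, y 0 = y₀ ∧ v 0 = v₀ ∧ ∀ s ∈ Set.Icc (-S) 0,
      HasDerivWithinAt y (v s) (Set.Icc (-S) 0) s ∧
      HasDerivWithinAt v (φ (max ‖y s‖ m) • y s) (Set.Icc (-S) 0) s := by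
  set g : Space → Space := fun y => φ (max ‖y‖ m) • y with hg
  have hB0 : 0 ≤ B := le_trans (mul_nonneg (abs_nonneg _) hm.le) (hB m le_rfl)
  have hgB : ∀ y, ‖g y‖ ≤ B := fun y => by
    rw [hg, norm_smul, Real.norm_eq_abs]
    exact le_trans (by gcongr; exact le_max_left _ _) (hB _ (le_max_right _ _))
  have hgL : ∀ M : ℝ, m ≤ M → ∃ K : NNReal, LipschitzOnWith K g (Metric.closedBall 0 M) := by
    intro M hM
    obtain ⟨K, hK⟩ := (hφ.mono Set.Icc_subset_Ici_self).exists_lipschitzOnWith (s := Set.Icc m M)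
      one_ne_zero (convex_Icc m M) isCompact_Icc
    have hM0 : 0 ≤ M := hm.le.trans hM
    refine ⟨Real.toNNReal (B / m + K * M), LipschitzOnWith.of_dist_le_mul fun y hy z hz => ?_⟩
    have hy' : max ‖y‖ m ∈ Set.Icc m M := ⟨le_max_right _ _, max_le (by simpa using hy) hM⟩
    have hz' : max ‖z‖ m ∈ Set.Icc m M := ⟨le_max_right _ _, max_le (by simpa using hz) hM⟩
    have h1 := hK.dist_le_mul _ hy' _ hz'
    have h2 : dist (max ‖y‖ m) (max ‖z‖ m) ≤ dist y z := by
      rw [Real.dist_eq, dist_eq_norm]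
      exact (abs_max_sub_max_le_abs _ _ _).trans (abs_norm_sub_norm_le _ _)
    have h3 : |φ (max ‖y‖ m)| ≤ B / m := by
      rw [le_div_iff₀ hm]
      exact le_trans (by gcongr; exact le_max_right _ _) (hB _ (le_max_right _ _))
    have e : g y - g z = φ (max ‖y‖ m) • (y - z) + (φ (max ‖y‖ m) - φ (max ‖z‖ m)) • z := by
      simp only [hg]; module
    rw [Real.coe_toNNReal _ (by positivity), dist_eq_norm, e]
    refine (norm_add_le _ _).trans ?_
    rw [norm_smul, norm_smul, ← dist_eq_norm, ← dist_eq_norm, Real.norm_eq_abs]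
    have hzM : ‖z‖ ≤ M := by simpa using hz
    calc |φ (max ‖y‖ m)| * dist y z + dist (φ (max ‖y‖ m)) (φ (max ‖z‖ m)) * ‖z‖
        ≤ B / m * dist y z + (K * dist y z) * M := by
          gcongr
          exact h1.trans (by gcongr)
      _ = (B / m + K * M) * dist y z := by ring
  -- Rescaling the velocity by 2S lets one Picard–Lindelöf ball of radius A serve the whole
  -- interval. In time S the position moves by at most S‖v₀‖ + A/2 ≤ A, the rescaled velocity by at
  -- most 2S²B ≤ A.
  set V : Space × Space → Space × Space := fun z => ((2 * S)⁻¹ • z.2, (2 * S) • g z.1) with hV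
  set z₀ : Space × Space := (y₀, (2 * S) • v₀) with hz₀
  set A : ℝ := 2 * S * ‖v₀‖ + 2 * S ^ 2 * B with hA
  have hA0 : 0 ≤ A := by positivity
  set Lb : ℝ := max ((2 * S)⁻¹ * (2 * S * ‖v₀‖ + A)) (2 * S * B) with hLb
  have hLb0 : 0 ≤ Lb := le_max_of_le_right (by positivity)
  obtain ⟨K, hK⟩ := hgL (‖y₀‖ + A + m) (by have := norm_nonneg y₀; linarith)
  have hmem : ∀ z ∈ Metric.closedBall z₀ A, ‖z.1‖ ≤ ‖y₀‖ + A ∧ ‖z.2‖ ≤ 2 * S * ‖v₀‖ + A := by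
    intro z hz
    rw [mem_closedBall_iff_norm] at hz
    have h1 : ‖z.1 - y₀‖ ≤ A := (norm_fst_le (z - z₀)).trans hz
    have h2 : ‖z.2 - (2 * S) • v₀‖ ≤ A := (norm_snd_le (z - z₀)).trans hz
    constructor
    · have := norm_le_norm_add_norm_sub' z.1 y₀
      linarith
    · have := norm_le_norm_add_norm_sub' z.2 ((2 * S) • v₀)
      rw [norm_smul, Real.norm_of_nonneg (by positivity : 0 ≤ 2 * S)] at this
      linarith
  have hVb : ∀ z ∈ Metric.closedBall z₀ A, ‖V z‖ ≤ Lb := by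
    intro z hz
    rw [hV, Prod.norm_def]
    refine max_le_max ?_ ?_
    · rw [norm_smul, Real.norm_of_nonneg (by positivity : 0 ≤ (2 * S)⁻¹)]
      gcongr
      exact (hmem z hz).2
    · rw [norm_smul, Real.norm_of_nonneg (by positivity : 0 ≤ 2 * S)]
      gcongr
      exact hgB _
  have hVL : LipschitzOnWith (max (Real.toNNReal (2 * S)⁻¹) (Real.toNNReal (2 * S) * K)) V
      (Metric.closedBall z₀ A) := by
    refine LipschitzOnWith.prodMk (LipschitzOnWith.of_dist_le_mul fun y _ z _ => ?_)
      (LipschitzOnWith.of_dist_le_mul fun y hy z hz => ?_)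
    · rw [dist_smul₀, Real.norm_of_nonneg (by positivity : 0 ≤ (2 * S)⁻¹)]
      rw [Real.coe_toNNReal _ (by positivity)]
      gcongr
      exact le_max_right _ _
    · rw [dist_smul₀, Real.norm_of_nonneg (by positivity : 0 ≤ 2 * S)]
      have h1 := hK.dist_le_mul y.1 (by simpa using (hmem y hy).1.trans (by linarith)) z.1
        (by simpa using (hmem z hz).1.trans (by linarith))
      have h2 : dist y.1 z.1 ≤ dist y z := le_max_left _ _
      rw [NNReal.coe_mul, Real.coe_toNNReal _ (by positivity)]
      calc 2 * S * dist (g y.1) (g z.1) ≤ 2 * S * (K * dist y z) := by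
            gcongr
            exact h1.trans (by gcongr)
        _ = _ := by ring
  have hPL : IsPicardLindelof (fun _ => V) (tmin := -S) (tmax := 0) ⟨0, ⟨by linarith, le_rfl⟩⟩ z₀
      A.toNNReal 0 Lb.toNNReal (max (Real.toNNReal (2 * S)⁻¹) (Real.toNNReal (2 * S) * K)) := by
    refine IsPicardLindelof.of_time_independent ?_ (by rwa [Real.coe_toNNReal _ hA0]) ?_
    · rwa [Real.coe_toNNReal _ hA0, Real.coe_toNNReal _ hLb0]
    rw [Real.coe_toNNReal _ hA0, Real.coe_toNNReal _ hLb0]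
    change Lb * max (0 - 0) (0 - -S) ≤ A - 0
    rw [show max (0 - 0) (0 - -S) = S by simp [hS.le], hLb, max_mul_of_nonneg _ _ hS.le, sub_zero]
    refine max_le ?_ ?_
    · have : (2 * S)⁻¹ * (2 * S * ‖v₀‖ + A) * S = S * ‖v₀‖ + A / 2 := by field_simp
      rw [this, hA]
      nlinarith [mul_nonneg (sq_nonneg S) hB0]
    · rw [hA]
      nlinarith [mul_nonneg hS.le (norm_nonneg v₀)]
  obtain ⟨α, hα0, hα⟩ := hPL.exists_eq_forall_mem_Icc_hasDerivWithinAt₀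
  refine ⟨fun s => (α s).1, fun s => (2 * S)⁻¹ • (α s).2, ?_, ?_, fun s hs => ⟨?_, ?_⟩⟩
  · change (α 0).1 = y₀
    have : α 0 = z₀ := hα0
    rw [this]
  · have : α 0 = z₀ := hα0
    simp only [this, hz₀, smul_smul]
    rw [inv_mul_cancel₀ (by positivity), one_smul]
  · exact (hα s hs).fst
  · have h2 : HasDerivWithinAt (fun s => (α s).2) ((2 * S) • g (α s).1) (Set.Icc (-S) 0) s :=
      (hα s hs).snd
    refine (h2.const_smul ((2 * S)⁻¹)).congr_deriv ?_
    rw [smul_smul]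
    rw [inv_mul_cancel₀ (by positivity), one_smul]

theorem eq_right_of_deriv_zero {a b : ℝ} {f : ℝ → ℝ}
    (hf : ∀ s ∈ Set.Icc a b, HasDerivWithinAt f 0 (Set.Icc a b) s) :
    ∀ s ∈ Set.Icc a b, f s = f b := by
  intro s hs
  have h1 := constant_of_derivWithin_zero (f := f)
    (fun s hs => (hf s hs).differentiableWithinAt)
    (fun s hs => by
      have hs' : s ∈ Set.Icc a b := Set.Ico_subset_Icc_self hs
      exact (hf s hs').derivWithin (uniqueDiffOn_Icc (hs.1.trans_lt hs.2) s hs'))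
  rw [h1 s hs, h1 b (Set.right_mem_Icc.2 (hs.1.trans hs.2))]

section central

variable {m a b L : ℝ} {y v : ℝ → Space}

/-- Conservation of angular momentum. -/
theorem central_angular {φ : ℝ → ℝ}
    (hy : ∀ s ∈ Set.Icc a b, HasDerivWithinAt y (v s) (Set.Icc a b) s)
    (hv : ∀ s ∈ Set.Icc a b, HasDerivWithinAt v (φ s • y s) (Set.Icc a b) s) :
    ∀ s ∈ Set.Icc a b, ‖y s‖ ^ 2 * ‖v s‖ ^ 2 - inner ℝ (y s) (v s) ^ 2 =
      ‖y b‖ ^ 2 * ‖v b‖ ^ 2 - inner ℝ (y b) (v b) ^ 2 := by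
  refine eq_right_of_deriv_zero (f := fun s => ‖y s‖ ^ 2 * ‖v s‖ ^ 2 - inner ℝ (y s) (v s) ^ 2)
    fun s hs => ?_
  refine (((hy s hs).norm_sq.mul (hv s hs).norm_sq).sub
    (((hy s hs).inner ℝ (hv s hs)).pow 2)).congr_deriv ?_
  simp only [real_inner_smul_right, real_inner_self_eq_norm_sq, real_inner_comm (y s) (v s),
    Nat.cast_ofNat, Nat.add_one_sub_one, pow_one]
  ring

/-- Centrifugal term minus attraction: L²/r³ - L² m(3r - 2m)/r⁵, where r² - 3mr + 2m² = (r - m)(r -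
2m). -/
theorem central_deriv_radial (hm : 0 < m)
    (hr : ∀ s ∈ Set.Icc a b, m ≤ ‖y s‖)
    (hy : ∀ s ∈ Set.Icc a b, HasDerivWithinAt y (v s) (Set.Icc a b) s)
    (hv : ∀ s ∈ Set.Icc a b, HasDerivWithinAt v
      (-(L ^ 2 * m * (3 * ‖y s‖ - 2 * m) / ‖y s‖ ^ 6) • y s) (Set.Icc a b) s)
    (hang : ∀ s ∈ Set.Icc a b, L ^ 2 = ‖y s‖ ^ 2 * ‖v s‖ ^ 2 - inner ℝ (y s) (v s) ^ 2) :
    ∀ s ∈ Set.Icc a b, HasDerivWithinAt (fun s => inner ℝ (y s) (v s) / ‖y s‖)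
      (L ^ 2 * ((‖y s‖ - m) * (‖y s‖ - 2 * m) / ‖y s‖ ^ 5)) (Set.Icc a b) s := by
  intro s hs
  have h0 : 0 < ‖y s‖ := hm.trans_le (hr s hs)
  refine (((hy s hs).inner ℝ (hv s hs)).div (hasDerivWithinAt_norm (hy s hs) h0)
    h0.ne').congr_deriv ?_
  rw [real_inner_smul_right, real_inner_self_eq_norm_sq, real_inner_self_eq_norm_sq]
  have h1 := hang s hs
  have h7 : ‖v s‖ ^ 2 = (L ^ 2 + inner ℝ (y s) (v s) ^ 2) / ‖y s‖ ^ 2 := by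
    rw [eq_div_iff (by positivity)]; linear_combination -h1
  rw [h7]
  field_simp
  ring

end central

/-- Conservation of energy for the radial motion. -/
theorem radial_energy {m a b L : ℝ} {r ξ : ℝ → ℝ} (hm : 0 < m) (hr : ∀ s ∈ Set.Icc a b, m ≤ r s)
    (hd : ∀ s ∈ Set.Icc a b, HasDerivWithinAt r (ξ s) (Set.Icc a b) s)
    (hξ : ∀ s ∈ Set.Icc a b,
      HasDerivWithinAt ξ (L ^ 2 * ((r s - m) * (r s - 2 * m) / r s ^ 5)) (Set.Icc a b) s) :
    ∀ s ∈ Set.Icc a b, ξ s ^ 2 + L ^ 2 * (r s - m) ^ 2 / r s ^ 4 =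
      ξ b ^ 2 + L ^ 2 * (r b - m) ^ 2 / r b ^ 4 := by
  refine eq_right_of_deriv_zero (f := fun s => ξ s ^ 2 + L ^ 2 * (r s - m) ^ 2 / r s ^ 4)
    fun s hs => ?_
  have h0 : 0 < r s := hm.trans_le (hr s hs)
  refine (((hξ s hs).pow 2).add (((((hd s hs).sub_const m).pow 2).const_mul (L ^ 2)).div
    ((hd s hs).pow 4) (by simp only [Pi.pow_apply]; positivity))).congr_deriv ?_
  simp only [Pi.pow_apply, Nat.cast_ofNat, Nat.add_one_sub_one, pow_one]
  field_simp
  ring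

/-- The component `pv` along the radial motion. -/
theorem exists_pv {m a b L E : ℝ} {r ξ : ℝ → ℝ} (hm : 0 < m) (hE : 0 < E)
    (hr : ∀ s ∈ Set.Icc a b, m ≤ r s) (hr' : ∀ s ∈ Set.Ico a b, m < r s)
    (hb : m < r b ∨ ξ b = -E)
    (hd : ∀ s ∈ Set.Icc a b, HasDerivWithinAt r (ξ s) (Set.Icc a b) s)
    (hξ : ∀ s ∈ Set.Icc a b,
      HasDerivWithinAt ξ (L ^ 2 * ((r s - m) * (r s - 2 * m) / r s ^ 5)) (Set.Icc a b) s)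
    (hen : ∀ s ∈ Set.Icc a b, ξ s ^ 2 + L ^ 2 * (r s - m) ^ 2 / r s ^ 4 = E ^ 2) :
    ∃ pv : ℝ → ℝ, ∀ s ∈ Set.Icc a b, 0 ≤ pv s ∧
      pv s * (r s - m) ^ 2 = (E + ξ s) * r s ^ 2 ∧ pv s * (E - ξ s) * r s ^ 2 = L ^ 2 ∧
      HasDerivWithinAt pv ((L ^ 2 - m * (r s - m) * pv s ^ 2) / r s ^ 3) (Set.Icc a b) s := by
  have hen' : ∀ s ∈ Set.Icc a b, L ^ 2 * (r s - m) ^ 2 = (E ^ 2 - ξ s ^ 2) * r s ^ 4 :=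
    fun s hs => by
      have h0 : 0 < r s := hm.trans_le (hr s hs)
      rw [← hen s hs]; field_simp; ring
  have habs : ∀ s ∈ Set.Icc a b, -E ≤ ξ s ∧ ξ s ≤ E := fun s hs => by
    rw [← abs_le]
    apply abs_le_of_sq_le_sq _ hE.le
    rw [← hen s hs]
    have h0 : 0 < r s := hm.trans_le (hr s hs)
    have : 0 ≤ L ^ 2 * (r s - m) ^ 2 / r s ^ 4 := by positivity
    linarith
  -- Each null relation gives a formula for pv. The first is regular when r > m up to the endpoint.
  -- The second is used when the orbit ends on the horizon and needs E - ξ > 0: if ξ = E somewhere,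
  -- then L = 0 and ξ is constant, contradicting ξ b = -E.
  by_cases hbm : m < r b
  · have hgt : ∀ s ∈ Set.Icc a b, 0 < r s - m := fun s hs => by
      rcases hs.2.eq_or_lt with h | h
      · rw [h]; exact sub_pos.2 hbm
      · exact sub_pos.2 (hr' s ⟨hs.1, h⟩)
    refine ⟨fun s => (E + ξ s) * r s ^ 2 / (r s - m) ^ 2, fun s hs => ?_⟩
    have h0 : 0 < r s := hm.trans_le (hr s hs)
    have h1 := hgt s hs
    have h2 := hen' s hs
    have h3 := habs s hs
    have hL : L ^ 2 = (E ^ 2 - ξ s ^ 2) * r s ^ 4 / (r s - m) ^ 2 := by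
      rw [eq_div_iff (by positivity), h2]
    refine ⟨?_, ?_, ?_, ?_⟩
    · have : 0 ≤ E + ξ s := by linarith
      positivity
    · field_simp
    · rw [hL]; field_simp; ring
    · refine ((((hξ s hs).const_add E).mul ((hd s hs).pow 2)).div
        (((hd s hs).sub_const m).pow 2) (by simp only [Pi.pow_apply]; positivity)).congr_deriv ?_
      simp only [Pi.pow_apply, Pi.mul_apply, Nat.cast_ofNat, Nat.add_one_sub_one, pow_one]
      rw [hL]
      field_simp
      ring
  · have hξb : ξ b = -E := hb.resolve_left hbm
    have hlt : ∀ s ∈ Set.Icc a b, 0 < E - ξ s := fun s hs => by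
      rcases (habs s hs).2.lt_or_eq with h | h
      · linarith
      exfalso
      rcases hs.2.eq_or_lt with h' | h'
      · rw [h'] at h; linarith
      have h1 : 0 < r s - m := sub_pos.2 (hr' s ⟨hs.1, h'⟩)
      have h2 := hen' s hs
      rw [h, sub_self, zero_mul] at h2
      have hL : L = 0 := by
        rcases mul_eq_zero.1 h2 with h2 | h2
        · exact pow_eq_zero_iff (two_ne_zero) |>.1 h2
        · have : 0 < (r s - m) ^ 2 := by positivity
          linarith
      have := eq_right_of_deriv_zero (f := ξ) (fun t ht => by simpa [hL] using hξ t ht) s hs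
      rw [h, hξb] at this
      linarith
    refine ⟨fun s => L ^ 2 / (r s ^ 2 * (E - ξ s)), fun s hs => ?_⟩
    have h0 : 0 < r s := hm.trans_le (hr s hs)
    have h1 := hlt s hs
    have h2 := hen' s hs
    refine ⟨by positivity, ?_, by field_simp, ?_⟩
    · rw [div_mul_eq_mul_div, h2]; field_simp; ring
    · refine ((hasDerivWithinAt_const s _ (L ^ 2)).div (((hd s hs).pow 2).mul
        ((hξ s hs).const_sub E)) (by simp only [Pi.pow_apply, Pi.mul_apply]; positivity)).congr_deriv
          ?_
      simp only [Pi.pow_apply, Pi.mul_apply, Nat.cast_ofNat, Nat.add_one_sub_one, pow_one]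
      field_simp
      linear_combination L ^ 2 * h2

end ERN

/-! ### The time function and geodesics traced back to Σ₀. -/

namespace ERN

/-- The difference `t* - τ` as a function of `max r R`. -/
noncomputable def tauShift (m R r : ℝ) : ℝ :=
  (r - R) + 4 * m * (Real.log (r - m) - Real.log (R - m)) + 2 * m ^ 2 / (R - m)
    - 2 * m ^ 2 / (r - m)

section tau

variable {m R : ℝ} {x : Event}

theorem tau_eq (m R : ℝ) (x : Event) : tau m R x = x.1 - tauShift m R (max (rad x) R) := by
  rw [tau, tauShift]
  split_ifs with h
  · rw [max_eq_right h]; ring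
  · rw [max_eq_left (not_le.1 h).le, uCoord, bigF, rStar, cConst]; ring

theorem continuous_tau (hm : 0 < m) (hR : 2 * m < R) : Continuous (tau m R) := by
  have h : tau m R = fun x => x.1 - tauShift m R (max (rad x) R) := funext fun x => tau_eq m R x
  rw [h]
  unfold tauShift rad
  have h1 : Continuous fun x : Event => max ‖x.2‖ R - m := by fun_prop
  have h2 : ∀ x : Event, max ‖x.2‖ R - m ≠ 0 := fun x => by
    have := le_max_right ‖x.2‖ R
    have : 0 < max ‖x.2‖ R - m := by linarith
    exact this.ne'
  have h3 := h1.log h2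
  have h4 : Continuous fun x : Event => 2 * m ^ 2 / (max ‖x.2‖ R - m) :=
    continuous_const.div h1 h2
  fun_prop

theorem tauShift_nonneg (hm : 0 < m) (hR : 2 * m < R) {r : ℝ} (hr : R ≤ r) :
    0 ≤ tauShift m R r := by
  have h1 : 0 < R - m := by linarith
  have h2 : Real.log (R - m) ≤ Real.log (r - m) := Real.log_le_log h1 (by linarith)
  have h3 : 2 * m ^ 2 / (r - m) ≤ 2 * m ^ 2 / (R - m) := by gcongr
  have h4 : 0 ≤ 4 * m * (Real.log (r - m) - Real.log (R - m)) :=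
    mul_nonneg (by positivity) (by linarith)
  rw [tauShift]; linarith

theorem tau_le (hm : 0 < m) (hR : 2 * m < R) : tau m R x ≤ x.1 := by
  rw [tau_eq]
  linarith [tauShift_nonneg hm hR (le_max_right (rad x) R)]

/-- The time function `τ` differs from `t* - r - 4 m log (r / m)` by a bounded amount. -/
theorem tau_le_smooth {ρ : ℝ} (hm : 0 < m) (hρ : 2 < ρ) (hx : x ∈ exterior m) :
    tau m (ρ * m) x ≤ x.1 - rad x - 4 * m * Real.log (rad x) + 4 * m * Real.log m
      + (ρ + 4 * Real.log ρ + 4 * Real.log 2) * m := by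
  have hr : 0 < rad x := rad_pos hm hx
  have hx' : m ≤ rad x := hx
  have hl2 : 0 < Real.log 2 := Real.log_pos one_lt_two
  rw [tau_eq]
  rcases le_total (rad x) (ρ * m) with h | h
  · rw [max_eq_right h]
    have h1 : Real.log (rad x) ≤ Real.log ρ + Real.log m := by
      rw [← Real.log_mul (by linarith) hm.ne']
      exact Real.log_le_log hr h
    have h2 : tauShift m (ρ * m) (ρ * m) = 0 := by rw [tauShift]; ring
    rw [h2]
    nlinarith [mul_le_mul_of_nonneg_left h1 (by positivity : 0 ≤ 4 * m)]
  · rw [max_eq_left h, tauShift]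
    have hR1 : 0 < ρ * m - m := by nlinarith
    have hr1 : 0 < rad x - m := by linarith
    have h1 : Real.log (rad x) ≤ Real.log 2 + Real.log (rad x - m) := by
      rw [← Real.log_mul (by norm_num) hr1.ne']
      exact Real.log_le_log hr (by nlinarith)
    have h2 : Real.log (ρ * m - m) ≤ Real.log ρ + Real.log m := by
      rw [← Real.log_mul (by linarith) hm.ne']
      exact Real.log_le_log hR1 (by linarith)
    have h3 : 2 * m ^ 2 / (rad x - m) ≤ 2 * m ^ 2 / (ρ * m - m) := by gcongr
    have hs := mul_le_mul_of_nonneg_left (add_le_add h1 h2) (by positivity : 0 ≤ 4 * m)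
    nlinarith

theorem smooth_le_tau {ρ : ℝ} (hm : 0 < m) (hρ : 2 < ρ) (hx : x ∈ exterior m) :
    x.1 - rad x - 4 * m * Real.log (rad x) + 4 * m * Real.log m ≤ tau m (ρ * m) x + 2 * m := by
  have hr : 0 < rad x := rad_pos hm hx
  have hx' : m ≤ rad x := hx
  rw [tau_eq]
  rcases le_total (rad x) (ρ * m) with h | h
  · rw [max_eq_right h]
    have h1 : Real.log m ≤ Real.log (rad x) := Real.log_le_log hm hx
    have h2 : tauShift m (ρ * m) (ρ * m) = 0 := by rw [tauShift]; ring
    rw [h2]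
    nlinarith [mul_le_mul_of_nonneg_left h1 (by positivity : 0 ≤ 4 * m)]
  · rw [max_eq_left h, tauShift]
    have hR1 : m ≤ ρ * m - m := by nlinarith
    have hr1 : 0 < rad x - m := by linarith
    have h1 : Real.log (rad x - m) ≤ Real.log (rad x) := Real.log_le_log hr1 (by linarith)
    have h2 : Real.log m ≤ Real.log (ρ * m - m) := Real.log_le_log hm hR1
    have h3 : 2 * m ^ 2 / (ρ * m - m) ≤ 2 * m := by
      rw [div_le_iff₀ (by linarith)]; nlinarith
    have h4 : 0 ≤ 2 * m ^ 2 / (rad x - m) := by positivity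
    have hs := mul_le_mul_of_nonneg_left (add_le_add h1 h2) (by positivity : 0 ≤ 4 * m)
    nlinarith

end tau

/-- Going back along a path that is outside the radius `m` shortly before its end, either one
reaches the given time, or one gets arbitrarily close to the radius `m`. -/
theorem exists_start {m S ε : ℝ} {r X : ℝ → ℝ} (hm : 0 < m) (hε : 0 < ε) (hεS : ε ≤ S)
    (hc : ContinuousOn r (Set.Icc (-S) 0)) (hr : ∀ s ∈ Set.Ico (-ε) 0, m < r s) :
    ∃ c ∈ Set.Ico (-S) 0, (∀ s ∈ Set.Ico c 0, m < r s) ∧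
      (c = -S ∨ ∃ s ∈ Set.Ico c 0, X s ≤ m ^ 2 / (r c - m)) := by
  by_cases hB : ∃ s ∈ Set.Icc (-S) (-ε), r s ≤ m
  swap
  · push Not at hB
    refine ⟨-S, ⟨le_rfl, by linarith⟩, fun s hs => ?_, Or.inl rfl⟩
    rcases le_or_gt s (-ε) with h | h
    · exact hB s ⟨hs.1, h⟩
    · exact hr s ⟨h.le, hs.2⟩
  have hcomp : IsCompact (Set.Icc (-S) (-ε) ∩ r ⁻¹' Set.Iic m) :=
    IsCompact.of_isClosed_subset isCompact_Icc
      ((hc.mono (Set.Icc_subset_Icc_right (by linarith))).preimage_isClosed_of_isClosed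
        isClosed_Icc isClosed_Iic) Set.inter_subset_left
  obtain ⟨s₁, ⟨hs₁, hrs₁⟩, hmax⟩ := hcomp.exists_isGreatest (by
    obtain ⟨s, hs, hs'⟩ := hB
    exact ⟨s, hs, hs'⟩)
  have hrs₁' : r s₁ ≤ m := hrs₁
  have hε1 : m < r (-ε) := hr _ ⟨le_rfl, by linarith⟩
  have hgt : ∀ s ∈ Set.Ioo s₁ 0, m < r s := fun s hs => by
    rcases le_or_gt s (-ε) with h | h
    · by_contra hle
      have := hmax ⟨⟨hs₁.1.trans hs.1.le, h⟩, not_lt.1 hle⟩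
      linarith [hs.1]
    · exact hr s ⟨h.le, hs.2⟩
  -- Here s₁ is the last time in [-S, -ε] with r ≤ m. The level m + η is crossed after s₁, and η is
  -- small enough for m²/η to exceed X (-ε).
  set η := min (r (-ε) - m) (m ^ 2 / (|X (-ε)| + 1)) with hη
  have hη0 : 0 < η := lt_min (by linarith) (by positivity)
  obtain ⟨c, hcm, hcr⟩ := intermediate_value_Icc hs₁.2
    (hc.mono (Set.Icc_subset_Icc hs₁.1 (by linarith)))
    (⟨by linarith, by have := min_le_left (r (-ε) - m) (m ^ 2 / (|X (-ε)| + 1)); linarith⟩ :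
      m + η ∈ Set.Icc (r s₁) (r (-ε)))
  have hcs : s₁ < c := by
    rcases hcm.1.eq_or_lt with h | h
    · rw [← h] at hcr; linarith
    · exact h
  refine ⟨c, ⟨hs₁.1.trans hcm.1, by linarith [hcm.2]⟩,
    fun s hs => hgt s ⟨hcs.trans_le hs.1, hs.2⟩, Or.inr ⟨-ε, ⟨hcm.2, by linarith⟩, ?_⟩⟩
  rw [hcr, add_sub_cancel_left, le_div_iff₀ hη0]
  have h1 : η ≤ m ^ 2 / (|X (-ε)| + 1) := min_le_right _ _
  rw [le_div_iff₀ (by positivity)] at h1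
  nlinarith [le_abs_self (X (-ε))]

theorem exists_primitive {a b : ℝ} (hab : a ≤ b) {g : ℝ → ℝ} (hg : ContinuousOn g (Set.Icc a b))
    (T₀ : ℝ) : ∃ T : ℝ → ℝ, T b = T₀ ∧
      ∀ s ∈ Set.Icc a b, HasDerivWithinAt T (g s) (Set.Icc a b) s := by
  set G := Set.IccExtend hab (Set.domRestrict (Set.Icc a b) g) with hG
  have hGc : Continuous G := hg.domRestrict.Icc_extend'
  refine ⟨fun s => T₀ + ∫ t in b..s, G t, by simp, fun s hs => ?_⟩
  have := ((hGc.integral_hasStrictDerivAt b s).hasDerivAt.const_add T₀).hasDerivWithinAt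
    (s := Set.Icc a b)
  refine this.congr_deriv ?_
  rw [hG, Set.IccExtend_of_mem _ _ hs]; rfl

theorem monotoneOn_of_deriv {a b : ℝ} {φ φ' : ℝ → ℝ}
    (hφ : ∀ s ∈ Set.Icc a b, HasDerivWithinAt φ (φ' s) (Set.Icc a b) s)
    (h0 : ∀ s ∈ Set.Icc a b, 0 ≤ φ' s) : MonotoneOn φ (Set.Icc a b) := by
  have := IsOrbit.antitoneOn_of_deriv (φ := fun s => -φ s) (fun s hs => (hφ s hs).neg)
    (fun s hs => neg_nonpos.2 (h0 s (Set.Ioo_subset_Icc_self hs)))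
  intro s hs t ht hst
  have := this hs ht hst
  simp only at this
  linarith

/-- A path that ends at radius `m` with negative velocity, or at a larger radius, is outside the
radius `m` shortly before its end. -/
theorem exists_outside_before {m S d : ℝ} {r : ℝ → ℝ} (hS : 0 < S)
    (hd : HasDerivWithinAt r d (Set.Icc (-S) 0) 0) (h0 : m ≤ r 0) (hend : m < r 0 ∨ d < 0) :
    ∃ ε, 0 < ε ∧ ε ≤ S ∧ ∀ s ∈ Set.Ico (-ε) 0, m < r s := by
  suffices hev : ∀ᶠ s in nhdsWithin (0 : ℝ) (Set.Iio 0), m < r s by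
    obtain ⟨l, hl, hl'⟩ := mem_nhdsLT_iff_exists_Ico_subset.1 hev
    have hl0 : l < 0 := hl
    refine ⟨min (-l) S, lt_min (by linarith) hS, min_le_right _ _, fun s hs => ?_⟩
    exact hl' ⟨by have := min_le_left (-l) S; linarith [hs.1], hs.2⟩
  have hmem : Set.Icc (-S) 0 ∈ nhdsWithin (0 : ℝ) (Set.Iio 0) := by
    filter_upwards [Ioo_mem_nhdsLT (show -S < 0 by linarith)] with s hs
    exact ⟨hs.1.le, hs.2.le⟩
  have hd' := hd.mono_of_mem_nhdsWithin hmem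
  rcases hend with h' | h'
  · exact hd'.continuousWithinAt.eventually (lt_mem_nhds h')
  · rw [hasDerivWithinAt_iff_tendsto_slope' (by simp)] at hd'
    filter_upwards [hd'.eventually (gt_mem_nhds h'), self_mem_nhdsWithin] with s hs hs0
    have hs0' : s < 0 := hs0
    rw [slope_def_field, sub_zero, div_neg_iff] at hs
    rcases hs with hs | hs
    · linarith [hs.1]
    · linarith [hs.2]

/-- The radial motion determines `pv` and `T`, and `T` becomes nonpositive in the past provided
the motion is followed far enough or comes close enough to the horizon. -/
theorem exists_pv_time {m c t₀ L E : ℝ} {r ξ : ℝ → ℝ} (hm : 0 < m) (hE : 0 < E) (hc0 : c ≤ 0)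
    (hr : ∀ s ∈ Set.Icc c 0, m ≤ r s) (hr' : ∀ s ∈ Set.Ico c 0, m < r s)
    (hb : m < r 0 ∨ ξ 0 = -E)
    (hd : ∀ s ∈ Set.Icc c 0, HasDerivWithinAt r (ξ s) (Set.Icc c 0) s)
    (hξ : ∀ s ∈ Set.Icc c 0,
      HasDerivWithinAt ξ (L ^ 2 * ((r s - m) * (r s - 2 * m) / r s ^ 5)) (Set.Icc c 0) s)
    (hen : ∀ s ∈ Set.Icc c 0, ξ s ^ 2 + L ^ 2 * (r s - m) ^ 2 / r s ^ 4 = E ^ 2)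
    (hX : t₀ + E * c ≤ 0 ∨ ∃ s ∈ Set.Ico c 0, t₀ + r s + m ^ 2 / (r s - m) ≤ m ^ 2 / (r c - m)) :
    ∃ pv T : ℝ → ℝ, T 0 = t₀ ∧ T c ≤ 0 ∧ (∀ s ∈ Set.Icc c 0, |ξ s| ≤ E) ∧
      (∀ s ∈ Set.Icc c 0, E ≤ pv s - ξ s) ∧
      (∀ s ∈ Set.Icc c 0, HasDerivWithinAt T (pv s - ξ s) (Set.Icc c 0) s) ∧
      ∀ s ∈ Set.Icc c 0, 0 ≤ pv s ∧
        pv s * (r s - m) ^ 2 = (E + ξ s) * r s ^ 2 ∧ pv s * (E - ξ s) * r s ^ 2 = L ^ 2 ∧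
        HasDerivWithinAt pv ((L ^ 2 - m * (r s - m) * pv s ^ 2) / r s ^ 3) (Set.Icc c 0) s := by
  obtain ⟨pv, hpv⟩ := exists_pv hm hE hr hr' hb hd hξ hen
  have hpvc : ContinuousOn (fun s => pv s - ξ s) (Set.Icc c 0) := fun s hs =>
    (hpv s hs).2.2.2.continuousWithinAt.sub (hξ s hs).continuousWithinAt
  obtain ⟨T, hT0, hT⟩ := exists_primitive hc0 hpvc t₀
  have habs : ∀ s ∈ Set.Icc c 0, |ξ s| ≤ E := fun s hs => by
    apply abs_le_of_sq_le_sq _ hE.le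
    rw [← hen s hs]
    have h0 : 0 < r s := hm.trans_le (hr s hs)
    have : 0 ≤ L ^ 2 * (r s - m) ^ 2 / r s ^ 4 := by positivity
    linarith
  have hpvE : ∀ s ∈ Set.Icc c 0, E ≤ pv s - ξ s := fun s hs => by
    obtain ⟨q0, q1, -, -⟩ := hpv s hs
    have h0 : 0 < r s := hm.trans_le (hr s hs)
    by_contra hlt
    push Not at hlt
    have h2 : (r s - m) ^ 2 ≤ r s ^ 2 := by nlinarith [hr s hs]
    have h3 : pv s * (r s - m) ^ 2 ≤ pv s * r s ^ 2 := by gcongr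
    have h4 : pv s * r s ^ 2 < (E + ξ s) * r s ^ 2 := by
      apply mul_lt_mul_of_pos_right _ (by positivity); linarith
    linarith
  have hTmono : MonotoneOn T (Set.Icc c 0) :=
    monotoneOn_of_deriv hT fun s hs => hE.le.trans (hpvE s hs)
  refine ⟨pv, T, hT0, ?_, habs, hpvE, hT, hpv⟩
  rcases hX with hcS | ⟨s₃, hs₃, hX⟩
  · have hmono : MonotoneOn (fun s => T s - E * s) (Set.Icc c 0) :=
      monotoneOn_of_deriv (fun s hs => (hT s hs).sub
        ((hasDerivWithinAt_id s (Set.Icc c 0)).const_mul E)) fun s hs => by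
          have := hpvE s hs; linarith
    have := hmono (Set.left_mem_Icc.2 hc0) (Set.right_mem_Icc.2 hc0) hc0
    simp only [hT0] at this
    linarith
  · have hs3 : Set.Icc c s₃ ⊆ Set.Icc c 0 := Set.Icc_subset_Icc_right hs₃.2.le
    -- The derivative is at least m²E/(r - m)². Going back, a large m²/(r - m) at c therefore forces
    -- T c to be negative: t* tends to -∞ towards the past horizon.
    have hmono : MonotoneOn (fun s => T s + r s + m ^ 2 * (r s - m)⁻¹) (Set.Icc c s₃) := by
      refine monotoneOn_of_deriv (φ' := fun s => pv s - ξ s + ξ s + m ^ 2 * (-ξ s / (r s - m) ^ 2))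
        (fun s hs => (((hT s (hs3 hs)).add (hd s (hs3 hs))).add
          ((((hd s (hs3 hs)).sub_const m).inv ?_).const_mul (m ^ 2))).mono hs3) fun s hs => ?_
      · exact (sub_pos.2 (hr' s ⟨hs.1, hs.2.trans_lt hs₃.2⟩)).ne'
      · obtain ⟨q0, q1, -, -⟩ := hpv s (hs3 hs)
        have hd : 0 < r s - m := sub_pos.2 (hr' s ⟨hs.1, hs.2.trans_lt hs₃.2⟩)
        have hpve : pv s = (E + ξ s) * r s ^ 2 / (r s - m) ^ 2 := by
          rw [eq_div_iff (by positivity), q1]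
        have e : pv s - ξ s + ξ s + m ^ 2 * (-ξ s / (r s - m) ^ 2)
            = ((E + ξ s) * r s ^ 2 - m ^ 2 * ξ s) / (r s - m) ^ 2 := by
          rw [hpve]; field_simp; ring
        rw [e]
        apply div_nonneg _ (by positivity)
        have h1 := abs_le.1 (habs s (hs3 hs))
        have h2 : m ^ 2 ≤ r s ^ 2 := by gcongr; exact hr s (hs3 hs)
        nlinarith [mul_le_mul_of_nonneg_left h2 (by linarith : 0 ≤ E + ξ s), sq_nonneg m]
    have h1 := hmono (Set.left_mem_Icc.2 hs₃.1) (Set.right_mem_Icc.2 hs₃.1) hs₃.1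
    have h2 := hTmono (⟨hs₃.1, hs₃.2.le⟩ : s₃ ∈ Set.Icc c 0) (Set.right_mem_Icc.2 hc0) hs₃.2.le
    simp only [← div_eq_mul_inv] at h1
    have h3 : m ≤ r c := hr c (Set.left_mem_Icc.2 hc0)
    linarith

theorem pIn_mul_sq {m : ℝ} {x p : Event} (hx : 0 < rad x) :
    pIn x p * (rad x - m) ^ 2 = (energy m x p + pR x p) * rad x ^ 2 := by
  rw [energy_eq, lapse_eq hx]; field_simp; ring

theorem pIn_mul_sub {m : ℝ} {x p : Event} (h : (x, p) ∈ massShell m) :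
    pIn x p * (energy m x p - pR x p) * rad x ^ 2 = (rad x * pAng x p) ^ 2 := by
  rw [mul_pow, pAng_sq_eq h]; ring

/-- The component `p^{t*} + p^r` is determined by the other components and the energy. -/
theorem pIn_unique {m q : ℝ} {x p : Event} (hm : 0 < m) (h : (x, p) ∈ massShell m)
    (hE : 0 < energy m x p) (h1 : q * (rad x - m) ^ 2 = (energy m x p + pR x p) * rad x ^ 2)
    (h2 : q * (energy m x p - pR x p) * rad x ^ 2 = (rad x * pAng x p) ^ 2) : q = pIn x p := by
  have hr0 : 0 < rad x := rad_pos hm h.1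
  have hx : m ≤ rad x := h.1
  rcases hx.eq_or_lt with h' | h'
  · have e3 : pR x p = -energy m x p := by rw [energy_eq, lapse_eq hr0, ← h']; ring
    have e6 : 0 < (energy m x p - pR x p) * rad x ^ 2 := by
      have : 0 < energy m x p - pR x p := by rw [e3]; linarith
      positivity
    rw [← pIn_mul_sub h, mul_assoc, mul_assoc] at h2
    exact mul_right_cancel₀ e6.ne' h2
  · have hd : 0 < rad x - m := sub_pos.2 h'
    rw [← pIn_mul_sq hr0] at h1
    exact mul_right_cancel₀ (by positivity) h1

/-- Every future-directed null vector of positive energy over `{τ > 0}` is reached by a null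
geodesic issuing from `Σ₀`. -/
theorem exists_orbit {m R : ℝ} (hm : 0 < m) (hR : 2 * m < R) {x p : Event}
    (h : (x, p) ∈ massShell m) (hE : 0 < energy m x p) (hτ : 0 < tau m R x) :
    ∃ (a : ℝ) (y v : ℝ → Space) (pv T : ℝ → ℝ),
      IsNullGeodesic m a 0 (fun s => (T s, y s))
        (fun s => (pv s - inner ℝ (y s) (v s) / ‖y s‖, v s)) ∧
      (T 0, y 0) = x ∧ (pv 0 - inner ℝ (y 0) (v 0) / ‖y 0‖, v 0) = p ∧
      tau m R (T a, y a) = 0 ∧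
      IsOrbit m (energy m x p) (rad x * pAng x p) a 0 (fun s => ‖y s‖)
        (fun s => inner ℝ (y s) (v s) / ‖y s‖) pv T := by
  have hx : m ≤ rad x := h.1
  have hr0 : 0 < rad x := rad_pos hm h.1
  have hEsq : pR x p ^ 2 + (rad x * pAng x p) ^ 2 * (rad x - m) ^ 2 / rad x ^ 4 =
      energy m x p ^ 2 := by
    rw [energy_sq_eq h, lapse_eq hr0]
    field_simp
  have hend : m < rad x ∨ pR x p = -energy m x p := by
    rcases hx.eq_or_lt with h' | h'
    · right
      rw [energy_eq, lapse_eq hr0, ← h']; ring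
    · left; exact h'
  have hpIn := fun q => pIn_unique (q := q) hm h hE
  have hL0 : 0 ≤ rad x * pAng x p := mul_nonneg hr0.le (norm_nonneg _)
  have hL2 : (rad x * pAng x p) ^ 2 = ‖x.2‖ ^ 2 * ‖p.2‖ ^ 2 - inner ℝ x.2 p.2 ^ 2 := by
    rw [mul_pow, pAng_sq, inner_eq_rad_mul_pR hr0]
    change _ = rad x ^ 2 * _ - _
    ring
  generalize hEdef : energy m x p = E at *
  generalize hLdef : rad x * pAng x p = L at *
  have ht0 : 0 < x.1 := hτ.trans_le (tau_le hm hR)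
  set φ : ℝ → ℝ := fun q => -(L ^ 2 * m * (3 * q - 2 * m) / q ^ 6) with hφ
  have hφd : ContDiffOn ℝ 1 φ (Set.Ici m) := by
    refine ContDiffOn.neg (ContDiffOn.div (by fun_prop) (by fun_prop) fun q hq => ?_)
    have : 0 < q := hm.trans_le hq
    positivity
  have hφB : ∀ q : ℝ, m ≤ q → |φ q| * q ≤ 3 * L ^ 2 / m ^ 3 := by
    intro q hq
    have hq0 : 0 < q := hm.trans_le hq
    have h1 : 0 ≤ 3 * q - 2 * m := by linarith
    rw [hφ, abs_neg, abs_of_nonneg (by positivity), div_mul_eq_mul_div,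
      div_le_div_iff₀ (by positivity) (by positivity)]
    have h2 : m ^ 4 ≤ q ^ 4 := by gcongr
    calc L ^ 2 * m * (3 * q - 2 * m) * q * m ^ 3 = L ^ 2 * ((3 * q - 2 * m) * q) * m ^ 4 := by ring
      _ ≤ L ^ 2 * ((3 * q) * q) * q ^ 4 := by gcongr; linarith
      _ = 3 * L ^ 2 * q ^ 6 := by ring
  -- Since dT/ds ≥ E, this parameter length brings t* below 0, unless the orbit approaches r = m
  -- earlier.
  obtain ⟨S, hSdef⟩ : ∃ S, S = x.1 / E + 1 := ⟨_, rfl⟩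
  have hS : 0 < S := by rw [hSdef]; positivity
  obtain ⟨y, v, hy0, hv0, hyv⟩ := exists_central_solution hm hφd hφB x.2 p.2 hS
  have hang : ∀ s ∈ Set.Icc (-S) 0,
      L ^ 2 = ‖y s‖ ^ 2 * ‖v s‖ ^ 2 - inner ℝ (y s) (v s) ^ 2 := by
    intro s hs
    rw [central_angular (fun s hs => (hyv s hs).1)
      (φ := fun s => φ (max ‖y s‖ m)) (fun s hs => (hyv s hs).2) s hs, hy0, hv0, hL2]
  have hrc : ContinuousOn (fun s => ‖y s‖) (Set.Icc (-S) 0) := fun s hs =>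
    (hyv s hs).1.continuousWithinAt.norm
  have hξ0 : inner ℝ (y 0) (v 0) / ‖y 0‖ = pR x p := by rw [hy0, hv0]; rfl
  have hr00 : ‖y 0‖ = rad x := by rw [hy0]; rfl
  have hend' : m < ‖y 0‖ ∨ inner ℝ (y 0) (v 0) / ‖y 0‖ = -E := by rwa [hr00, ← hr00, hξ0, hr00]
  have h0mem : (0 : ℝ) ∈ Set.Icc (-S) 0 := ⟨by linarith, le_rfl⟩
  obtain ⟨ε, hε, hεS, hεr⟩ := exists_outside_before (m := m) hS
    (hasDerivWithinAt_norm (hyv 0 h0mem).1 (by rw [hr00]; exact hr0)) (by rw [hr00]; exact hx)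
    (hend'.imp_right fun h => by rw [h]; linarith)
  obtain ⟨c, hc, hcr, hcX⟩ := exists_start
    (X := fun s => x.1 + ‖y s‖ + m ^ 2 / (‖y s‖ - m)) hm hε hεS hrc hεr
  have hsub : Set.Icc c 0 ⊆ Set.Icc (-S) 0 := Set.Icc_subset_Icc_left hc.1
  have hge : ∀ s ∈ Set.Icc c 0, m ≤ ‖y s‖ := fun s hs => by
    rcases hs.2.eq_or_lt with h' | h'
    · rw [h', hr00]; exact hx
    · exact (hcr s ⟨hs.1, h'⟩).le
  have hy : ∀ s ∈ Set.Icc c 0, HasDerivWithinAt y (v s) (Set.Icc c 0) s := fun s hs =>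
    (hyv s (hsub hs)).1.mono hsub
  have hv : ∀ s ∈ Set.Icc c 0, HasDerivWithinAt v
      (-(L ^ 2 * m * (3 * ‖y s‖ - 2 * m) / ‖y s‖ ^ 6) • y s) (Set.Icc c 0) s := fun s hs => by
    have := (hyv s (hsub hs)).2.mono hsub
    rwa [max_eq_left (hge s hs)] at this
  have hangc : ∀ s ∈ Set.Icc c 0,
      L ^ 2 = ‖y s‖ ^ 2 * ‖v s‖ ^ 2 - inner ℝ (y s) (v s) ^ 2 := fun s hs => hang s (hsub hs)
  have hdr : ∀ s ∈ Set.Icc c 0, HasDerivWithinAt (fun s => ‖y s‖)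
      (inner ℝ (y s) (v s) / ‖y s‖) (Set.Icc c 0) s := fun s hs =>
    hasDerivWithinAt_norm (hy s hs) (hm.trans_le (hge s hs))
  have hdξ := central_deriv_radial hm hge hy hv hangc
  have hen : ∀ s ∈ Set.Icc c 0, (inner ℝ (y s) (v s) / ‖y s‖) ^ 2
      + L ^ 2 * (‖y s‖ - m) ^ 2 / ‖y s‖ ^ 4 = E ^ 2 := by
    intro s hs
    rw [radial_energy (r := fun s => ‖y s‖) hm hge hdr hdξ s hs, hξ0, hr00, hEsq]
  have hc0 : c ≤ 0 := hc.2.le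
  obtain ⟨pv, T, hT0, hTc, habs, hpvE, hT, hpv⟩ := exists_pv_time (t₀ := x.1) hm hE hc0 hge hcr
    hend' hdr hdξ hen (hcX.imp_left fun hcS => by
      have e : E * c = -x.1 - E := by rw [hcS, hSdef]; field_simp; ring
      linarith)
  have hτc : ContinuousOn (fun s => tau m R (T s, y s)) (Set.Icc c 0) :=
    (continuous_tau hm hR).comp_continuousOn fun s hs =>
      ((hT s hs).continuousWithinAt).prodMk ((hy s hs).continuousWithinAt)
  have hx0 : (T 0, y 0) = x := by rw [hT0, hy0]
  -- At c one has τ ≤ t* ≤ 0 and at the end τ > 0, so τ vanishes in between.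
  obtain ⟨a, ha, haτ⟩ := intermediate_value_Icc hc0 hτc
    (⟨(tau_le hm hR).trans hTc, by simp only [hx0]; exact hτ.le⟩ : (0 : ℝ) ∈ Set.Icc _ _)
  have hsa : Set.Icc a 0 ⊆ Set.Icc c 0 := Set.Icc_subset_Icc_left ha.1
  have hpv0 : pv 0 = pIn x p := by
    obtain ⟨-, q1, q2, -⟩ := hpv 0 (Set.right_mem_Icc.2 hc0)
    rw [hξ0, hr00] at q1 q2
    exact hpIn _ q1 q2
  refine ⟨a, y, v, pv, T, ?_, hx0, ?_, haτ, ?_⟩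
  · exact isNullGeodesic_of_central hm (fun s hs => hge s (hsa hs))
      (fun s hs => (hy s (hsa hs)).mono hsa) (fun s hs => (hv s (hsa hs)).mono hsa)
      (fun s hs => (hpv s (hsa hs)).2.2.2.mono hsa) (fun s hs => (hT s (hsa hs)).mono hsa)
      (fun s hs => (hpv s (hsa hs)).2.1) (fun s hs => (hpv s (hsa hs)).2.2.1)
      (fun s hs => hangc s (hsa hs)) (fun s hs => hE.trans_le (hpvE s (hsa hs)))
  · rw [hξ0, hpv0, hv0, pIn]
    simp [pT]
  · exact ⟨hm, hE, hL0, ha.2, fun s hs => hge s (hsa hs),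
      fun s hs => hcr s ⟨ha.1.trans hs.1.le, hs.2⟩, fun s hs => (hdr s (hsa hs)).mono hsa,
      fun s hs => (hdξ s (hsa hs)).mono hsa, fun s hs => (hpv s (hsa hs)).2.2.2.mono hsa,
      fun s hs => (hT s (hsa hs)).mono hsa, fun s hs => (hpv s (hsa hs)).2.1,
      fun s hs => (hpv s (hsa hs)).2.2.1, fun s hs => (hpv s (hsa hs)).1,
      fun s hs => habs s (hsa hs)⟩

/-- The generators of the horizon, affinely parametrised by `t*`. -/
theorem isNullGeodesic_generator {m t e : ℝ} (hm : 0 < m) (he : 0 < e) {y : Space}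
    (hy : ‖y‖ = m) : IsNullGeodesic m (-t) 0 (fun s => (e * (s + t), y)) (fun _ => (e, 0)) := by
  have := isNullGeodesic_of_central (m := m) (a := -t) (b := 0) (E := 0) (L := 0) hm
    (y := fun _ => y) (v := fun _ => 0) (pv := fun _ => e) (T := fun s => e * (s + t))
    (fun s _ => hy.ge) (fun s _ => hasDerivWithinAt_const _ _ _)
    (fun s _ => by simpa using hasDerivWithinAt_const s (Set.Icc (-t) 0) (0 : Space))
    (fun s _ => by simpa [hy] using hasDerivWithinAt_const s (Set.Icc (-t) 0) e)
    (fun s _ => by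
      simpa using (((hasDerivAt_id s).add_const t).const_mul e).hasDerivWithinAt
        (s := Set.Icc (-t) 0))
    (fun s _ => by simp [hy]) (fun s _ => by simp) (fun s _ => by simp) (fun s _ => by simpa)
  simpa using this

end ERN

/-! ### Momenta in the support of the solution. -/

namespace ERN

/-- The constant in the definition of the retarded time `τ_•`. -/
noncomputable def retardConst (ρ : ℝ) : ℝ := ρ + 4 * Real.log ρ + 4 * Real.log 2 + 14

theorem retardConst_pos {ρ : ℝ} (hρ : 2 < ρ) : 0 < retardConst ρ := by
  have h1 : 0 < Real.log ρ := Real.log_pos (by linarith)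
  have h2 : 0 < Real.log 2 := Real.log_pos one_lt_two
  rw [retardConst]; positivity

/-- What is known about a null vector `p` over `x` in the support of the solution, when
`τ(x) ≥ τ_•`; `r₀` is the radius at which the geodesic issues from `Σ₀`. -/
structure SupportBounds (m Cr Cp t r₀ : ℝ) (x p : Event) : Prop where
  m_le : m ≤ Cr
  energy_pos : 0 < energy m x p
  energy_le : energy m x p ≤ Cp
  ang_le : (rad x * pAng x p) ^ 2 ≤ 4 * Cr ^ 2 * Cp * energy m x p
  pT_le : pT p ≤ 33 * Cp
  out_le : 2 * m < rad x → (energy m x p - pR x p) * rad x ^ 2 ≤ 16 * energy m x p * Cr ^ 2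
  slow_or_trapped : 0 ≤ t →
    (energy m x p * t ^ 2 ≤ 2304 * Cp * m ^ 2 ∧ (r₀ - m) * t ≤ 48 * m ^ 2) ∨
    |energy m x p - rad x * pAng x p / (4 * m)| ≤
      (energy m x p + rad x * pAng x p / (4 * m)) * Real.exp (-t / (8000 * m))

/-- Long-lived orbits either issue from the vicinity of the horizon and have small energy, or are
almost trapped. -/
theorem IsOrbit.slow_or_trapped {m E L a b Cp t : ℝ} {r ξ pv T : ℝ → ℝ}
    (h : IsOrbit m E L a b r ξ pv T) (hCp : 0 ≤ Cp) (hpv : pv a ≤ 2 * Cp) (ht : 0 ≤ t)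
    (htle : t ≤ (T b - r b - 4 * m * Real.log (r b)) - (T a - r a - 4 * m * Real.log (r a))
      - 12 * r a) :
    (E * t ^ 2 ≤ 2304 * Cp * m ^ 2 ∧ (r a - m) * t ≤ 48 * m ^ 2) ∨
      |E - L / (4 * m)| ≤ (E + L / (4 * m)) * Real.exp (-t / (8000 * m)) := by
  have hm := h.m_pos
  have hE := h.E_pos
  have ha := Set.left_mem_Icc.2 h.le
  have hra := h.r_ge a ha
  have hra0 := h.r_pos ha
  have hina := h.in_eq a ha
  have hpva := h.pv_nonneg a ha
  have hξa := abs_le.1 (h.abs_ξ_le a ha)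
  -- Does the horizon correction account for half of the elapsed time? If not, t/2 remains in the
  -- exponent of `escape`, whence 8000 = 2 · 4000.
  by_cases hslow : t / 2 ≤ 12 * m ^ 2 / E * (pv a * (r a - m) / r a ^ 2)
  · left
    have hd : 0 ≤ r a - m := by linarith
    have e1 : E * t * r a ^ 2 ≤ 24 * m ^ 2 * (pv a * (r a - m)) := by
      have : 12 * m ^ 2 / E * (pv a * (r a - m) / r a ^ 2)
          = 12 * m ^ 2 * (pv a * (r a - m)) / (E * r a ^ 2) := by field_simp
      rw [this, le_div_iff₀ (by positivity)] at hslow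
      linarith
    have e2 : (r a - m) * t ≤ 48 * m ^ 2 := by
      have e3 : (E * r a ^ 2) * ((r a - m) * t) ≤ (E * r a ^ 2) * (48 * m ^ 2) := by
        have e4 := mul_le_mul_of_nonneg_left e1 hd
        have e5 : (r a - m) * (24 * m ^ 2 * (pv a * (r a - m)))
            = 24 * m ^ 2 * ((E + ξ a) * r a ^ 2) := by rw [← hina]; ring
        rw [e5] at e4
        have e6 : 24 * m ^ 2 * ((E + ξ a) * r a ^ 2) ≤ 24 * m ^ 2 * ((2 * E) * r a ^ 2) := by
          gcongr; linarith
        linarith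
      exact le_of_mul_le_mul_left e3 (by positivity)
    refine ⟨?_, e2⟩
    have e7 : (E * t ^ 2) * r a ^ 2 ≤ (2304 * Cp * m ^ 2) * r a ^ 2 := by
      calc (E * t ^ 2) * r a ^ 2 = (E * t * r a ^ 2) * t := by ring
        _ ≤ (24 * m ^ 2 * (pv a * (r a - m))) * t := by gcongr
        _ = 24 * m ^ 2 * pv a * ((r a - m) * t) := by ring
        _ ≤ 24 * m ^ 2 * (2 * Cp) * (48 * m ^ 2) := by gcongr
        _ = (2304 * Cp * m ^ 2) * m ^ 2 := by ring
        _ ≤ _ := by gcongr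
    exact le_of_mul_le_mul_right e7 (by positivity)
  · right
    push Not at hslow
    refine h.escape.trans ?_
    have hL0 := h.L_nonneg
    have hW : 0 ≤ E + L / (4 * m) := by positivity
    refine mul_le_mul_of_nonneg_left (Real.exp_le_exp.2 ?_) hW
    rw [div_le_div_iff₀ (by positivity) (by positivity)]
    nlinarith

/-- The travel time to `x`, measured by the smooth time function. -/
theorem sub_tauDot_le {ρ m Cr : ℝ} (hρ : 2 < ρ) (hm : 0 < m) {x x₀ : Event} (hx : x ∈ exterior m)
    (hx₀ : x₀ ∈ exterior m) (h₀ : tau m (ρ * m) x₀ = 0) (hr : rad x₀ ≤ Cr) :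
    tau m (ρ * m) x - tauDot (retardConst ρ) m Cr ≤
      (x.1 - rad x - 4 * m * Real.log (rad x)) - (x₀.1 - rad x₀ - 4 * m * Real.log (rad x₀))
      - 12 * rad x₀ := by
  have s1 := tau_le_smooth hm hρ hx
  have s2 := smooth_le_tau hm hρ hx₀
  rw [h₀] at s2
  have s4 : Cr ≤ m + Cr ^ 2 / m := by
    have : m + Cr ^ 2 / m - Cr = ((m - Cr / 2) ^ 2 + 3 / 4 * Cr ^ 2) / m := by
      field_simp; ring
    have h5 : 0 ≤ ((m - Cr / 2) ^ 2 + 3 / 4 * Cr ^ 2) / m := by positivity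
    linarith
  have s5 : 0 ≤ Cr ^ 2 / m := by positivity
  have hl1 : 0 < Real.log ρ := Real.log_pos (by linarith)
  have hl2 : 0 < Real.log 2 := Real.log_pos one_lt_two
  have s7 : 0 ≤ (ρ + 4 * Real.log ρ + 4 * Real.log 2 + 2) * (Cr ^ 2 / m) := by
    have : 0 < ρ := by linarith
    positivity
  -- The 14 is 2 + 12: the 2m lost in `smooth_le_tau`, and 12 r(x₀) ≤ 12 C_r ≤ 12 (m + C_r²/m). The
  -- other terms of `retardConst` come from `tau_le_smooth`.
  rw [tauDot, retardConst]
  linarith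

section

variable {ρ m Cr Cp : ℝ} {f₀ f : Phase → ℝ}

theorem le_supNorm {R : ℝ} (hf₀ : IsInitialData m R Cr Cp f₀) {z : Phase}
    (hz : z ∈ initialShell m R) : f₀ z ≤ supNorm m R f₀ :=
  le_csSup hf₀.bounded ⟨z, hz, rfl⟩

theorem supNorm_nonneg {R : ℝ} (hf₀ : IsInitialData m R Cr Cp f₀) : 0 ≤ supNorm m R f₀ :=
  Real.sSup_nonneg (by rintro _ ⟨z, hz, rfl⟩; exact hf₀.nonneg z hz)

theorem mem_suppOn {A : Set Phase} {g : Phase → ℝ} {z : Phase} (hz : z ∈ A) (h : g z ≠ 0) :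
    z ∈ suppOn A g := ⟨hz, subset_closure ⟨hz, h⟩⟩

/-- The value f(x, p) is the datum at the foot of the geodesic through (x, p). At the foot, the
support of f₀ gives r ≤ C_r, pv ≤ 2C_p, E ≤ C_p and L² = pv (E - ξ) r² ≤ 4 C_r² C_p E. The orbit
estimates carry this to x. -/
theorem exists_supportBounds (hρ : 2 < ρ) (hm : 0 < m) (hCp : 0 < Cp)
    (hf₀ : IsInitialData m (ρ * m) Cr Cp f₀) (hf : IsVlasovSolution m (ρ * m) f₀ f)
    {x p : Event} (h : (x, p) ∈ massShell m) (hE : 0 < energy m x p)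
    (hτ : 0 < tau m (ρ * m) x) (hne : f (x, p) ≠ 0) :
    ∃ z₀ ∈ suppOn (initialShell m (ρ * m)) f₀, f (x, p) = f₀ z₀ ∧
      SupportBounds m Cr Cp (tau m (ρ * m) x - tauDot (retardConst ρ) m Cr) (rad z₀.1) x p := by
  have hR : 2 * m < ρ * m := by nlinarith
  obtain ⟨a, y, v, pv, T, hgeo, hx0, hp0, hτa, horb⟩ := exists_orbit hm hR h hE hτ
  have ha := Set.left_mem_Icc.2 horb.le
  have h0 := Set.right_mem_Icc.2 horb.le
  have htr := hf.transport a 0 _ _ horb.le hgeo hτa (by rw [hx0]; exact hτ)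
  simp only [hx0, hp0] at htr
  set z₀ : Phase := ((T a, y a), (pv a - inner ℝ (y a) (v a) / ‖y a‖, v a)) with hz₀
  have hshell : z₀ ∈ initialShell m (ρ * m) := ⟨(hgeo a ha).1, hτa⟩
  have hsupp : z₀ ∈ suppOn (initialShell m (ρ * m)) f₀ := mem_suppOn hshell (htr ▸ hne)
  refine ⟨z₀, hsupp, htr, ?_⟩
  obtain ⟨b1, b2, b3, b4⟩ := hf₀.support z₀ hsupp
  have hξa := abs_le.1 (horb.abs_ξ_le a ha)
  have hra := horb.r_ge a ha
  have hra0 := horb.r_pos ha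
  have hpvle := horb.pv_le (P := 2 * Cp)
  have hout := horb.energy_sub_le
  have hina := horb.in_eq a ha
  have houta := horb.out_eq a ha
  have hpva := horb.pv_nonneg a ha
  have hx02 : ‖y 0‖ = rad x := by rw [← hx0]; rfl
  have hξ0 : inner ℝ (y 0) (v 0) / rad x = pR x p := by rw [← hx0, ← hp0]; rfl
  have hpv0 : pv 0 = pT p + pR x p := by rw [← hξ0, ← hp0, pT, hx02]; ring
  have hT0 : T 0 = x.1 := by rw [← hx0]
  have hradz : rad z₀.1 = ‖y a‖ := rfl
  simp only [hx02, hξ0, hpv0] at hout hpvle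
  rw [hradz] at b1 ⊢
  set ra := ‖y a‖ with hradef
  set ξa := inner ℝ (y a) (v a) / ra with hξadef
  set E := energy m x p with hEdef
  set L := rad x * pAng x p with hLdef
  have hpT0 : pv a - ξa ≤ Cp := b2
  have hpR0 : |ξa| ≤ Cp := b3
  have hpva2 : pv a ≤ 2 * Cp := by linarith [(abs_le.1 hpR0).2]
  have hECp : E ≤ Cp := by
    refine le_trans ?_ hpT0
    by_contra hlt
    push Not at hlt
    have h2 : (ra - m) ^ 2 ≤ ra ^ 2 := by nlinarith
    have h3 : pv a * (ra - m) ^ 2 ≤ pv a * ra ^ 2 := by gcongr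
    have h4 : pv a * ra ^ 2 < (E + ξa) * ra ^ 2 := by
      apply mul_lt_mul_of_pos_right _ (by positivity); linarith
    linarith
  have hEp : 0 < E := hE
  refine ⟨hra.trans b1, hE, hECp, ?_, ?_, ?_, ?_⟩
  · rw [← houta]
    have : 0 ≤ E - ξa := by linarith
    calc pv a * (E - ξa) * ra ^ 2 ≤ (2 * Cp) * (2 * E) * Cr ^ 2 := by
          gcongr; linarith
      _ = 4 * Cr ^ 2 * Cp * E := by ring
  · have h1 := hpvle hpva2 (by linarith)
    have h2 := abs_le.1 (abs_pR_le_energy hE.le h)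
    linarith [h2.1]
  · intro h2m
    refine (hout h2m).trans ?_
    gcongr
  · intro ht
    refine horb.slow_or_trapped hCp.le hpva2 ht ?_
    have := sub_tauDot_le hρ hm h.1 (hgeo a ha).1.1 hτa b1
    simp only [hx02, hT0]
    exact this

/-- On the support of the solution, the momenta are bounded. -/
theorem pT_le_of_ne_zero (hρ : 2 < ρ) (hm : 0 < m) (hCp : 0 < Cp)
    (hf₀ : IsInitialData m (ρ * m) Cr Cp f₀) (hf : IsVlasovSolution m (ρ * m) f₀ f)
    {z : Phase} (hz : z ∈ futureShell m (ρ * m)) (hne : f z ≠ 0) : pT z.2 ≤ 33 * Cp := by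
  obtain ⟨x, p⟩ := z
  obtain ⟨h, hτ⟩ := hz
  have hR : 2 * m < ρ * m := by nlinarith
  rcases hτ.eq_or_lt with hτ | hτ
  · have hi : (x, p) ∈ initialShell m (ρ * m) := ⟨h, hτ.symm⟩
    have := (hf₀.support _ (mem_suppOn hi (hf.initial _ hi ▸ hne))).2.1
    linarith
  by_cases h0 : m < rad x ∨ p.2 ≠ 0
  · obtain ⟨z₀, -, -, hb⟩ := exists_supportBounds hρ hm hCp hf₀ hf h (energy_pos hm h h0) hτ hne
    exact hb.pT_le
  -- What remains are the horizon generators, of zero energy. Their momentum is constant in this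
  -- chart, so the bound on the data carries over.
  · push Not at h0
    have hrad : rad x = m := le_antisymm h0.1 h.1
    have hpT : 0 < pT p := h.2.2
    have hxt : tau m (ρ * m) x = x.1 := by
      rw [tau, if_pos]; rw [hrad]; nlinarith
    have hp : p = (pT p, 0) := Prod.ext rfl h0.2
    have hgeo := isNullGeodesic_generator (t := x.1 / pT p) hm hpT (y := x.2) hrad
    have h1 : 0 < x.1 := by rw [← hxt]; exact hτ
    have hle : -(x.1 / pT p) ≤ 0 := by
      have : 0 < x.1 / pT p := by positivity
      linarith
    have e0 : pT p * (0 + x.1 / pT p) = x.1 := by rw [zero_add]; field_simp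
    have e1 : pT p * (-(x.1 / pT p) + x.1 / pT p) = 0 := by simp
    have hta : tau m (ρ * m) (0, x.2) = 0 := by
      rw [tau, if_pos]; change rad x ≤ _; rw [hrad]; nlinarith
    have htr := hf.transport _ 0 _ _ hle hgeo (by simp only [e1]; exact hta)
      (by simp only [e0]; exact hτ)
    simp only [e0, e1] at htr
    rw [← hp] at htr
    have hi : (((0 : ℝ), x.2), p) ∈ initialShell m (ρ * m) := by
      have := (hgeo _ (Set.left_mem_Icc.2 hle)).1
      simp only [e1] at this
      rw [← hp] at this
      exact ⟨this, hta⟩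
    have hne' : f₀ (((0 : ℝ), x.2), p) ≠ 0 := by
      rw [← htr]; exact hne
    have := (hf₀.support _ (mem_suppOn hi hne')).2.1
    simp only at this ⊢
    linarith

/-- The bound on p^{t*} is a closed condition and so extends to the closed support. Boundedness
matters because `sSup` of an unbounded set is 0. -/
theorem bddAbove_weight (hρ : 2 < ρ) (hm : 0 < m) (hCp : 0 < Cp)
    (hf₀ : IsInitialData m (ρ * m) Cr Cp f₀) (hf : IsVlasovSolution m (ρ * m) f₀ f)
    {w : Phase → ℝ} (hw : IsWeight m w) :
    BddAbove (w '' suppOn (futureShell m (ρ * m)) f) := by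
  refine (hw.boundedInX (33 * Cp) (by positivity)).mono (Set.image_mono ?_)
  rintro z ⟨hz, hcl⟩
  have hpT : pT z.2 ≤ 33 * Cp := by
    have hcls : IsClosed {z : Phase | pT z.2 ≤ 33 * Cp} :=
      isClosed_le (continuous_fst.comp continuous_snd) continuous_const
    refine hcls.closure_subset_iff.2 ?_ hcl
    rintro z ⟨hz, hne⟩
    exact pT_le_of_ne_zero hρ hm hCp hf₀ hf hz hne
  have h := pAng_le_pT_and_abs_pR_le hm (x := z.1) (p := z.2) hz.1
  exact ⟨hz.1, hpT, h.2.trans hpT, h.1.trans hpT⟩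

end

end ERN

/-! ### Measure of the slow and of the almost trapped momenta. -/

namespace ERN

/-- Dyadic decomposition: a quadratic bound for the volume of the sublevel sets of `e` bounds the
integral of `1 / e`. -/
theorem lintegral_inv_le_of_sublevel {α : Type*} [MeasurableSpace α] {μ : Measure α} {e : α → ℝ}
    {Z : Set α} {e₀ K : ℝ} (he₀ : 0 < e₀) (hK : 0 ≤ K) (he : Measurable e) (hZ : MeasurableSet Z)
    (hZe : ∀ z ∈ Z, 0 < e z ∧ e z ≤ e₀)
    (hvol : ∀ t, 0 < t → t ≤ e₀ → μ (Z ∩ {z | e z ≤ t}) ≤ ENNReal.ofReal (K * t ^ 2)) :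
    ∫⁻ z in Z, ENNReal.ofReal (1 / e z) ∂μ ≤ ENNReal.ofReal (4 * K * e₀) := by
  set Zj : ℕ → Set α := fun j => Z ∩ {z | e₀ * (1 / 2) ^ (j + 1) < e z ∧ e z ≤ e₀ * (1 / 2) ^ j}
    with hZj
  have hmeas : ∀ j, MeasurableSet (Zj j) := fun j =>
    hZ.inter ((measurableSet_lt measurable_const he).inter (measurableSet_le he measurable_const))
  have hsub : Z ⊆ ⋃ j, Zj j := by
    intro z hz
    obtain ⟨h1, h2⟩ := hZe z hz
    obtain ⟨n, hn1, hn2⟩ := exists_nat_pow_near_of_lt_one (x := e z / e₀) (y := (1 / 2 : ℝ))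
      (by positivity) ((div_le_one he₀).2 h2) (by norm_num) (by norm_num)
    rw [lt_div_iff₀ he₀] at hn1
    rw [div_le_iff₀ he₀] at hn2
    exact Set.mem_iUnion.2 ⟨n, hz, by linarith, by linarith⟩
  have hj : ∀ j, ∫⁻ z in Zj j, ENNReal.ofReal (1 / e z) ∂μ ≤
      ENNReal.ofReal (2 * K * e₀ * (1 / 2) ^ j) := by
    intro j
    have hp : (0 : ℝ) < (1 / 2) ^ j := by positivity
    have ht : 0 < e₀ * (1 / 2 : ℝ) ^ (j + 1) := by positivity
    calc ∫⁻ z in Zj j, ENNReal.ofReal (1 / e z) ∂μ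
        ≤ ∫⁻ _ in Zj j, ENNReal.ofReal (1 / (e₀ * (1 / 2) ^ (j + 1))) ∂μ := by
          refine setLIntegral_mono' (hmeas j) fun z hz => ENNReal.ofReal_le_ofReal ?_
          exact one_div_le_one_div_of_le ht hz.2.1.le
      _ = ENNReal.ofReal (1 / (e₀ * (1 / 2) ^ (j + 1))) * μ (Zj j) := by
          rw [setLIntegral_const]
      _ ≤ ENNReal.ofReal (1 / (e₀ * (1 / 2) ^ (j + 1))) *
            ENNReal.ofReal (K * (e₀ * (1 / 2) ^ j) ^ 2) := by
          gcongr
          refine (measure_mono ?_).trans (hvol (e₀ * (1 / 2) ^ j) (by positivity) ?_)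
          · exact fun z hz => ⟨hz.1, hz.2.2⟩
          · exact mul_le_of_le_one_right he₀.le (pow_le_one₀ (by norm_num) (by norm_num))
      _ = ENNReal.ofReal (2 * K * e₀ * (1 / 2) ^ j) := by
          rw [← ENNReal.ofReal_mul (by positivity)]
          congr 1
          rw [pow_succ]
          field_simp
  calc ∫⁻ z in Z, ENNReal.ofReal (1 / e z) ∂μ
      ≤ ∫⁻ z in ⋃ j, Zj j, ENNReal.ofReal (1 / e z) ∂μ := lintegral_mono_set hsub
    _ ≤ ∑' j, ∫⁻ z in Zj j, ENNReal.ofReal (1 / e z) ∂μ := lintegral_iUnion_le _ _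
    _ ≤ ∑' j, ENNReal.ofReal (2 * K * e₀ * (1 / 2) ^ j) := ENNReal.tsum_le_tsum hj
    _ = ENNReal.ofReal (∑' j : ℕ, 2 * K * e₀ * (1 / 2) ^ j) := by
        rw [ENNReal.ofReal_tsum_of_nonneg (fun j => by positivity)
          (summable_geometric_two.mul_left _)]
    _ = ENNReal.ofReal (4 * K * e₀) := by
        rw [tsum_mul_left, tsum_geometric_two]; congr 1; ring

/-- Two symmetric intervals between the roots of κ - η² and κ + η², each of length at most 2η
uniformly in κ; `√` is 0 on negative numbers, which covers small κ. Near κ = 0 the width of t is the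
root of the width of t², which halves the exponential rate later. -/
theorem volume_sq_near_le (κ : ℝ) {η : ℝ} (hη : 0 ≤ η) :
    volume {t : ℝ | |t ^ 2 - κ| ≤ η ^ 2} ≤ ENNReal.ofReal (4 * η) := by
  set α := √(κ - η ^ 2)
  set β := √(κ + η ^ 2)
  have hαβ : α ≤ β := Real.sqrt_le_sqrt (by nlinarith)
  have hα : 0 ≤ α := Real.sqrt_nonneg _
  have hdiff : β - α ≤ 2 * η := by
    by_cases h : 0 ≤ κ + η ^ 2
    · have hb : β ^ 2 = κ + η ^ 2 := Real.sq_sqrt h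
      have ha : κ - η ^ 2 ≤ α ^ 2 := by
        rcases le_total 0 (κ - η ^ 2) with h' | h'
        · rw [Real.sq_sqrt h']
        · exact h'.trans (sq_nonneg _)
      by_contra hlt
      push Not at hlt
      nlinarith [mul_nonneg hα (by linarith : 0 ≤ β - α)]
    · have hb : β = 0 := Real.sqrt_eq_zero'.2 (by linarith)
      linarith
  have hsub : {t : ℝ | |t ^ 2 - κ| ≤ η ^ 2} ⊆ Set.Icc α β ∪ Set.Icc (-β) (-α) := by
    intro t ht
    have ht' := abs_le.1 (show |t ^ 2 - κ| ≤ η ^ 2 from ht)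
    have h1 : |t| ≤ β := Real.abs_le_sqrt (by linarith)
    have h2 : α ≤ |t| := by
      rw [← Real.sqrt_sq_eq_abs]; exact Real.sqrt_le_sqrt (by linarith)
    rcases abs_cases t with ⟨h3, -⟩ | ⟨h3, -⟩
    · left; exact ⟨by linarith, by linarith⟩
    · right; exact ⟨by linarith, by linarith⟩
  refine (measure_mono hsub).trans ((measure_union_le _ _).trans ?_)
  rw [Real.volume_Icc, Real.volume_Icc, ← ENNReal.ofReal_add (by linarith) (by linarith)]
  exact ENNReal.ofReal_le_ofReal (by linarith)

/-- Coordinates on momentum space adapted to the radial direction. -/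
theorem exists_radial_coordinates {x : Event} (hx : 0 < rad x) :
    ∃ Ψ : Space → ℝ × (Fin 2 → ℝ), MeasurePreserving Ψ volume volume ∧
      ∀ q, (Ψ q).1 = pR x (0, q) ∧ pAng x (0, q) = √((Ψ q).2 0 ^ 2 + (Ψ q).2 1 ^ 2) := by
  have hn : ‖(rad x)⁻¹ • x.2‖ = 1 := by
    rw [norm_smul, norm_inv, Real.norm_of_nonneg hx.le]
    exact inv_mul_cancel₀ hx.ne'
  obtain ⟨b, hb⟩ := Orthonormal.exists_orthonormalBasis_extension_of_card_eq (𝕜 := ℝ)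
    (E := Space) (ι := Fin 3) (by simp) (v := fun _ => (rad x)⁻¹ • x.2) (s := {0}) (by
      refine ⟨fun i => by simpa using hn, fun i j hij => ?_⟩
      exact absurd (Subsingleton.elim i j) hij)
  have hb0 := hb 0 rfl
  refine ⟨fun q => (MeasurableEquiv.piFinSuccAbove (fun _ : Fin 3 => ℝ) 0)
    ((MeasurableEquiv.toLp 2 (Fin 3 → ℝ)).symm (b.repr q)), ?_, fun q => ?_⟩
  · exact (volume_preserving_piFinSuccAbove (fun _ : Fin 3 => ℝ) 0).comp
      ((EuclideanSpace.volume_preserving_symm_measurableEquiv_toLp (Fin 3)).comp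
        b.measurePreserving_repr)
  · have h0 : b.repr q 0 = pR x (0, q) := by
      rw [b.repr_apply_apply, hb0, real_inner_smul_left, pR]; ring
    refine ⟨h0, ?_⟩
    change _ = √(b.repr q 1 ^ 2 + b.repr q 2 ^ 2)
    have h1 : ‖q‖ ^ 2 = b.repr q 0 ^ 2 + b.repr q 1 ^ 2 + b.repr q 2 ^ 2 := by
      rw [← b.repr.norm_map q, EuclideanSpace.norm_sq_eq, Fin.sum_univ_three]
      simp
    rw [eq_comm, Real.sqrt_eq_iff_eq_sq (by positivity)
      (show 0 ≤ pAng x (0, q) from norm_nonneg _)]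
    rw [pAng_sq, ← h0]
    change _ = ‖q‖ ^ 2 - _
    rw [h1]; ring

/-- The volume of a set of momenta in terms of its slices at fixed angular part. -/
theorem volume_slices_le {x : Event} (hx : 0 < rad x) {S : Set (ℝ × ℝ)} (hS : MeasurableSet S)
    {c : ℝ≥0∞} (hc : ∀ a, volume {t | (t, a) ∈ S} ≤ c) {β : ℝ} (hβ : 0 ≤ β) :
    volume {q : Space | (pR x (0, q), pAng x (0, q)) ∈ S ∧ pAng x (0, q) ≤ β} ≤
      c * ENNReal.ofReal (4 * β ^ 2) := by
  obtain ⟨Ψ, hΨ, hΨq⟩ := exists_radial_coordinates hx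
  set n : (Fin 2 → ℝ) → ℝ := fun w => √(w 0 ^ 2 + w 1 ^ 2) with hn
  have hnm : Measurable n := by fun_prop
  set P : Set (ℝ × (Fin 2 → ℝ)) := {w | (w.1, n w.2) ∈ S ∧ n w.2 ≤ β} with hP
  have hPm : MeasurableSet P :=
    (hS.preimage (measurable_fst.prodMk (hnm.comp measurable_snd))).inter
      (measurableSet_le (hnm.comp measurable_snd) measurable_const)
  have hpre : {q : Space | (pR x (0, q), pAng x (0, q)) ∈ S ∧ pAng x (0, q) ≤ β} = Ψ ⁻¹' P := by
    ext q
    simp only [hP, Set.mem_ofPred_eq, Set.mem_preimage, (hΨq q).1, hn, ← (hΨq q).2]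
  rw [hpre, hΨ.measure_preimage hPm.nullMeasurableSet, Measure.volume_eq_prod,
    Measure.prod_apply_symm hPm]
  have hbox : MeasurableSet (Set.Icc (fun _ : Fin 2 => -β) (fun _ => β)) := measurableSet_Icc
  calc ∫⁻ w, volume ((fun t => (t, w)) ⁻¹' P)
      ≤ ∫⁻ w, (Set.Icc (fun _ : Fin 2 => -β) (fun _ => β)).indicator (fun _ => c) w := by
        refine lintegral_mono fun w => ?_
        by_cases hw : n w ≤ β
        · have hmem : w ∈ Set.Icc (fun _ : Fin 2 => -β) (fun _ => β) := by
            have h0 : |w 0| ≤ β := (Real.abs_le_sqrt (by nlinarith [sq_nonneg (w 1)])).trans hw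
            have h1 : |w 1| ≤ β := (Real.abs_le_sqrt (by nlinarith [sq_nonneg (w 0)])).trans hw
            constructor <;> intro i <;> fin_cases i
            exacts [(abs_le.1 h0).1, (abs_le.1 h1).1, (abs_le.1 h0).2, (abs_le.1 h1).2]
          rw [Set.indicator_of_mem hmem]
          exact (measure_mono fun t ht => ht.1).trans (hc (n w))
        · have : (fun t => (t, w)) ⁻¹' P = ∅ := by
            ext t; simp [hP, hw]
          rw [this]; simp
    _ = c * volume (Set.Icc (fun _ : Fin 2 => -β) (fun _ => β)) := by
        rw [lintegral_indicator hbox, setLIntegral_const]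
    _ = c * ENNReal.ofReal (4 * β ^ 2) := by
        rw [Real.volume_Icc_pi, Fin.prod_univ_two, ← ENNReal.ofReal_mul (by linarith)]
        congr 2; ring

section shellEnergy

variable {m : ℝ} {x : Event}

theorem continuous_pR_snd (x : Event) : Continuous fun q : Space => pR x (0, q) := by
  unfold pR; fun_prop

theorem continuous_pAng_snd (x : Event) : Continuous fun q : Space => pAng x (0, q) := by
  unfold pAng slash pR; fun_prop

theorem continuous_shellEnergy (m : ℝ) (x : Event) : Continuous (shellEnergy m x) := by
  have h1 := continuous_pR_snd x
  have h2 := continuous_pAng_snd x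
  unfold shellEnergy; fun_prop

theorem abs_pR_le_shellEnergy (q : Space) : |pR x (0, q)| ≤ shellEnergy m x q := by
  refine Real.abs_le_sqrt ?_
  have := mul_nonneg (lapse_nonneg m (rad x)) (sq_nonneg (pAng x (0, q)))
  linarith

theorem shellEnergy_sq (q : Space) :
    shellEnergy m x q ^ 2 = pR x (0, q) ^ 2 + lapse m (rad x) * pAng x (0, q) ^ 2 :=
  Real.sq_sqrt (by have := mul_nonneg (lapse_nonneg m (rad x)) (sq_nonneg (pAng x (0, q)));
                   positivity)

/-- The zero momentum lifts to p^{t*} = 0 (with 0 / 0 = 0), which is off the shell. Thus the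
parametrisation never meets the horizon generators. -/
theorem energy_lift_pos (hm : 0 < m) {q : Space} (h : (x, lift m x q) ∈ massShell m) :
    0 < energy m x (lift m x q) := by
  refine energy_pos hm h (Or.inr fun h0 => ?_)
  have hq : q = 0 := h0
  have : 0 < pT (lift m x q) := h.2.2
  simp [hq, pT, lift, pR, pAng, slash] at this

theorem energy_lift_eq (hm : 0 < m) {q : Space} (h : (x, lift m x q) ∈ massShell m) :
    energy m x (lift m x q) = shellEnergy m x q := by
  rw [shellEnergy, eq_comm, Real.sqrt_eq_iff_eq_sq _ (energy_lift_pos hm h).le, energy_sq_eq h]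
  · rfl
  · have := mul_nonneg (lapse_nonneg m (rad x)) (sq_nonneg (pAng x (0, q)))
    positivity

/-- Momenta satisfying the general support bounds, with energy at most `e₀`. -/
def slowSet (m : ℝ) (x : Event) (B e₀ : ℝ) : Set Space :=
  {q | (0 < shellEnergy m x q ∧ shellEnergy m x q ≤ e₀) ∧
    (rad x * pAng x (0, q)) ^ 2 ≤ B * shellEnergy m x q}

/-- Momenta whose impact parameter is close to the critical one. -/
def trappedSet (m : ℝ) (x : Event) (B e₀ ε : ℝ) : Set Space :=
  slowSet m x B e₀ ∩ {q | |shellEnergy m x q - rad x * pAng x (0, q) / (4 * m)| ≤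
    (shellEnergy m x q + rad x * pAng x (0, q) / (4 * m)) * ε}

theorem measurableSet_slowSet (m : ℝ) (x : Event) (B e₀ : ℝ) :
    MeasurableSet (slowSet m x B e₀) := by
  have h1 := (continuous_shellEnergy m x).measurable
  have h2 := (continuous_pAng_snd x).measurable
  have h3 : MeasurableSet
      {q | (rad x * pAng x (0, q)) ^ 2 ≤ B * shellEnergy m x q} :=
    measurableSet_le (by fun_prop) (by fun_prop)
  have h4 : MeasurableSet {q | 0 < shellEnergy m x q ∧ shellEnergy m x q ≤ e₀} :=
    (measurableSet_lt measurable_const h1).inter (measurableSet_le h1 measurable_const)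
  exact h4.inter h3

theorem measurableSet_trappedSet (m : ℝ) (x : Event) (B e₀ ε : ℝ) :
    MeasurableSet (trappedSet m x B e₀ ε) := by
  have h1 := (continuous_shellEnergy m x).measurable
  have h2 := (continuous_pAng_snd x).measurable
  refine (measurableSet_slowSet m x B e₀).inter (measurableSet_le ?_ ?_)
  · exact (h1.sub ((h2.const_mul _).div_const _)).abs
  · fun_prop

/-- If the energy is at most t, then |p^r| ≤ t and |p̸| ≤ √(Bt)/r: a volume of order B t²/r², since
the angular part scales like the root of the energy. The dyadic sum then gives a bound linear in e₀.
-/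
theorem lintegral_slowSet_le (hx : 0 < rad x) {B e₀ : ℝ} (hB : 0 ≤ B) (he₀ : 0 < e₀) :
    ∫⁻ q in slowSet m x B e₀, ENNReal.ofReal (1 / shellEnergy m x q) ≤
      ENNReal.ofReal (32 * B * e₀ / rad x ^ 2) := by
  have := lintegral_inv_le_of_sublevel (μ := (volume : Measure Space)) (K := 8 * B / rad x ^ 2)
    he₀ (by positivity) (continuous_shellEnergy m x).measurable (measurableSet_slowSet m x B e₀)
    (fun q hq => hq.1) (fun t ht _ => ?_)
  · refine this.trans (le_of_eq ?_)
    congr 1; ring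
  · refine (measure_mono (t := {q : Space | (pR x (0, q), pAng x (0, q)) ∈
      {w : ℝ × ℝ | w.1 ∈ Set.Icc (-t) t} ∧ pAng x (0, q) ≤ √(B * t) / rad x}) ?_).trans
      ((volume_slices_le hx (measurable_fst measurableSet_Icc) (c := ENNReal.ofReal (2 * t))
        (fun a => ?_) (by positivity)).trans (le_of_eq ?_))
    · rintro q ⟨⟨⟨h1, -⟩, h2⟩, h3⟩
      have h3' : shellEnergy m x q ≤ t := h3
      refine ⟨abs_le.1 ((abs_pR_le_shellEnergy q).trans h3'), ?_⟩
      rw [le_div_iff₀ hx, mul_comm]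
      exact Real.le_sqrt_of_sq_le (h2.trans (by gcongr))
    · change volume (Set.Icc (-t) t) ≤ _
      rw [Real.volume_Icc]; exact ENNReal.ofReal_le_ofReal (by linarith)
    · rw [← ENNReal.ofReal_mul (by positivity), div_pow, Real.sq_sqrt (by positivity)]
      congr 1; ring

/-- As E² = (p^r)² + Ω²|p̸|², near-criticality at fixed |p̸| puts (p^r)² within (4t√ε)² of
(r|p̸|/4m)² - Ω²|p̸|² when E ≤ t. This uses L/(4m) ≤ 3E, valid for ε ≤ 1/2; for larger ε the
slow-set bound suffices. -/
theorem lintegral_trappedSet_le (hm : 0 < m) (hx : 0 < rad x) {Cr Cp ε : ℝ} (hCr : m ≤ Cr)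
    (hCp : 0 < Cp) (hε : 0 ≤ ε) :
    ∫⁻ q in trappedSet m x (4 * Cr ^ 2 * Cp) Cp ε, ENNReal.ofReal (1 / shellEnergy m x q) ≤
      ENNReal.ofReal (36864 * √ε * (Cp ^ 2 * Cr ^ 2 / rad x ^ 2)) := by
  have hsε := Real.sqrt_nonneg ε
  rcases lt_or_ge (1 / 2) ε with hε2 | hε2
  · refine (lintegral_mono_set Set.inter_subset_left).trans
      ((lintegral_slowSet_le hx (by positivity) hCp).trans (ENNReal.ofReal_le_ofReal ?_))
    have h1 : 1 / 2 ≤ √ε := Real.le_sqrt_of_sq_le (by linarith)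
    have h2 : 0 ≤ Cp ^ 2 * Cr ^ 2 / rad x ^ 2 := by positivity
    have e : 32 * (4 * Cr ^ 2 * Cp) * Cp / rad x ^ 2 = 128 * (Cp ^ 2 * Cr ^ 2 / rad x ^ 2) := by
      ring
    rw [e]
    nlinarith [mul_le_mul_of_nonneg_right h1 h2]
  have := lintegral_inv_le_of_sublevel (μ := (volume : Measure Space))
    (K := 9216 * m ^ 2 * √ε * Cp / rad x ^ 2) hCp (by positivity)
    (continuous_shellEnergy m x).measurable (measurableSet_trappedSet m x (4 * Cr ^ 2 * Cp) Cp ε)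
    (fun q hq => hq.1.1) (fun t ht htC => ?_)
  · refine this.trans (ENNReal.ofReal_le_ofReal ?_)
    calc 4 * (9216 * m ^ 2 * √ε * Cp / rad x ^ 2) * Cp
        = 36864 * √ε * (Cp ^ 2 * m ^ 2 / rad x ^ 2) := by ring
      _ ≤ _ := by gcongr
  · refine (measure_mono (t := {q : Space | (pR x (0, q), pAng x (0, q)) ∈
      {w : ℝ × ℝ | |w.1 ^ 2 - ((rad x * w.2 / (4 * m)) ^ 2 - lapse m (rad x) * w.2 ^ 2)| ≤
        (4 * t * √ε) ^ 2} ∧ pAng x (0, q) ≤ 12 * m * t / rad x}) ?_).trans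
      ((volume_slices_le hx ?_ (c := ENNReal.ofReal (4 * (4 * t * √ε)))
        (fun a => volume_sq_near_le ((rad x * a / (4 * m)) ^ 2 - lapse m (rad x) * a ^ 2)
          (η := 4 * t * √ε) (by positivity)) (by positivity)).trans ?_)
    · rintro q ⟨⟨⟨⟨h1, -⟩, -⟩, h2⟩, h3⟩
      have h3' : shellEnergy m x q ≤ t := h3
      have h2' : |shellEnergy m x q - rad x * pAng x (0, q) / (4 * m)| ≤
        (shellEnergy m x q + rad x * pAng x (0, q) / (4 * m)) * ε := h2
      have hsq := shellEnergy_sq (m := m) (x := x) q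
      have hA : 0 ≤ pAng x (0, q) := norm_nonneg _
      set e := shellEnergy m x q
      set z := rad x * pAng x (0, q) / (4 * m) with hz
      have hz0 : 0 ≤ z := by positivity
      have h4 : (e + z) * ε ≤ (e + z) * (1 / 2) := by gcongr
      have hz3 : z ≤ 3 * e := by linarith [(abs_le.1 h2').1]
      constructor
      · change |pR x (0, q) ^ 2 - (z ^ 2 - lapse m (rad x) * pAng x (0, q) ^ 2)| ≤ _
        have e1 : pR x (0, q) ^ 2 - (z ^ 2 - lapse m (rad x) * pAng x (0, q) ^ 2)
          = (e - z) * (e + z) := by linear_combination -hsq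
        rw [e1, abs_mul, abs_of_nonneg (by positivity : 0 ≤ e + z)]
        calc |e - z| * (e + z) ≤ ((e + z) * ε) * (e + z) := by gcongr
          _ = (e + z) ^ 2 * ε := by ring
          _ ≤ (4 * t) ^ 2 * ε := by gcongr; linarith
          _ = (4 * t * √ε) ^ 2 := by rw [mul_pow _ (√ε), Real.sq_sqrt hε]
      · rw [le_div_iff₀ hx]
        rw [hz, div_le_iff₀ (by positivity)] at hz3
        nlinarith
    · exact measurableSet_le (by fun_prop) (by fun_prop)
    · rw [← ENNReal.ofReal_mul (by positivity)]
      refine ENNReal.ofReal_le_ofReal ?_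
      have : 4 * (4 * t * √ε) * (4 * (12 * m * t / rad x) ^ 2)
          = (9216 * m ^ 2 * √ε / rad x ^ 2 * t ^ 2) * t := by ring
      rw [this]
      calc (9216 * m ^ 2 * √ε / rad x ^ 2 * t ^ 2) * t
          ≤ (9216 * m ^ 2 * √ε / rad x ^ 2 * t ^ 2) * Cp := by gcongr
        _ = _ := by ring

theorem measurable_lift (m : ℝ) (x : Event) : Measurable (lift m x) := by
  have h1 := (continuous_pR_snd x).measurable
  have h2 := (continuous_pAng_snd x).measurable
  have h3 := (continuous_shellEnergy m x).measurable
  refine Measurable.prodMk (Measurable.ite (measurableSet_le h1 measurable_const) ?_ ?_)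
    measurable_id
  · exact h1.abs.add ((h2.pow_const 2).div (h3.add h1.abs))
  · exact (h3.add (h1.const_mul _)).div_const _

theorem measurable_metric_lift (m : ℝ) (x : Event) :
    Measurable fun q => metric m x (lift m x q) (lift m x q) := by
  have h1 : Measurable fun q => pT (lift m x q) := measurable_fst.comp (measurable_lift m x)
  have h2 : Measurable fun q => pR x (lift m x q) := (continuous_pR_snd x).measurable
  have h3 : Measurable fun q => pAng x (lift m x q) := (continuous_pAng_snd x).measurable
  simp only [metric, real_inner_self_eq_norm_sq]
  change Measurable fun q => _ + pAng x (lift m x q) ^ 2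
  fun_prop

theorem measurableSet_shell (m : ℝ) (x : Event) :
    MeasurableSet {q | (x, lift m x q) ∈ massShell m} := by
  have h1 : Measurable fun q => pT (lift m x q) := measurable_fst.comp (measurable_lift m x)
  have h2 : MeasurableSet {q | metric m x (lift m x q) (lift m x q) = 0} :=
    measurableSet_eq_fun (measurable_metric_lift m x) measurable_const
  have h3 : MeasurableSet {q | 0 < pT (lift m x q)} := measurableSet_lt measurable_const h1
  exact (MeasurableSet.const (x ∈ exterior m)).inter (h2.inter h3)

/-- A moment is controlled by pointwise bounds on two sets of momenta covering the support. -/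
theorem moment_le_of_cover (hm : 0 < m) {h : Phase → ℝ} {Z₁ Z₂ : Set Space} {M₁ M₂ : ℝ}
    (hZ₁ : MeasurableSet Z₁) (hZ₂ : MeasurableSet Z₂)
    (hcov : ∀ q, (x, lift m x q) ∈ massShell m → 0 < h (x, lift m x q) →
      (q ∈ Z₁ ∧ h (x, lift m x q) ≤ M₁) ∨ (q ∈ Z₂ ∧ h (x, lift m x q) ≤ M₂)) :
    moment m x h ≤
      ENNReal.ofReal M₁ * (∫⁻ q in Z₁, ENNReal.ofReal (1 / shellEnergy m x q)) +
      ENNReal.ofReal M₂ * (∫⁻ q in Z₂, ENNReal.ofReal (1 / shellEnergy m x q)) := by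
  have hSm := measurableSet_shell m x
  have hem : Measurable fun q => ENNReal.ofReal (1 / shellEnergy m x q) :=
    ((continuous_shellEnergy m x).measurable.const_div 1).ennreal_ofReal
  have hlm := measurable_lift m x
  have hdm : Measurable fun q => ENNReal.ofReal (1 / energy m x (lift m x q)) := by
    have h1 : Measurable fun q => pT (lift m x q) := measurable_fst.comp hlm
    have h2 : Measurable fun q => pR x (lift m x q) := (continuous_pR_snd x).measurable
    simp only [energy_eq, pIn]
    fun_prop
  calc moment m x h
      ≤ ∫⁻ q in {q | (x, lift m x q) ∈ massShell m},
          ENNReal.ofReal (1 / energy m x (lift m x q)) * ENNReal.ofReal (h (x, lift m x q)) :=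
        lintegral_withDensity_le_lintegral_mul _ hdm _
    _ ≤ ∫⁻ q in {q | (x, lift m x q) ∈ massShell m},
          (ENNReal.ofReal M₁ * Z₁.indicator (fun q => ENNReal.ofReal (1 / shellEnergy m x q)) q +
          ENNReal.ofReal M₂ *
            Z₂.indicator (fun q => ENNReal.ofReal (1 / shellEnergy m x q)) q) := by
        refine setLIntegral_mono' hSm fun q hq => ?_
        rw [energy_lift_eq hm hq]
        rcases le_or_gt (h (x, lift m x q)) 0 with h0 | h0
        · rw [ENNReal.ofReal_of_nonpos h0, mul_zero]; exact zero_le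
        rcases hcov q hq h0 with ⟨h1, h2⟩ | ⟨h1, h2⟩
        · refine le_trans ?_ le_self_add
          rw [Set.indicator_of_mem h1, mul_comm]
          gcongr
        · refine le_trans ?_ le_add_self
          rw [Set.indicator_of_mem h1, mul_comm]
          gcongr
    _ ≤ ∫⁻ q, (ENNReal.ofReal M₁ *
            Z₁.indicator (fun q => ENNReal.ofReal (1 / shellEnergy m x q)) q +
          ENNReal.ofReal M₂ * Z₂.indicator (fun q => ENNReal.ofReal (1 / shellEnergy m x q)) q) :=
        setLIntegral_le_lintegral _ _
    _ = _ := by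
        rw [lintegral_add_left ((hem.indicator hZ₁).const_mul _),
          lintegral_const_mul _ (hem.indicator hZ₁), lintegral_const_mul _ (hem.indicator hZ₂),
          lintegral_indicator hZ₁, lintegral_indicator hZ₂]

end shellEnergy

end ERN

/-! ### From measure bounds to decay of moments. -/

namespace ERN

/-- `exp (-y)` decays faster than any power. -/
theorem exists_sqrt_exp_le_rpow {N : ℝ} (hN : 0 ≤ N) : ∃ K : ℝ, 0 < K ∧ ∀ m t : ℝ, 0 < m → 0 < t →
    √(Real.exp (-t / (8000 * m))) ≤ K * (m / t) ^ N := by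
  obtain ⟨n, hn⟩ := exists_nat_ge N
  refine ⟨16000 ^ N * (1 + n.factorial), by positivity, fun m t hm ht => ?_⟩
  set y := t / (16000 * m) with hy
  have hy0 : 0 < y := by positivity
  have h1 : √(Real.exp (-t / (8000 * m))) = Real.exp (-y) := by
    rw [← Real.exp_half, hy]
    congr 1
    field_simp
    norm_num
  have h2 : m / t = 16000⁻¹ * y⁻¹ := by rw [hy]; field_simp
  rw [h1, h2, Real.mul_rpow (by norm_num) (by positivity), Real.inv_rpow (by norm_num),
    Real.inv_rpow hy0.le]
  have h3 : y ^ N ≤ (1 + n.factorial) * Real.exp y := by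
    rcases le_total y 1 with h | h
    · have e1 : y ^ N ≤ 1 := Real.rpow_le_one hy0.le h hN
      have e2 : 1 ≤ Real.exp y := Real.one_le_exp hy0.le
      have e3 : (0 : ℝ) ≤ n.factorial := by positivity
      nlinarith
    · have e1 : y ^ N ≤ y ^ n := by
        rw [← Real.rpow_natCast]; exact Real.rpow_le_rpow_of_exponent_le h hn
      have e2 := Real.pow_div_factorial_le_exp y hy0.le n
      rw [div_le_iff₀ (by positivity)] at e2
      have e3 := Real.exp_pos y
      nlinarith
  have h4 : 0 < y ^ N := by positivity
  have h5 : (16000 : ℝ) ^ N ≠ 0 := by positivity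
  calc Real.exp (-y) = Real.exp (-y) * y ^ N * (y ^ N)⁻¹ := by field_simp
    _ ≤ Real.exp (-y) * ((1 + n.factorial) * Real.exp y) * (y ^ N)⁻¹ := by gcongr
    _ = (Real.exp (-y) * Real.exp y) * (1 + n.factorial) * (y ^ N)⁻¹ := by ring
    _ = _ := by rw [← Real.exp_add, neg_add_cancel, Real.exp_zero]; field_simp

theorem rpow_mul_rpow_mul_rpow_le {A B D α β γ σ i j k a b c : ℝ} (hA : 0 ≤ A) (hB : 0 ≤ B)
    (hD : 0 ≤ D) (hα : 0 ≤ α) (hβ : 0 ≤ β) (hγ : 0 ≤ γ) (hσ : 0 < σ) (ha : 0 ≤ a) (hb : 0 ≤ b)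
    (hc : 0 ≤ c) (hAα : A ≤ α * σ ^ i) (hBβ : B ≤ β * σ ^ j) (hDγ : D ≤ γ * σ ^ k) :
    A ^ a * B ^ b * D ^ c ≤ α ^ a * β ^ b * γ ^ c * σ ^ (i * a + j * b + k * c) := by
  calc A ^ a * B ^ b * D ^ c
      ≤ (α * σ ^ i) ^ a * (β * σ ^ j) ^ b * (γ * σ ^ k) ^ c := by gcongr
    _ = _ := by
      rw [Real.mul_rpow hα (by positivity), Real.mul_rpow hβ (by positivity),
        Real.mul_rpow hγ (by positivity), ← Real.rpow_mul hσ.le, ← Real.rpow_mul hσ.le,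
        ← Real.rpow_mul hσ.le, Real.rpow_add hσ, Real.rpow_add hσ]
      ring

section moments

variable {ρ m Cr Cp : ℝ} {f₀ f : Phase → ℝ} {x : Event}

/-- The moment of `g f` in terms of bounds for `g` on the slow and on the almost trapped part of
the support. -/
theorem moment_mul_le (hρ : 2 < ρ) (hm : 0 < m) (hCp : 0 < Cp)
    (hf₀ : IsInitialData m (ρ * m) Cr Cp f₀) (hf : IsVlasovSolution m (ρ * m) f₀ f)
    (hx : x ∈ exterior m) (hτ : 0 < tau m (ρ * m) x) {t : ℝ}
    (ht : tau m (ρ * m) x - tauDot (retardConst ρ) m Cr = t) (ht0 : 0 ≤ t)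
    {g : Phase → ℝ} {e A₁ A₂ : ℝ} (he : 0 < e) (hA₁ : 0 ≤ A₁) (hA₂ : 0 ≤ A₂)
    (hg : ∀ p, (x, p) ∈ massShell m → f (x, p) ≠ 0 →
      ∀ z₀ ∈ suppOn (initialShell m (ρ * m)) f₀, SupportBounds m Cr Cp t (rad z₀.1) x p →
      (energy m x p * t ^ 2 ≤ 2304 * Cp * m ^ 2 → (rad z₀.1 - m) * t ≤ 48 * m ^ 2 →
        energy m x p ≤ e ∧ g (x, p) ≤ A₁) ∧ g (x, p) ≤ A₂) :
    moment m x (fun z => g z * f z) ≤ ENNReal.ofReal (supNorm m (ρ * m) f₀ *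
      (Cp * Cr ^ 2 / rad x ^ 2) *
        (128 * A₁ * e + 36864 * A₂ * Cp * √(Real.exp (-t / (8000 * m))))) := by
  have hr := rad_pos hm hx
  set S := supNorm m (ρ * m) f₀
  have hS : 0 ≤ S := supNorm_nonneg hf₀
  have key : ∀ q, (x, lift m x q) ∈ massShell m →
      0 < g (x, lift m x q) * f (x, lift m x q) →
      m ≤ Cr ∧ ((q ∈ slowSet m x (4 * Cr ^ 2 * Cp) e ∧
        g (x, lift m x q) * f (x, lift m x q) ≤ A₁ * S) ∨
      (q ∈ trappedSet m x (4 * Cr ^ 2 * Cp) Cp (Real.exp (-t / (8000 * m))) ∧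
        g (x, lift m x q) * f (x, lift m x q) ≤ A₂ * S)) := by
    intro q hq hpos
    have hne : f (x, lift m x q) ≠ 0 := fun h0 => by simp [h0] at hpos
    obtain ⟨z₀, hz₀, hfz, hb⟩ :=
      exists_supportBounds hρ hm hCp hf₀ hf hq (energy_lift_pos hm hq) hτ hne
    rw [ht] at hb
    have hf0 : 0 ≤ f (x, lift m x q) := by rw [hfz]; exact hf₀.nonneg _ hz₀.1
    have hfS : f (x, lift m x q) ≤ S := by rw [hfz]; exact le_supNorm hf₀ hz₀.1
    obtain ⟨hg1, hg2⟩ := hg _ hq hne z₀ hz₀ hb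
    have hmul : ∀ A, 0 ≤ A → g (x, lift m x q) ≤ A →
        g (x, lift m x q) * f (x, lift m x q) ≤ A * S := fun A h0 h1 =>
      mul_le_mul h1 hfS hf0 h0
    refine ⟨hb.m_le, ?_⟩
    have hang := hb.ang_le
    have hEp := hb.energy_pos
    have hEle := hb.energy_le
    have hst := hb.slow_or_trapped ht0
    rcases hst with ⟨h1, h2⟩ | h1
    · obtain ⟨h3, h4⟩ := hg1 h1 h2
      rw [energy_lift_eq hm hq] at hang hEp h3
      exact Or.inl ⟨⟨⟨hEp, h3⟩, hang⟩, hmul _ hA₁ h4⟩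
    · rw [energy_lift_eq hm hq] at hang hEp hEle h1
      exact Or.inr ⟨⟨⟨⟨hEp, hEle⟩, hang⟩, h1⟩, hmul _ hA₂ hg2⟩
  -- If C_r < m, no momentum over x contributes and empty sets cover the support.
  by_cases hCr : m ≤ Cr
  · refine (moment_le_of_cover hm (measurableSet_slowSet m x (4 * Cr ^ 2 * Cp) e)
      (measurableSet_trappedSet m x (4 * Cr ^ 2 * Cp) Cp (Real.exp (-t / (8000 * m))))
      fun q hq hpos => (key q hq hpos).2).trans ?_
    refine (add_le_add (mul_le_mul_right (lintegral_slowSet_le hr (by positivity) he) _)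
      (mul_le_mul_right (lintegral_trappedSet_le hm hr hCr hCp (Real.exp_pos _).le) _)).trans ?_
    rw [← ENNReal.ofReal_mul (by positivity), ← ENNReal.ofReal_mul (by positivity),
      ← ENNReal.ofReal_add (by positivity) (by positivity)]
    refine ENNReal.ofReal_le_ofReal (le_of_eq ?_)
    ring
  · refine (moment_le_of_cover (M₁ := 0) (M₂ := 0) hm MeasurableSet.empty MeasurableSet.empty
      fun q hq hpos => absurd (key q hq hpos).1 hCr).trans ?_
    simp

/-- Power-law decay of the moments of a function bounded by a power of the energy on the
support. -/
theorem exists_moment_mul_le_rpow {n : ℝ} (hn : 0 ≤ n) : ∃ K : ℝ, 0 < K ∧ ∀ {ρ m Cr Cp : ℝ}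
    {f₀ f : Phase → ℝ} {x : Event}, 2 < ρ → 0 < m → 0 < Cp →
    IsInitialData m (ρ * m) Cr Cp f₀ → IsVlasovSolution m (ρ * m) f₀ f →
    x ∈ exterior m → ∀ {t : ℝ}, 0 < tau m (ρ * m) x →
    tau m (ρ * m) x - tauDot (retardConst ρ) m Cr = t → 0 < t →
    ∀ {g : Phase → ℝ} {G : ℝ}, 0 ≤ G →
    (∀ p, (x, p) ∈ massShell m → f (x, p) ≠ 0 → ∀ r₀, SupportBounds m Cr Cp t r₀ x p →
      ∀ σ, 0 < σ → energy m x p ≤ Cp * σ ^ 2 → g (x, p) ≤ G * σ ^ n) →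
    moment m x (fun z => g z * f z) ≤ ENNReal.ofReal (K * supNorm m (ρ * m) f₀ *
      (Cp ^ 2 * Cr ^ 2 / rad x ^ 2) * G * (m / t) ^ (n + 2)) := by
  obtain ⟨K, hK, hKt⟩ := exists_sqrt_exp_le_rpow (N := n + 2) (by positivity)
  refine ⟨128 * 48 ^ (n + 2) + 36864 * K, by positivity, ?_⟩
  intro ρ m Cr Cp f₀ f x hρ hm hCp hf₀ hf hx t hτ ht ht0 g G hG hg
  have hS := supNorm_nonneg hf₀
  have hr := rad_pos hm hx
  set s := m / t with hs
  have hs0 : 0 < s := by positivity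
  -- In the slow case E t² ≤ 2304 C_p m² = C_p (48m)², so σ = 48m/t is admissible. In the trapped
  -- case only σ = 1 is available, and all the decay comes from the measure.
  refine (moment_mul_le (g := g) (e := Cp * (48 * s) ^ 2) (A₁ := G * (48 * s) ^ n) (A₂ := G)
    hρ hm hCp hf₀ hf hx hτ ht ht0.le (by positivity) (by positivity) hG
    fun p hp hne z₀ _ hb => ⟨fun h1 _ => ?_, ?_⟩).trans (ENNReal.ofReal_le_ofReal ?_)
  · have h2 : energy m x p ≤ Cp * (48 * s) ^ 2 := by
      have e : Cp * (48 * s) ^ 2 = 2304 * Cp * m ^ 2 / t ^ 2 := by rw [hs]; ring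
      rw [e, le_div_iff₀ (by positivity)]
      exact h1
    exact ⟨h2, hg p hp hne _ hb _ (by positivity) h2⟩
  · simpa using hg p hp hne _ hb 1 one_pos (by simpa using hb.energy_le)
  · have e1 : (48 * s) ^ n * (48 * s) ^ 2 = 48 ^ (n + 2) * s ^ (n + 2) := by
      rw [← Real.mul_rpow (by norm_num) hs0.le, Real.rpow_add (by positivity), Real.rpow_two]
    calc _ ≤ supNorm m (ρ * m) f₀ * (Cp * Cr ^ 2 / rad x ^ 2) *
          (128 * (G * (48 * s) ^ n) * (Cp * (48 * s) ^ 2) +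
            36864 * G * Cp * (K * s ^ (n + 2))) := by
          gcongr
          exact hKt m t hm ht0
      _ = supNorm m (ρ * m) f₀ * (Cp * Cr ^ 2 / rad x ^ 2) * (G * Cp) *
          (128 * ((48 * s) ^ n * (48 * s) ^ 2) + 36864 * (K * s ^ (n + 2))) := by ring
      _ = _ := by rw [e1]; ring

theorem weight_le_weightSup (hρ : 2 < ρ) (hm : 0 < m) (hCp : 0 < Cp)
    (hf₀ : IsInitialData m (ρ * m) Cr Cp f₀) (hf : IsVlasovSolution m (ρ * m) f₀ f)
    {w : Phase → ℝ} (hw : IsWeight m w) {z : Phase} (hz : z ∈ massShell m)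
    (hτ : 0 ≤ tau m (ρ * m) z.1) (hne : f z ≠ 0) : w z ≤ weightSup m (ρ * m) w f :=
  le_csSup (bddAbove_weight hρ hm hCp hf₀ hf hw) ⟨z, mem_suppOn ⟨hz, hτ⟩ hne, rfl⟩

theorem weightSup_nonneg {w : Phase → ℝ} (hw : IsWeight m w) {R : ℝ} :
    0 ≤ weightSup m R w f := by
  refine Real.sSup_nonneg ?_
  rintro _ ⟨z, hz, rfl⟩
  exact hw.nonneg z hz.1.1

/-- Exponential decay for data supported away from the horizon. -/
theorem moment_weight_le_exp (hρ : 2 < ρ) (hm : 0 < m) (hCp : 0 < Cp)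
    (hf₀ : IsInitialData m (ρ * m) Cr Cp f₀) (hf : IsVlasovSolution m (ρ * m) f₀ f)
    (hx : x ∈ exterior m) (hτ : 0 < tau m (ρ * m) x) {t : ℝ}
    (ht : tau m (ρ * m) x - tauDot (retardConst ρ) m Cr = t) (ht0 : 0 ≤ t) {δ : ℝ} (hδ : 0 < δ)
    (hδ1 : δ < 1)
    (hsupp : ∀ z ∈ suppOn (initialShell m (ρ * m)) f₀, (1 + δ) * m ≤ rad z.1)
    {w : Phase → ℝ} (hw : IsWeight m w) :
    moment m x (fun z => w z * f z) ≤ ENNReal.ofReal (37504 * weightSup m (ρ * m) w f *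
      supNorm m (ρ * m) f₀ * (Cr ^ 2 * Cp ^ 2 / rad x ^ 2) *
        Real.exp (-(2 * (δ / 32000) / m) * t)) := by
  have hS := supNorm_nonneg hf₀
  have hr := rad_pos hm hx
  set W := weightSup m (ρ * m) w f
  have hW : 0 ≤ W := weightSup_nonneg hw
  have hwW : ∀ p, (x, p) ∈ massShell m → f (x, p) ≠ 0 → w (x, p) ≤ W := fun p hp hne =>
    weight_le_weightSup hρ hm hCp hf₀ hf hw hp hτ.le hne
  set X := Real.exp (-(2 * (δ / 32000) / m) * t)
  have htrap : √(Real.exp (-t / (8000 * m))) ≤ X := by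
    rw [← Real.exp_half]
    refine Real.exp_le_exp.2 ?_
    have e : -(2 * (δ / 32000) / m) * t - -t / (8000 * m) / 2
      = (1 - δ) * (t / (16000 * m)) := by field_simp; ring
    have : 0 ≤ (1 - δ) * (t / (16000 * m)) := mul_nonneg (by linarith) (by positivity)
    linarith
  -- A bounds w on slow momenta, where δmt ≤ (r₀ - m)t ≤ 48m². Up to t = 48m/δ the exponential X is
  -- bounded below, so A = W costs only a constant; beyond, there are no slow momenta and A = 0. The
  -- total constant is 128 · 5 + 36864 = 37504.
  obtain ⟨A, hA, hAX, hAw⟩ : ∃ A, 0 ≤ A ∧ A ≤ 5 * W * X ∧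
      ∀ p, (x, p) ∈ massShell m → f (x, p) ≠ 0 → t ≤ 48 * m / δ → w (x, p) ≤ A := by
    by_cases h : t ≤ 48 * m / δ
    · refine ⟨W, hW, ?_, fun p hp hne _ => hwW p hp hne⟩
      have h1 : 1 - 96 / 32000 ≤ X := by
        refine le_trans ?_ (Real.add_one_le_exp _)
        have e : -(2 * (δ / 32000) / m) * t = -(2 / 32000 * (t * δ / m)) := by field_simp
        have h2 : t * δ / m ≤ 48 := by
          rw [le_div_iff₀ hδ] at h
          rwa [div_le_iff₀ hm]
        rw [e]
        linarith
      nlinarith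
    · exact ⟨0, le_rfl, by positivity, fun p _ _ h' => absurd h' h⟩
  refine (moment_mul_le (g := w) (e := Cp) (A₁ := A) (A₂ := W)
    hρ hm hCp hf₀ hf hx hτ ht ht0 hCp hA hW
    fun p hp hne z₀ hz₀ hb => ⟨fun _ h2 => ⟨hb.energy_le, hAw p hp hne ?_⟩, hwW p hp hne⟩).trans
    (ENNReal.ofReal_le_ofReal ?_)
  · have h3 := hsupp z₀ hz₀
    rw [le_div_iff₀ hδ]
    have h4 : δ * m * t ≤ 48 * m ^ 2 := by
      refine le_trans ?_ h2
      gcongr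
      linarith
    exact le_of_mul_le_mul_left (by linarith) hm
  · calc _ ≤ supNorm m (ρ * m) f₀ * (Cp * Cr ^ 2 / rad x ^ 2) *
          (128 * (5 * W * X) * Cp + 36864 * W * Cp * X) := by gcongr
      _ = _ := by ring

end moments

section components

variable {m : ℝ} {x p : Event}

/-- From L² ≤ 4 C_r² C_p E. The angular part is of order √E, so it gains a single power of σ where
p^r gains two. -/
theorem pAng_le_of_energy_le {Cr Cp t r₀ σ : ℝ} (hm : 0 < m) (hx : 0 < rad x) (hCp : 0 < Cp)
    (hb : SupportBounds m Cr Cp t r₀ x p) (hσ : 0 < σ) (hE : energy m x p ≤ Cp * σ ^ 2) :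
    pAng x p ≤ 2 * (Cr / rad x) * Cp * σ := by
  have hCr : 0 < Cr := hm.trans_le hb.m_le
  have h1 : (rad x * pAng x p) ^ 2 ≤ (2 * Cr * Cp * σ) ^ 2 := by
    refine hb.ang_le.trans ?_
    calc 4 * Cr ^ 2 * Cp * energy m x p ≤ 4 * Cr ^ 2 * Cp * (Cp * σ ^ 2) := by gcongr
      _ = _ := by ring
  have h2 := le_of_sq_le_sq h1 (by positivity)
  have e : 2 * (Cr / rad x) * Cp * σ = 2 * Cr * Cp * σ / rad x := by ring
  rw [e, le_div_iff₀ hx]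
  linarith

/-- The hypothesis says Ω ≥ δ/2, and pIn = (E + p^r)/Ω² with p^r ≤ E. -/
theorem pIn_le_of_le_rad (hx : 0 < rad x) {δ : ℝ} (hδ : 0 < δ) (hδr : δ * rad x ≤ 2 * (rad x - m))
    (hp : (x, p) ∈ massShell m) (hE : 0 ≤ energy m x p) : pIn x p ≤ 8 / δ ^ 2 * energy m x p := by
  have h1 := pIn_mul_sq (m := m) (p := p) hx
  have h2 := (abs_le.1 (abs_pR_le_energy hE hp)).2
  have h3 : (δ * rad x) ^ 2 ≤ (2 * (rad x - m)) ^ 2 := by gcongr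
  have h4 : 0 < rad x ^ 2 := by positivity
  have h5 : 0 < rad x - m := by nlinarith [mul_pos hδ hx]
  rcases le_or_gt (pIn x p) 0 with h0 | h0
  · exact h0.trans (by positivity)
  have h6 : pIn x p * (δ * rad x) ^ 2 ≤ 4 * ((energy m x p + pR x p) * rad x ^ 2) := by
    rw [← h1]; nlinarith
  have h7 : rad x ^ 2 * (pIn x p * δ ^ 2) ≤ rad x ^ 2 * (8 * energy m x p) := by nlinarith
  rw [div_mul_eq_mul_div, le_div_iff₀ (by positivity)]
  exact le_of_mul_le_mul_left h7 h4

theorem pT_le_of_le_rad (hm : 0 < m) (hx : 0 < rad x) {δ : ℝ} (hδ : 0 < δ) (hδ1 : δ < 1)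
    (hδr : (1 + δ) * m ≤ rad x) (hp : (x, p) ∈ massShell m) (hE : 0 ≤ energy m x p) :
    pT p ≤ 9 / δ ^ 2 * energy m x p := by
  have h0 : δ * rad x ≤ 2 * (rad x - m) := by
    nlinarith [mul_le_mul_of_nonneg_left hδr (by linarith : 0 ≤ 2 - δ),
      mul_pos (mul_pos hδ (sub_pos.2 hδ1)) hm]
  have h1 := pIn_le_of_le_rad hx hδ h0 hp hE
  have h2 := (abs_le.1 (abs_pR_le_energy hE hp)).1
  have h3 : energy m x p ≤ 1 / δ ^ 2 * energy m x p := by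
    refine le_mul_of_one_le_left hE ?_
    rw [le_div_iff₀ (by positivity)]
    nlinarith
  have e : 9 / δ ^ 2 * energy m x p = 8 / δ ^ 2 * energy m x p + 1 / δ ^ 2 * energy m x p := by ring
  rw [e]
  have h4 : pIn x p = pT p + pR x p := rfl
  linarith

theorem hasDerivAt_bigF {r : ℝ} (hr : m < r) :
    HasDerivAt (bigF m) (r ^ 2 / (r - m) ^ 2 - 1) r := by
  have h0 : r - m ≠ 0 := (sub_pos.2 hr).ne'
  have h1 : HasDerivAt (fun r : ℝ => r - m) 1 r := (hasDerivAt_id r).sub_const m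
  refine (((h1.log h0).const_mul (2 * m)).sub ((h1.inv h0).const_mul (m ^ 2))).congr_deriv ?_
  field_simp
  ring

theorem hasDerivAt_rStar {r : ℝ} (hr : m < r) :
    HasDerivAt (rStar m) (r ^ 2 / (r - m) ^ 2) r := by
  have h : rStar m = fun r => r + bigF m r - (2 * m * Real.log m + m) := by
    funext r; rw [rStar, bigF]; ring
  rw [h]
  exact (((hasDerivAt_id r).add (hasDerivAt_bigF hr)).sub_const _).congr_deriv (by ring)

theorem fderiv_time_add_radial {φ : ℝ → ℝ} {c : ℝ} (hx : 0 < rad x) (hφ : HasDerivAt φ c (rad x)) :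
    fderiv ℝ (fun x : Event => x.1 + φ (rad x)) x p = pT p + c * pR x p := by
  have hd : DifferentiableAt ℝ (fun x : Event => x.1 + φ (rad x)) x :=
    differentiableAt_fst.add (hφ.differentiableAt.comp x (differentiableAt_rad hx))
  rw [← hd.lineDeriv_eq_fderiv]
  refine HasLineDerivAt.lineDeriv ?_
  unfold HasLineDerivAt
  have h1 : HasDerivAt (fun t : ℝ => rad (x + t • p)) (pR x p) 0 := hasDerivAt_norm_line hx
  have h0 : rad (x + (0 : ℝ) • p) = rad x := by simp
  have h2 : HasDerivAt (fun t : ℝ => φ (rad (x + t • p))) (c * pR x p) 0 :=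
    HasDerivAt.comp (0 : ℝ) (h₂ := φ) (by rw [h0]; exact hφ) h1
  have h3 : HasDerivAt (fun t : ℝ => (x + t • p).1) (pT p) 0 := by
    simpa [pT] using ((hasDerivAt_id (0 : ℝ)).mul_const p.1).const_add x.1
  exact h3.add h2

theorem pV_eq (hx : 0 < rad x) (hr : m < rad x) : pV m x p = pIn x p := by
  have h : vCoord m = fun x : Event => x.1 + (rStar m (rad x) - bigF m (rad x)) := by
    funext x; rw [vCoord]; ring
  rw [pV, h, fderiv_time_add_radial (φ := fun r => rStar m r - bigF m r) hx
    ((hasDerivAt_rStar hr).sub (hasDerivAt_bigF hr)), pIn]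
  ring

theorem pU_mul_sq (hx : 0 < rad x) (hr : m < rad x) :
    pU m x p * (rad x - m) ^ 2 = (energy m x p - pR x p) * rad x ^ 2 := by
  have h : uCoord m = fun x : Event => x.1 + -(bigF m (rad x) + rStar m (rad x)) := by
    funext x; rw [uCoord]; ring
  have h0 : rad x - m ≠ 0 := (sub_pos.2 hr).ne'
  have h1 := pIn_mul_sq (m := m) (p := p) hx
  rw [pU, h, fderiv_time_add_radial (φ := fun r => -(bigF m r + rStar m r)) hx
    ((hasDerivAt_bigF hr).add (hasDerivAt_rStar hr)).neg]
  rw [pIn] at h1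
  field_simp
  linear_combination h1

end components

end ERN

/-! ### Polynomial weights and the assembly of the theorem. -/

namespace ERN

section polynomial

variable {a b c : ℝ}

/-- Decay of polynomial moments. -/
theorem exists_moment_pT_le (ha : 0 ≤ a) (hb : 0 ≤ b) (hc : 0 ≤ c) : ∃ K : ℝ, 0 < K ∧
    ∀ {ρ m Cr Cp : ℝ} {f₀ f : Phase → ℝ} {x : Event} {t δ : ℝ}, 2 < ρ → 0 < m → 0 < Cr → 0 < Cp →
    IsInitialData m (ρ * m) Cr Cp f₀ → IsVlasovSolution m (ρ * m) f₀ f →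
    x ∈ exterior m → 0 < tau m (ρ * m) x →
    tau m (ρ * m) x - tauDot (retardConst ρ) m Cr = t → 0 < t → 0 < δ → δ < 1 →
    (1 + δ) * m ≤ rad x →
    moment m x (fun z => |pR z.1 z.2| ^ a * pT z.2 ^ b * pAng z.1 z.2 ^ c * f z) ≤
      ENNReal.ofReal (K / δ ^ (2 * b) * supNorm m (ρ * m) f₀ *
        (Cp ^ (2 + a + b + c) * Cr ^ (2 + c) / rad x ^ (2 + c)) *
        (m / t) ^ (2 * (1 + a + b) + c)) := by
  obtain ⟨K, hK, h⟩ := exists_moment_mul_le_rpow (n := 2 * a + 2 * b + 1 * c) (by positivity)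
  refine ⟨K * (9 ^ b * 2 ^ c), by positivity, ?_⟩
  intro ρ m Cr Cp f₀ f x t δ hρ hm hCr hCp hf₀ hf hx hτ ht ht0 hδ hδ1 hδr
  have hr := rad_pos hm hx
  refine (h hρ hm hCp hf₀ hf hx hτ ht ht0
    (g := fun z => |pR z.1 z.2| ^ a * pT z.2 ^ b * pAng z.1 z.2 ^ c)
    (G := Cp ^ a * (9 / δ ^ 2 * Cp) ^ b * (2 * (Cr / rad x) * Cp) ^ c) (by positivity)
    fun p hp _ r₀ hbd σ hσ hE => ?_).trans (le_of_eq ?_)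
  · have hE0 := hbd.energy_pos.le
    refine rpow_mul_rpow_mul_rpow_le (abs_nonneg _) hp.2.2.le (norm_nonneg _) hCp.le
      (by positivity) (by positivity) hσ ha hb hc ?_ ?_ ?_
    · rw [Real.rpow_two]; exact (abs_pR_le_energy hE0 hp).trans hE
    · rw [Real.rpow_two, mul_assoc]
      exact (pT_le_of_le_rad hm hr hδ hδ1 hδr hp hE0).trans (by gcongr)
    · rw [Real.rpow_one]; exact pAng_le_of_energy_le hm hr hCp hbd hσ hE
  · have e : (δ ^ 2) ^ b = δ ^ (2 * b) := by rw [Real.rpow_mul hδ.le, Real.rpow_two]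
    have e2 : 2 * a + 2 * b + 1 * c + 2 = 2 * (1 + a + b) + c := by ring
    rw [e2, Real.mul_rpow (by positivity) hCp.le, Real.div_rpow (by norm_num) (by positivity), e,
      Real.mul_rpow (by positivity) hCp.le, Real.mul_rpow (by norm_num) (by positivity),
      Real.div_rpow hCr.le hr.le, Real.rpow_add hCp, Real.rpow_add hCp, Real.rpow_add hCp,
      Real.rpow_add hCr, Real.rpow_add hr, Real.rpow_two, Real.rpow_two, Real.rpow_two]
    congr 1
    field_simp

/-- Decay of polynomial moments, up to the horizon. -/
theorem exists_moment_horizon_le (ha : 0 ≤ a) (hb : 0 ≤ b) (hc : 0 ≤ c) : ∃ K : ℝ, 0 < K ∧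
    ∀ {ρ m Cr Cp : ℝ} {f₀ f : Phase → ℝ} {x : Event} {t : ℝ}, 2 < ρ → 0 < m → 0 < Cr → 0 < Cp →
    IsInitialData m (ρ * m) Cr Cp f₀ → IsVlasovSolution m (ρ * m) f₀ f →
    x ∈ exterior m → 0 < tau m (ρ * m) x →
    tau m (ρ * m) x - tauDot (retardConst ρ) m Cr = t → 0 < t →
    moment m x (fun z => |pR z.1 z.2| ^ a * pT z.2 ^ b * pAng z.1 z.2 ^ c * f z) ≤
      ENNReal.ofReal (K * supNorm m (ρ * m) f₀ *
        (Cp ^ (2 + a + b + c) * Cr ^ (2 + c) / rad x ^ (2 + c)) *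
        (m / t) ^ (2 * (1 + a) + c)) := by
  -- Up to the horizon p^{t*} is bounded but not small with the energy, so it gains σ⁰ and b drops
  -- out of the decay rate.
  obtain ⟨K, hK, h⟩ := exists_moment_mul_le_rpow (n := 2 * a + 0 * b + 1 * c) (by positivity)
  refine ⟨K * (33 ^ b * 2 ^ c), by positivity, ?_⟩
  intro ρ m Cr Cp f₀ f x t hρ hm hCr hCp hf₀ hf hx hτ ht ht0
  have hr := rad_pos hm hx
  refine (h hρ hm hCp hf₀ hf hx hτ ht ht0
    (g := fun z => |pR z.1 z.2| ^ a * pT z.2 ^ b * pAng z.1 z.2 ^ c)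
    (G := Cp ^ a * (33 * Cp) ^ b * (2 * (Cr / rad x) * Cp) ^ c) (by positivity)
    fun p hp _ r₀ hbd σ hσ hE => ?_).trans (le_of_eq ?_)
  · have hE0 := hbd.energy_pos.le
    refine rpow_mul_rpow_mul_rpow_le (abs_nonneg _) hp.2.2.le (norm_nonneg _) hCp.le
      (by positivity) (by positivity) hσ ha hb hc ?_ ?_ ?_
    · rw [Real.rpow_two]; exact (abs_pR_le_energy hE0 hp).trans hE
    · rw [Real.rpow_zero, mul_one]; exact hbd.pT_le
    · rw [Real.rpow_one]; exact pAng_le_of_energy_le hm hr hCp hbd hσ hE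
  · have e2 : 2 * a + 0 * b + 1 * c + 2 = 2 * (1 + a) + c := by ring
    rw [e2, Real.mul_rpow (by positivity) hCp.le,
      Real.mul_rpow (by positivity) hCp.le, Real.mul_rpow (by norm_num) (by positivity),
      Real.div_rpow hCr.le hr.le, Real.rpow_add hCp, Real.rpow_add hCp, Real.rpow_add hCp,
      Real.rpow_add hCr, Real.rpow_add hr, Real.rpow_two, Real.rpow_two, Real.rpow_two]
    congr 1
    field_simp

/-- Decay of the moments of the double null components in the wave zone. -/
theorem exists_moment_null_le (ha : 0 ≤ a) (hb : 0 ≤ b) (hc : 0 ≤ c) : ∃ K : ℝ, 0 < K ∧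
    ∀ {ρ m Cr Cp : ℝ} {f₀ f : Phase → ℝ} {x : Event} {t : ℝ}, 2 < ρ → 0 < m → 0 < Cr → 0 < Cp →
    IsInitialData m (ρ * m) Cr Cp f₀ → IsVlasovSolution m (ρ * m) f₀ f →
    x ∈ exterior m → 0 < tau m (ρ * m) x →
    tau m (ρ * m) x - tauDot (retardConst ρ) m Cr = t → 0 < t → ρ * m ≤ rad x →
    moment m x (fun z => |pV m z.1 z.2| ^ a * |pU m z.1 z.2| ^ b * pAng z.1 z.2 ^ c * f z) ≤
      ENNReal.ofReal (K * supNorm m (ρ * m) f₀ *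
        (Cp ^ (2 + a + b + c) * Cr ^ (2 * (1 + b) + c) / rad x ^ (2 * (1 + b) + c)) *
        (m / t) ^ (2 * (1 + a + b) + c)) := by
  obtain ⟨K, hK, h⟩ := exists_moment_mul_le_rpow (n := 2 * a + 2 * b + 1 * c) (by positivity)
  refine ⟨K * (8 ^ a * 64 ^ b * 2 ^ c), by positivity, ?_⟩
  intro ρ m Cr Cp f₀ f x t hρ hm hCr hCp hf₀ hf hx hτ ht ht0 hR
  have hr := rad_pos hm hx
  have h2m : 2 * m < rad x := by nlinarith
  have hmr : m < rad x := by linarith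
  refine (h hρ hm hCp hf₀ hf hx hτ ht ht0
    (g := fun z => |pV m z.1 z.2| ^ a * |pU m z.1 z.2| ^ b * pAng z.1 z.2 ^ c)
    (G := (8 * Cp) ^ a * (64 * (Cr / rad x) ^ 2 * Cp) ^ b * (2 * (Cr / rad x) * Cp) ^ c)
    (by positivity) fun p hp _ r₀ hbd σ hσ hE => ?_).trans (le_of_eq ?_)
  · have hE0 := hbd.energy_pos.le
    refine rpow_mul_rpow_mul_rpow_le (abs_nonneg _) (abs_nonneg _) (norm_nonneg _)
      (by positivity) (by positivity) (by positivity) hσ ha hb hc ?_ ?_ ?_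
    · have h1 := pIn_le_of_le_rad hr one_pos (by linarith) hp hE0
      rw [Real.rpow_two, pV_eq hr hmr, abs_of_nonneg (pIn_nonneg hm hp)]
      nlinarith
    -- For r > 2m, p^u is comparable to E - p^r, and `out_le` supplies the additional factor
    -- (C_r/r)².
    · have h1 := pU_mul_sq (p := p) hr hmr
      have h2 := hbd.out_le h2m
      have h3 := (abs_le.1 (abs_pR_le_energy hE0 hp)).2
      have h4 : 0 < (rad x - m) ^ 2 := pow_pos (by linarith) 2
      have h5 : 0 ≤ pU m x p := by
        refine nonneg_of_mul_nonneg_left ?_ h4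
        rw [h1]
        exact mul_nonneg (by linarith) (by positivity)
      have h6 : rad x ^ 2 ≤ 4 * (rad x - m) ^ 2 := by nlinarith
      rw [Real.rpow_two, abs_of_nonneg h5]
      have h7 : pU m x p * rad x ^ 2 ≤ 64 * Cr ^ 2 * (Cp * σ ^ 2) := by
        calc pU m x p * rad x ^ 2 ≤ pU m x p * (4 * (rad x - m) ^ 2) := by gcongr
          _ ≤ 4 * (16 * energy m x p * Cr ^ 2) := by linarith
          _ ≤ 4 * (16 * (Cp * σ ^ 2) * Cr ^ 2) := by gcongr
          _ = _ := by ring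
      have e : 64 * (Cr / rad x) ^ 2 * Cp * σ ^ 2 = 64 * Cr ^ 2 * (Cp * σ ^ 2) / rad x ^ 2 := by
        ring
      rwa [e, le_div_iff₀ (by positivity)]
    · rw [Real.rpow_one]; exact pAng_le_of_energy_le hm hr hCp hbd hσ hE
  · have e2 : 2 * a + 2 * b + 1 * c + 2 = 2 * (1 + a + b) + c := by ring
    have e3 : 2 * (1 + b) + c = 2 + 2 * b + c := by ring
    have e4 : ((Cr / rad x) ^ 2) ^ b = Cr ^ (2 * b) / rad x ^ (2 * b) := by
      rw [← Real.rpow_two, ← Real.rpow_mul (by positivity), Real.div_rpow hCr.le hr.le]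
    rw [e2, e3, Real.mul_rpow (by norm_num) hCp.le, Real.mul_rpow (by positivity) hCp.le,
      Real.mul_rpow (by norm_num) (by positivity), e4,
      Real.mul_rpow (by positivity) hCp.le, Real.mul_rpow (by norm_num) (by positivity),
      Real.div_rpow hCr.le hr.le, Real.rpow_add hCp, Real.rpow_add hCp, Real.rpow_add hCp,
      Real.rpow_add hCr, Real.rpow_add hr, Real.rpow_add hCr, Real.rpow_add hr, Real.rpow_two,
      Real.rpow_two, Real.rpow_two]
    congr 1
    field_simp

end polynomial

theorem tauDot_pos {ρ m Cr : ℝ} (hρ : 2 < ρ) (hm : 0 < m) : 0 < tauDot (retardConst ρ) m Cr :=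
  mul_pos (retardConst_pos hρ) (by positivity)

end ERN

theorem theorem3p3 (ρ : ℝ) (hρ : 2 < ρ) :
    ∃ C₀ : ℝ, 0 < C₀ ∧ ∃ C : ℝ, 0 < C ∧
      -- general weights: quadratic decay
      (∀ m Cr Cp : ℝ, 0 < m → 0 < Cr → 0 < Cp → ∀ f₀ f : ERN.Phase → ℝ,
        ERN.IsInitialData m (ρ * m) Cr Cp f₀ → ERN.IsVlasovSolution m (ρ * m) f₀ f →
        ∀ w : ERN.Phase → ℝ, ERN.IsWeight m w →
          BddAbove (w '' ERN.suppOn (ERN.futureShell m (ρ * m)) f) ∧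
          ∀ x ∈ ERN.exterior m, ERN.tauDot C₀ m Cr < ERN.tau m (ρ * m) x →
            ERN.moment m x (fun z => w z * f z) ≤
              ENNReal.ofReal (C * ERN.weightSup m (ρ * m) w f * ERN.supNorm m (ρ * m) f₀ *
                (Cp ^ 2 * Cr ^ 2 / ERN.rad x ^ 2) *
                (m ^ 2 / (ERN.tau m (ρ * m) x - ERN.tauDot C₀ m Cr) ^ 2))) ∧
      -- polynomial weights
      (∀ a b c : ℝ, 0 ≤ a → 0 ≤ b → 0 ≤ c → ∃ C' : ℝ, 0 < C' ∧
        ∀ m Cr Cp : ℝ, 0 < m → 0 < Cr → 0 < Cp → ∀ f₀ f : ERN.Phase → ℝ,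
        ERN.IsInitialData m (ρ * m) Cr Cp f₀ → ERN.IsVlasovSolution m (ρ * m) f₀ f →
        ∀ x ∈ ERN.exterior m, ERN.tauDot C₀ m Cr < ERN.tau m (ρ * m) x →
          (∀ δ : ℝ, 0 < δ → δ < 1 →
            ((1 + δ) * m ≤ ERN.rad x →
              ERN.moment m x (fun z =>
                  |ERN.pR z.1 z.2| ^ a * ERN.pT z.2 ^ b * ERN.pAng z.1 z.2 ^ c * f z) ≤
                ENNReal.ofReal (C' / δ ^ (2 * b) * ERN.supNorm m (ρ * m) f₀ *
                  (Cp ^ (2 + a + b + c) * Cr ^ (2 + c) / ERN.rad x ^ (2 + c)) *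
                  (m / (ERN.tau m (ρ * m) x - ERN.tauDot C₀ m Cr)) ^
                    (2 * (1 + a + b) + c))) ∧
            (ERN.rad x ≤ (1 + δ) * m →
              ERN.moment m x (fun z =>
                  |ERN.pR z.1 z.2| ^ a * ERN.pT z.2 ^ b * ERN.pAng z.1 z.2 ^ c * f z) ≤
                ENNReal.ofReal (C' * ERN.supNorm m (ρ * m) f₀ *
                  (Cp ^ (2 + a + b + c) * Cr ^ (2 + c) / ERN.rad x ^ (2 + c)) *
                  (m / (ERN.tau m (ρ * m) x - ERN.tauDot C₀ m Cr)) ^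
                    (2 * (1 + a) + c)))) ∧
          (ρ * m ≤ ERN.rad x →
            ERN.moment m x (fun z =>
                |ERN.pV m z.1 z.2| ^ a * |ERN.pU m z.1 z.2| ^ b * ERN.pAng z.1 z.2 ^ c * f z) ≤
              ENNReal.ofReal (C' * ERN.supNorm m (ρ * m) f₀ *
                (Cp ^ (2 + a + b + c) * Cr ^ (2 * (1 + b) + c) /
                  ERN.rad x ^ (2 * (1 + b) + c)) *
                (m / (ERN.tau m (ρ * m) x - ERN.tauDot C₀ m Cr)) ^
                  (2 * (1 + a + b) + c)))) ∧
      -- data supported away from the horizon: exponential decay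
      (∀ δ : ℝ, 0 < δ → δ < 1 → ∃ κ : ℝ, 0 < κ ∧
        ∀ m Cr Cp : ℝ, 0 < m → 0 < Cr → 0 < Cp → ∀ f₀ f : ERN.Phase → ℝ,
        ERN.IsInitialData m (ρ * m) Cr Cp f₀ → ERN.IsVlasovSolution m (ρ * m) f₀ f →
        (∀ z ∈ ERN.suppOn (ERN.initialShell m (ρ * m)) f₀, (1 + δ) * m ≤ ERN.rad z.1) →
        ∀ w : ERN.Phase → ℝ, ERN.IsWeight m w →
        ∀ x ∈ ERN.exterior m, ERN.tauDot C₀ m Cr ≤ ERN.tau m (ρ * m) x →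
          ERN.moment m x (fun z => w z * f z) ≤
            ENNReal.ofReal (C * ERN.weightSup m (ρ * m) w f * ERN.supNorm m (ρ * m) f₀ *
              (Cr ^ 2 * Cp ^ 2 / ERN.rad x ^ 2) *
              Real.exp (-(κ / m) * (ERN.tau m (ρ * m) x - ERN.tauDot C₀ m Cr))) ∧
          -- improved rate away from the photon sphere `r = 2m`
          (∀ δ' : ℝ, 0 < δ' → δ' < 1 →
            ERN.rad x ∉ Set.Icc ((2 - δ') * m) ((2 + δ') * m) →
            ERN.tauDot C₀ m Cr - m * Real.log δ' ≤ ERN.tau m (ρ * m) x →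
            ERN.moment m x (fun z => w z * f z) ≤
              ENNReal.ofReal (C * ERN.weightSup m (ρ * m) w f * ERN.supNorm m (ρ * m) f₀ *
                (Cr ^ 2 * Cp ^ 2 / ERN.rad x ^ 2) *
                Real.exp (-(2 * κ / m) * (ERN.tau m (ρ * m) x - ERN.tauDot C₀ m Cr))))) := by
  -- With exponent 0 a general weight gains nothing from small energy; the quadratic rate comes from
  -- the measure alone.
  obtain ⟨K, hK, hKr⟩ := ERN.exists_moment_mul_le_rpow (le_refl (0 : ℝ))
  refine ⟨ERN.retardConst ρ, ERN.retardConst_pos hρ, K + 37504, by positivity, ?_, ?_, ?_⟩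
  · intro m Cr Cp hm _ hCp f₀ f hf₀ hf w hw
    refine ⟨ERN.bddAbove_weight hρ hm hCp hf₀ hf hw, fun x hx ht => ?_⟩
    have hτ := (ERN.tauDot_pos (Cr := Cr) hρ hm).trans ht
    have hW := ERN.weightSup_nonneg (f := f) (R := ρ * m) hw
    have hS := ERN.supNorm_nonneg hf₀
    refine (hKr hρ hm hCp hf₀ hf hx hτ rfl (sub_pos.2 ht) (g := w) hW
      fun p hp hne _ _ σ _ _ => ?_).trans (ENNReal.ofReal_le_ofReal ?_)
    · rw [Real.rpow_zero, mul_one]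
      exact ERN.weight_le_weightSup hρ hm hCp hf₀ hf hw hp hτ.le hne
    · rw [zero_add, Real.rpow_two, div_pow]
      calc _ = K * ERN.weightSup m (ρ * m) w f * ERN.supNorm m (ρ * m) f₀ *
            (Cp ^ 2 * Cr ^ 2 / ERN.rad x ^ 2) *
            (m ^ 2 / (ERN.tau m (ρ * m) x - ERN.tauDot (ERN.retardConst ρ) m Cr) ^ 2) := by ring
        _ ≤ _ := by gcongr; linarith
  · intro a b c ha hb hc
    obtain ⟨K₁, hK₁, h₁⟩ := ERN.exists_moment_pT_le ha hb hc
    obtain ⟨K₂, hK₂, h₂⟩ := ERN.exists_moment_horizon_le ha hb hc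
    obtain ⟨K₃, hK₃, h₃⟩ := ERN.exists_moment_null_le ha hb hc
    refine ⟨K₁ + K₂ + K₃, by positivity, ?_⟩
    intro m Cr Cp hm hCr hCp f₀ f hf₀ hf x hx ht
    have hτ := (ERN.tauDot_pos (Cr := Cr) hρ hm).trans ht
    have ht0 := sub_pos.2 ht
    have hr := ERN.rad_pos hm hx
    have hS := ERN.supNorm_nonneg hf₀
    refine ⟨fun δ hδ hδ1 => ⟨fun hδr => ?_, fun _ => ?_⟩, fun hR => ?_⟩
    · refine (h₁ hρ hm hCr hCp hf₀ hf hx hτ rfl ht0 hδ hδ1 hδr).trans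
        (ENNReal.ofReal_le_ofReal ?_)
      gcongr
      linarith
    · refine (h₂ hρ hm hCr hCp hf₀ hf hx hτ rfl ht0).trans (ENNReal.ofReal_le_ofReal ?_)
      gcongr
      linarith
    · refine (h₃ hρ hm hCr hCp hf₀ hf hx hτ rfl ht0 hR).trans (ENNReal.ofReal_le_ofReal ?_)
      gcongr
      linarith
  · intro δ hδ hδ1
    -- Half of the rate δ/16000 in `moment_weight_le_exp`. That lemma gives the doubled rate at
    -- every radius, the photon sphere included, and the first bound is a weakening of it.
    refine ⟨δ / 32000, by positivity, ?_⟩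
    intro m Cr Cp hm _ hCp f₀ f hf₀ hf hsupp w hw x hx ht
    have hτ := (ERN.tauDot_pos (Cr := Cr) hρ hm).trans_le ht
    have ht0 := sub_nonneg.2 ht
    have hW := ERN.weightSup_nonneg (f := f) (R := ρ * m) hw
    have hS := ERN.supNorm_nonneg hf₀
    have key := ERN.moment_weight_le_exp hρ hm hCp hf₀ hf hx hτ rfl ht0 hδ hδ1 hsupp hw
    refine ⟨key.trans (ENNReal.ofReal_le_ofReal ?_),
      fun δ' _ _ _ _ => key.trans (ENNReal.ofReal_le_ofReal ?_)⟩
    · gcongr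
      · linarith
      · have : 0 ≤ δ / 32000 := by positivity
        linarith
    · gcongr
      linarith
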